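/- An instance of undirected Budgeted Middlebox Node Purchase with a single source consists of a finite undirected graph $G=(V,E)$ with edge capacities $B(e)>0$, potential processing capacities $C(v)\ge 0$ and prices $q_v\ge 0$ for $v\in V$, an integer budget $k\ge 0$, a source $s\in V$, and finitely many demand pairs $(s,t_i)$, $t_i \in V$, with demands $R_i\ge 0$. All numbers are rational and are given in binary. A feasible solution is a set $T\subseteq V$ of purchased vertices with $\sum_{v\in T}q_v\le k$, together with a routing: a finite list of routes, each of which sends an amount $p\ge 0$ of flow for some pair $i$ along a walk $\pi$ in $G$ from $s$ to $t_i$ that visits every vertex at most twice, and processes that flow at a vertex $v$ of $\pi$ (possibly an endpoint). It is required that - for every edge $e$, the sum over all routes of $p$ times the number of traversals of $e$ by $\pi$ (in either direction) is at most $B(e)$; - the total amount processed at $v$ is at most $C(v)$ if $v\in T$, and is $0$ if $v\notin T$; - the total amount routed for each pair $i$ is at most $R_i$. The value of the solution is the total amount routed over all pairs, and $\mathrm{OPT}$ is the supremum of the values of all feasible solutions (with real amounts). Theorem. There is a deterministic polynomial-time algorithm which, on every such instance, outputs a feasible solution (the set $T$ and an explicit list of routes with rational amounts) of value at least $$\frac{1-1/e}{8}\cdot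 \mathrm{OPT}.$$ Here polynomial time means that, on a random access machine with logarithmic cost, the running time is bounded by a polynomial in the bit length of the instance. -/

import Mathlib

namespace Middlebox

/-! ## Random access machines with logarithmic cost

A program works on finitely many (those it mentions) unbounded arrays of natural numbers, with
indirect addressing, and on a write-only output tape. Every elementary operation is charged
the total bit length of the numbers (operands, addresses, results) it handles. -/

/-- The arithmetic operations (truncated subtraction, quotient rounded down). -/
inductive Op where
  | add | sub | mul | div

def Op.eval : Op → ℕ → ℕ → ℕ
  | .add, a, b => a + b
  | .sub, a, b => a - b
  | .mul, a, b => a * b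
  | .div, a, b => a / b

inductive Expr where
  | const (c : ℕ)
  /-- The entry of array `a` at the index that is the value of `i`. -/
  | read (a : ℕ) (i : Expr)
  | op (o : Op) (l r : Expr)

/-- Array memory: `m a i` is the entry with index `i` of array `a`. -/
abbrev Mem := ℕ → ℕ → ℕ

def Expr.val (m : Mem) : Expr → ℕ
  | .const c => c
  | .read a i => m a (i.val m)
  | .op o l r => o.eval (l.val m) (r.val m)

/-- The logarithmic cost of evaluating an expression; `Nat.size` is the binary length. -/
def Expr.cost (m : Mem) : Expr → ℕ
  | .const c => 1 + c.size
  | .read a i => i.cost m + (1 + (i.val m).size + (m a (i.val m)).size)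
  | .op o l r => l.cost m + r.cost m +
      (1 + (l.val m).size + (r.val m).size + (o.eval (l.val m) (r.val m)).size)

inductive Prog where
  | skip
  /-- Store the value of `e` in array `a` at the index that is the value of `i`. -/
  | write (a : ℕ) (i e : Expr)
  /-- Append the value of `e` to the output tape. -/
  | emit (e : Expr)
  | seq (p q : Prog)
  /-- Run `p` if the value of `e` is nonzero, and `q` otherwise. -/
  | ite (e : Expr) (p q : Prog)
  /-- Run `p` repeatedly as long as the value of `e` is nonzero. -/
  | loop (e : Expr) (p : Prog)

structure State where
  mem : Mem
  out : List ℕ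

def State.write (σ : State) (a i x : ℕ) : State :=
  { σ with mem := Function.update σ.mem a (Function.update (σ.mem a) i x) }

def State.emit (σ : State) (x : ℕ) : State :=
  { σ with out := σ.out ++ [x] }

/-- `Runs p σ τ t`: started in state `σ`, the program `p` halts in state `τ` at total cost `t`. -/
inductive Runs : Prog → State → State → ℕ → Prop where
  | skip (σ : State) : Runs .skip σ σ 1
  | write (a : ℕ) (i e : Expr) (σ : State) :
      Runs (.write a i e) σ (σ.write a (i.val σ.mem) (e.val σ.mem))
        (i.cost σ.mem + e.cost σ.mem + (1 + (i.val σ.mem).size + (e.val σ.mem).size))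
  | emit (e : Expr) (σ : State) :
      Runs (.emit e) σ (σ.emit (e.val σ.mem)) (e.cost σ.mem + (1 + (e.val σ.mem).size))
  | seq {p q : Prog} {σ τ υ : State} {t u : ℕ} :
      Runs p σ τ t → Runs q τ υ u → Runs (.seq p q) σ υ (t + u)
  | ite_true {e : Expr} {p q : Prog} {σ τ : State} {t : ℕ} :
      e.val σ.mem ≠ 0 → Runs p σ τ t → Runs (.ite e p q) σ τ (e.cost σ.mem + 1 + t)
  | ite_false {e : Expr} {p q : Prog} {σ τ : State} {t : ℕ} :
      e.val σ.mem = 0 → Runs q σ τ t → Runs (.ite e p q) σ τ (e.cost σ.mem + 1 + t)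
  | loop_done {e : Expr} {p : Prog} {σ : State} :
      e.val σ.mem = 0 → Runs (.loop e p) σ σ (e.cost σ.mem + 1)
  | loop_step {e : Expr} {p : Prog} {σ τ υ : State} {t u : ℕ} :
      e.val σ.mem ≠ 0 → Runs p σ τ t → Runs (.loop e p) τ υ u →
        Runs (.loop e p) σ υ (e.cost σ.mem + 1 + t + u)

/-- Programs are deterministic: final state and cost are determined by the initial state. -/
theorem Runs.deterministic {p : Prog} {σ τ τ' : State} {t t' : ℕ}
    (h : Runs p σ τ t) (h' : Runs p σ τ' t') : τ = τ' ∧ t = t' := by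
  induction h generalizing τ' t' with
  | skip | write | emit => cases h'; exact ⟨rfl, rfl⟩
  | seq _ _ ih₁ ih₂ =>
    cases h' with
    | seq a b =>
      obtain ⟨rfl, rfl⟩ := ih₁ a
      obtain ⟨rfl, rfl⟩ := ih₂ b
      exact ⟨rfl, rfl⟩
  | ite_true hc _ ih =>
    cases h' with
    | ite_true _ a => obtain ⟨rfl, rfl⟩ := ih a; exact ⟨rfl, rfl⟩
    | ite_false h0 _ => exact absurd h0 hc
  | ite_false hc _ ih =>
    cases h' with
    | ite_true h0 _ => exact absurd hc h0
    | ite_false _ a => obtain ⟨rfl, rfl⟩ := ih a; exact ⟨rfl, rfl⟩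
  | loop_done hc =>
    cases h' with
    | loop_done => exact ⟨rfl, rfl⟩
    | loop_step h0 => exact absurd hc h0
  | loop_step hc _ _ ih₁ ih₂ =>
    cases h' with
    | loop_done h0 => exact absurd h0 hc
    | loop_step _ a b =>
      obtain ⟨rfl, rfl⟩ := ih₁ a
      obtain ⟨rfl, rfl⟩ := ih₂ b
      exact ⟨rfl, rfl⟩

/-- The initial state on an input: the input words stand in array `0`, everything else is zero,
and the output tape is empty. -/
def initState (input : List ℕ) : State where
  mem := fun a i => if a = 0 then input.getD i 0 else 0
  out := []

/-- The number of bits of an input, with one extra bit per word as a separator. -/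
def bitSize (input : List ℕ) : ℕ := (input.map fun w => w.size + 1).sum

/-! ## Undirected, single-source Budgeted Middlebox Node Purchase -/

/-- An instance, with rational data. Vertices are `0, …, n - 1`; the edges are the pairs of
distinct vertices with positive capacity. -/
structure Instance where
  n : ℕ
  /-- Edge capacities (values on the diagonal play no role). -/
  cap : Sym2 (Fin n) → ℚ≥0
  /-- Potential processing capacities of the vertices. -/
  proc : Fin n → ℚ≥0
  /-- The price of purchasing each vertex. -/
  price : Fin n → ℚ≥0
  budget : ℕ
  /-- The common source of all demand pairs `(source, sink i)`. -/
  source : Fin n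
  numDemands : ℕ
  sink : Fin numDemands → Fin n
  demand : Fin numDemands → ℚ≥0

namespace Instance

variable (I : Instance)

/-- The underlying undirected graph. -/
def graph : SimpleGraph (Fin I.n) where
  Adj u v := u ≠ v ∧ 0 < I.cap s(u, v)
  symm := ⟨fun u v h => ⟨h.1.symm, by rw [Sym2.eq_swap]; exact h.2⟩⟩
  loopless := ⟨fun _ h => h.1 rfl⟩

/-- A nonnegative rational as two words, numerator and (positive) denominator. -/
def encodeRat (x : ℚ≥0) : List ℕ := [x.num, x.den]

/-- The input words of an instance: the four integers, the matrix of edge capacities in row-major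
order, the processing capacities, the prices, and the list of demands. -/
def encode : List ℕ :=
  [I.n, I.source, I.budget, I.numDemands]
    ++ (List.finRange I.n).flatMap (fun u =>
        (List.finRange I.n).flatMap fun v => encodeRat (I.cap s(u, v)))
    ++ (List.finRange I.n).flatMap (fun v => encodeRat (I.proc v))
    ++ (List.finRange I.n).flatMap (fun v => encodeRat (I.price v))
    ++ (List.finRange I.numDemands).flatMap
        (fun i => (I.sink i : ℕ) :: encodeRat (I.demand i))

/-- `amount` units of flow for demand pair `idx`, sent along `walk`, and processed at `node`. -/
structure Route where
  idx : Fin I.numDemands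
  walk : I.graph.Walk I.source (I.sink idx)
  node : Fin I.n
  amount : ℝ

/-- A set of purchased vertices with a routing of processed flow. -/
structure Solution where
  purchased : Finset (Fin I.n)
  routes : List I.Route

variable {I}

/-- The total amount of processed flow that is routed. -/
def Solution.value (S : I.Solution) : ℝ := (S.routes.map Route.amount).sum

structure Solution.Feasible (S : I.Solution) : Prop where
  /-- The purchases are within the budget. -/
  budget : ∑ v ∈ S.purchased, (I.price v : ℝ) ≤ I.budget
  amount_nonneg : ∀ r ∈ S.routes, 0 ≤ r.amount
  /-- Every walk visits every vertex at most twice. -/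
  two_walk : ∀ r ∈ S.routes, ∀ v, r.walk.support.count v ≤ 2
  /-- Flow is processed on its way. -/
  node_mem : ∀ r ∈ S.routes, r.node ∈ r.walk.support
  /-- Edge capacities, shared by both directions; every traversal of an edge counts. -/
  edge_cap : ∀ e ∈ I.graph.edgeSet,
    (S.routes.map fun r => (r.walk.edges.count e : ℝ) * r.amount).sum ≤ I.cap e
  /-- Only purchased vertices process flow, within their processing capacities. -/
  node_cap : ∀ v, ((S.routes.filter fun r => r.node = v).map Route.amount).sum
    ≤ if v ∈ S.purchased then (I.proc v : ℝ) else 0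
  /-- No more than the demand of each pair is routed. -/
  demand_cap : ∀ i, ((S.routes.filter fun r => r.idx = i).map Route.amount).sum ≤ I.demand i

variable (I) in
/-- The optimal value of the instance. -/
noncomputable def opt : ℝ := sSup {x | ∃ S : I.Solution, S.Feasible ∧ S.value = x}

theorem Solution.Feasible.value_le {S : I.Solution} (h : S.Feasible) :
    S.value ≤ ∑ i, (I.demand i : ℝ) := by
  have key : ∀ l : List I.Route, (l.map Route.amount).sum =
      ∑ i, ((l.filter fun r => r.idx = i).map Route.amount).sum := by
    intro l
    induction l with
    | nil => simp
    | cons r l ih =>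
      have : ∀ i, (((r :: l).filter fun r => r.idx = i).map Route.amount).sum =
          (if r.idx = i then r.amount else 0)
            + ((l.filter fun r => r.idx = i).map Route.amount).sum := by
        intro i
        by_cases hi : r.idx = i <;> simp [hi]
      simp only [this, Finset.sum_add_distrib, List.map_cons, List.sum_cons, ih]
      simp
  rw [Solution.value, key]
  exact Finset.sum_le_sum fun i _ => h.demand_cap i

/-- `opt` is a genuine supremum: the set of values is bounded above, and contains `0`. -/
theorem bddAbove_values : BddAbove {x | ∃ S : I.Solution, S.Feasible ∧ S.value = x} :=
  ⟨_, by rintro _ ⟨S, h, rfl⟩; exact h.value_le⟩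

theorem zero_mem_values : (0 : ℝ) ∈ {x | ∃ S : I.Solution, S.Feasible ∧ S.value = x} := by
  refine ⟨⟨∅, []⟩, ⟨by simp, by simp, by simp, by simp, fun e _ => ?_, by simp, fun i => ?_⟩, ?_⟩
  · simpa using NNRat.cast_nonneg (I.cap e)
  · simpa using NNRat.cast_nonneg (I.demand i)
  · simp [Solution.value]

theorem Solution.Feasible.value_le_opt {S : I.Solution} (h : S.Feasible) : S.value ≤ I.opt :=
  le_csSup bddAbove_values ⟨S, h, rfl⟩

/-- The words `w` describe the route `r`: the demand pair, the processing vertex, the amount as a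
(not necessarily reduced) fraction, the number of vertices of the walk, and these vertices. -/
def Route.EncodedBy (r : I.Route) (w : List ℕ) : Prop :=
  ∃ a b : ℕ, 0 < b ∧ r.amount = (a : ℝ) / b ∧
    w = [(r.idx : ℕ), (r.node : ℕ), a, b, r.walk.support.length]
      ++ r.walk.support.map fun v => (v : ℕ)

/-- The words `w` describe the solution `S`: the indicator vector of the purchased set, the number
of routes, and the routes. -/
def Solution.EncodedBy (S : I.Solution) (w : List ℕ) : Prop :=
  ∃ blocks : List (List ℕ), List.Forall₂ Route.EncodedBy S.routes blocks ∧
    w = ((List.finRange I.n).map fun v => if v ∈ S.purchased then 1 else 0)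
      ++ [S.routes.length] ++ blocks.flatten

end Instance

/-- `p` is a polynomial-time `α`-approximation algorithm: on every instance it halts, within a
cost that is polynomial in the bit size of the input, and it outputs a feasible solution
(purchased vertices and routing) of value at least `α` times the optimum. -/
def IsPolyTimeApprox (p : Prog) (α : ℝ) : Prop :=
  ∃ P : Polynomial ℕ, ∀ I : Instance, ∃ (τ : State) (t : ℕ),
    Runs p (initState I.encode) τ t ∧ t ≤ P.eval (bitSize I.encode) ∧
      ∃ S : I.Solution, S.EncodedBy τ.out ∧ S.Feasible ∧ α * I.opt ≤ S.value

end Middlebox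

namespace Middlebox

/-! ## A language of bounded loops, and its compilation -/

/-! Upper bound. Cut every route of a feasible solution with purchases `O` at its processing vertex.
The first pieces carry the whole value from the source into `O`, within the processing capacities,
and the full routes carry it to the sinks, within the demands. Hence the value is at most the
capacity of every cut in each of two single-commodity networks (`value_le_realP`, `value_le_realD`).

Recombination. Because edges are undirected and the source is shared, two such flows can be glued.
Decompose both into unit paths and pair a path `P` to a processing vertex with a path `Q` to a sink.
Go along `P` and process, walk back along `P` until the first vertex that lies on `Q` (the source
does), and then follow `Q` to its sink. The way out is simple, and so is the way back continued by
the rest of `Q`, so no vertex is visited more than twice. An edge pays at most twice for `P` and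
once for `Q`; sending a third of each unit therefore respects all capacities (`exists_follows`,
`exists_solution`).

Purchases. For a fixed unit, the truncated maximum flow to a set of purchased vertices is monotone
and submodular, by uncrossing minimum cuts (`flowP_submod`). Prices are rounded up to multiples of
the `2n`-th part of the budget, so an affordable set costs at most `3n` units, while at most `2n`
are ever spent. For a guessed target `w`, a single pass buys each vertex whose gain per price unit
is at least `w / (4n)`. If a dense vertex no longer fits, the pass together with this vertex is
worth `w / 2`, and one of the two is worth `w / 4`; runs seeded with one vertex cover the second
case. If no dense vertex is refused, the set `O` can add at most `3n * w / (4n)`, so the pass again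
has at least `w / 4` (`exists_greedyT`).

Integrality. The smaller of the two minimum cuts has fewer than `M` summands, all of them input
numbers or zero, so some input number lies between its `M`-th part and itself
(`exists_unit_of_realCut`). All capacities are rounded down to multiples of the `L`-th part of this
number, with `L = 20 (M + 1)`. This loses at most a twentieth, and the flows to be found have at
most `K = M * L` units, so unit augmentations suffice (`exists_unit`). The algorithm tries all
reference numbers, targets and seeds and keeps the best outcome, which gives the factor `19/20 * 1/4
* 1/3 = 19/240` (`le_best`), and this is at least `(1 - 1/e) / 8` because `e < 30/11`.

Running time. The algorithm is written with bounded loops only, whose bounds are parameters computed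
in advance. Stored values never multiply values computed during the run, so each instruction
lengthens words by a bounded number of bits only, and the logarithmic cost is polynomial (`exec`).
-/

instance : Add Expr := ⟨.op .add⟩
instance : Sub Expr := ⟨.op .sub⟩
instance : Mul Expr := ⟨.op .mul⟩
instance : Div Expr := ⟨.op .div⟩
instance (k : ℕ) : OfNat Expr k := ⟨.const k⟩

/-- The scalar variable stored in array `a`. -/
abbrev Expr.var (a : ℕ) : Expr := .read a (.const 0)

@[simp] theorem Expr.val_add (m : Mem) (e f : Expr) : (e + f).val m = e.val m + f.val m := rfl
@[simp] theorem Expr.val_sub (m : Mem) (e f : Expr) : (e - f).val m = e.val m - f.val m := rfl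
@[simp] theorem Expr.val_mul (m : Mem) (e f : Expr) : (e * f).val m = e.val m * f.val m := rfl
@[simp] theorem Expr.val_div (m : Mem) (e f : Expr) : (e / f).val m = e.val m / f.val m := rfl
@[simp] theorem Expr.val_two (m : Mem) : (2 : Expr).val m = 2 := rfl
@[simp] theorem Expr.val_three (m : Mem) : (3 : Expr).val m = 3 := rfl
@[simp] theorem Expr.val_four (m : Mem) : (4 : Expr).val m = 4 := rfl
@[simp] theorem Expr.val_zero (m : Mem) : (0 : Expr).val m = 0 := rfl
@[simp] theorem Expr.val_one (m : Mem) : (1 : Expr).val m = 1 := rfl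
@[simp] theorem Expr.val_const (m : Mem) (k : ℕ) : (Expr.const k).val m = k := rfl
@[simp] theorem Expr.val_read (m : Mem) (a : ℕ) (i : Expr) :
    (Expr.read a i).val m = m a (i.val m) := rfl

def Mem.set (m : Mem) (a i x : ℕ) : Mem := Function.update m a (Function.update (m a) i x)

theorem Mem.set_apply (m : Mem) (a i x b j : ℕ) :
    m.set a i x b j = if b = a ∧ j = i then x else m b j := by
  unfold Mem.set
  by_cases hb : b = a
  · subst hb
    by_cases hj : j = i
    · subst hj; simp
    · simp [hj]
  · simp [hb]

theorem Mem.set_ne (m : Mem) {a b : ℕ} (i x : ℕ) (h : b ≠ a) : m.set a i x b = m b := by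
  simp [Mem.set, h]

theorem Mem.set_self (m : Mem) (a i x : ℕ) : m.set a i x a = Function.update (m a) i x := by
  simp [Mem.set]

/-- All loop bounds sit in array 1, which admissible commands never overwrite. Every command
therefore terminates, and its meaning is a total function on memories. -/
inductive Cmd where
  | skip
  | set (a : ℕ) (i e : Expr)
  | seq (c d : Cmd)
  | ite (e : Expr) (c d : Cmd)
  /-- Run `c` with `x = 0, …, k - 1`, where `k` is entry `p` of array `1`. -/
  | loop (x p : ℕ) (c : Cmd)

infixr:60 " ;; " => Cmd.seq

namespace Cmd

/-- The counter is rewritten after each round, whatever the body did to it. The compiled loop agrees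
with this only when the body leaves the counter alone, which `ok` demands. -/
def iter (f : Mem → Mem) (x : ℕ) : ℕ → Mem → Mem
  | 0, m => m.set x 0 0
  | i + 1, m => (f (iter f x i m)).set x 0 (i + 1)

def run : Cmd → Mem → Mem
  | skip, m => m
  | set a i e, m => m.set a (i.val m) (e.val m)
  | seq c d, m => d.run (c.run m)
  | ite e c d, m => if e.val m ≠ 0 then c.run m else d.run m
  | loop x p c, m => iter c.run x (m 1 p) m

/-- The arrays that a command may write. -/
def writes : Cmd → List ℕ
  | skip => []
  | set a _ _ => [a]
  | seq c d => c.writes ++ d.writes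
  | ite _ c d => c.writes ++ d.writes
  | loop x _ c => x :: c.writes

theorem iter_frame {f : Mem → Mem} {x a : ℕ} (h : ∀ m, f m a = m a) (hx : a ≠ x) (i : ℕ) (m : Mem) :
    iter f x i m a = m a := by
  induction i with
  | zero => exact Mem.set_ne _ _ _ hx
  | succ i ih => rw [iter, Mem.set_ne _ _ _ hx, h, ih]

/-- This reduces all frame conditions of the verification to membership in an explicit list of
numbers. -/
theorem run_frame (c : Cmd) {a : ℕ} (h : a ∉ c.writes) (m : Mem) : c.run m a = m a := by
  induction c generalizing m with
  | skip => rfl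
  | set b i e => exact Mem.set_ne _ _ _ (by simpa [writes] using h)
  | seq c d ihc ihd =>
    simp only [writes, List.mem_append, not_or] at h
    rw [run, ihd h.2, ihc h.1]
  | ite e c d ihc ihd =>
    simp only [writes, List.mem_append, not_or] at h
    rw [run]
    split
    · exact ihc h.1 m
    · exact ihd h.2 m
  | loop x p c ih =>
    simp only [writes, List.mem_cons, not_or] at h
    exact iter_frame (ih h.2) h.1 _ m

@[simp] theorem run_skip (m : Mem) : skip.run m = m := rfl
@[simp] theorem run_set (a : ℕ) (i e : Expr) (m : Mem) :
    (set a i e).run m = m.set a (i.val m) (e.val m) := rfl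
@[simp] theorem run_seq (c d : Cmd) (m : Mem) : (c ;; d).run m = d.run (c.run m) := rfl
theorem run_ite (e : Expr) (c d : Cmd) (m : Mem) :
    (ite e c d).run m = if e.val m ≠ 0 then c.run m else d.run m := rfl

/-- The invariant rule for loops. -/
theorem run_loop_inv {x p : ℕ} {c : Cmd} {m : Mem} (P : ℕ → Mem → Prop)
    (hP : ∀ i m' v, P i m' → P i (m'.set x 0 v))
    (h0 : P 0 m)
    (hs : ∀ i m', i < m 1 p → m' x 0 = i → (∀ a, a ∉ (loop x p c).writes → m' a = m a) →
      P i m' → P (i + 1) (c.run m')) :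
    P (m 1 p) ((loop x p c).run m) := by
  have key : ∀ i, i ≤ m 1 p → P i (iter c.run x i m) ∧ iter c.run x i m x 0 = i := by
    intro i
    induction i with
    | zero => intro _; exact ⟨hP _ _ _ h0, by simp [iter, Mem.set_apply]⟩
    | succ i ih =>
      intro hi
      obtain ⟨h1, h2⟩ := ih (by omega)
      -- A round ends with a rewrite of the counter; `hP` says that the invariant does not notice
      -- it.
      refine ⟨hP _ _ _ (hs i _ (by omega) h2 ?_ h1), by simp [iter, Mem.set_apply]⟩
      intro a ha
      simp only [writes, List.mem_cons, not_or] at ha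
      exact iter_frame (c.run_frame ha.2) ha.1 _ m
  exact (key _ le_rfl).1

/-! ### Cost -/

/-- The truncated difference of bound and counter is nonzero exactly as long as rounds remain. -/
def toProg : Cmd → Prog
  | skip => .skip
  | set a i e => .write a i e
  | seq c d => .seq c.toProg d.toProg
  | ite e c d => .ite e c.toProg d.toProg
  | loop x p c => .seq (.write x 0 0)
      (.loop (.read 1 (.const p) - .var x) (.seq c.toProg (.write x 0 (.var x + 1))))

end Cmd

/-! ### Bit lengths of values and cost of expressions -/

namespace Expr

/-- Constants count with their binary length, so that the values of literals are controlled as well.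
-/
def len : Expr → ℕ
  | const c => 1 + c.size
  | read _ i => 1 + i.len
  | op _ l r => 1 + l.len + r.len

/-- All outermost reads are from the arrays `0` and `1`. -/
def base : Expr → Bool
  | const _ => true
  | read a _ => a == 0 || a == 1
  | op _ l r => l.base && r.base

/-- Products occur only in subexpressions all of whose reads are from the arrays `0` and `1`. -/
def lin : Expr → Bool
  | const _ => true
  | read _ _ => true
  | op .mul l r => l.base && r.base
  | op _ l r => (l.base && r.base) || (l.lin && r.lin)

theorem size_add_le (a b : ℕ) : (a + b).size ≤ max a.size b.size + 1 := by
  rw [Nat.size_le, pow_succ]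
  have h1 : a < 2 ^ max a.size b.size :=
    (Nat.lt_size_self a).trans_le (Nat.pow_le_pow_right (by norm_num) (le_max_left _ _))
  have h2 : b < 2 ^ max a.size b.size :=
    (Nat.lt_size_self b).trans_le (Nat.pow_le_pow_right (by norm_num) (le_max_right _ _))
  omega

theorem size_mul_le (a b : ℕ) : (a * b).size ≤ a.size + b.size := by
  rw [Nat.size_le, pow_add]
  exact Nat.mul_lt_mul'' (Nat.lt_size_self a) (Nat.lt_size_self b)

theorem size_eval_le (o : Op) (a b : ℕ) : (o.eval a b).size ≤ a.size + b.size + 1 := by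
  cases o with
  | add => exact (size_add_le a b).trans (by omega)
  | sub => exact (Nat.size_le_size (Nat.sub_le a b)).trans (by omega)
  | mul => exact (size_mul_le a b).trans (by omega)
  | div => exact (Nat.size_le_size (Nat.div_le_self a b)).trans (by omega)

/-- An operation yields at most one bit more than both operands together, so each symbol contributes
at most `W + 1` bits. -/
theorem size_val_le {m : Mem} {W : ℕ} (h : ∀ a i, (m a i).size ≤ W) (e : Expr) :
    (e.val m).size ≤ e.len * (W + 1) := by
  induction e with
  | const c => simp only [val_const, len]; nlinarith
  | read a i _ => simp only [val_read, len]; nlinarith [h a (i.val m)]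
  | op o l r hl hr =>
    have := size_eval_le o (l.val m) (r.val m)
    simp only [val, len]; nlinarith

/-- Each node of the expression is charged the lengths of a few values, and each of these is linear
in `len`; hence a quadratic bound. -/
theorem cost_le {m : Mem} {W : ℕ} (h : ∀ a i, (m a i).size ≤ W) (e : Expr) :
    e.cost m ≤ 4 * e.len ^ 2 * (W + 1) := by
  induction e with
  | const c => simp only [cost, len]; nlinarith [Nat.zero_le (c.size * W)]
  | read a i hi =>
    have h1 := size_val_le h i
    have h2 := h a (i.val m)
    simp only [cost, len]
    nlinarith
  | op o l r hl hr =>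
    have h1 := size_val_le h l
    have h2 := size_val_le h r
    have h3 := size_eval_le o (l.val m) (r.val m)
    simp only [cost, len]
    have : 4 * (1 + l.len + r.len) ^ 2 * (W + 1) = 4 * l.len ^ 2 * (W + 1) + 4 * r.len ^ 2 * (W + 1)
      + 8 * (l.len * (W + 1)) + 8 * (r.len * (W + 1)) + 4 * (W + 1)
      + 8 * l.len * r.len * (W + 1) := by ring
    rw [this]
    have : 0 ≤ 8 * l.len * r.len * (W + 1) := Nat.zero_le _
    omega

theorem size_base_le {m : Mem} {W : ℕ} (h0 : ∀ i, (m 0 i).size ≤ W) (h1 : ∀ i, (m 1 i).size ≤ W)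
    {e : Expr} (he : e.base = true) : (e.val m).size ≤ e.len * (W + 1) := by
  induction e with
  | const c => simp only [val_const, len]; nlinarith
  | read a i _ =>
    simp only [base, Bool.or_eq_true, beq_iff_eq] at he
    simp only [val_read, len]
    rcases he with rfl | rfl
    · nlinarith [h0 (i.val m)]
    · nlinarith [h1 (i.val m)]
  | op o l r hl hr =>
    simp only [base, Bool.and_eq_true] at he
    have := size_eval_le o (l.val m) (r.val m)
    have h1 := hl he.1
    have h2 := hr he.2
    simp only [val, len]; nlinarith

/-- The point is the coefficient 1 of `W`. Products involve only the read-only arrays, whose words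
have at most `V` bits; every other operation exceeds its longer operand by at most one bit. Word
lengths thus grow additively along a run instead of doubling. -/
theorem size_lin_le {m : Mem} {W V : ℕ} (h0 : ∀ i, (m 0 i).size ≤ V) (h1 : ∀ i, (m 1 i).size ≤ V)
    (h : ∀ a i, (m a i).size ≤ W) {e : Expr} (he : e.lin = true) :
    (e.val m).size ≤ W + e.len * (V + 1) := by
  induction e with
  | const c => simp only [val_const, len]; nlinarith
  | read a i _ => simp only [val_read]; exact (h _ _).trans (by omega)
  | op o l r hl hr =>
    by_cases hb : l.base && r.base
    · exact (size_base_le h0 h1 (e := op o l r) (by simpa [base] using hb)).trans (by omega)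
    · have hlr : o ≠ .mul ∧ l.lin = true ∧ r.lin = true := by
        simp only [Bool.and_eq_true, not_and] at hb
        cases o <;> simp only [lin, Bool.or_eq_true, Bool.and_eq_true] at he
        case mul => exact absurd he.2 (hb he.1)
        all_goals
          rcases he with he | he
          · exact absurd he.2 (hb he.1)
          · exact ⟨by simp, he⟩
      have hl := hl hlr.2.1
      have hr := hr hlr.2.2
      have : (o.eval (l.val m) (r.val m)).size ≤ max (l.val m).size (r.val m).size + 1 := by
        cases o with
        | add => exact size_add_le _ _
        | sub => exact (Nat.size_le_size (Nat.sub_le _ _)).trans (by omega)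
        | mul => exact absurd rfl hlr.1
        | div => exact (Nat.size_le_size (Nat.div_le_self _ _)).trans (by omega)
      simp only [val, len]
      have e : (1 + l.len + r.len) * (V + 1) = V + 1 + l.len * (V + 1) + r.len * (V + 1) := by ring
      rw [e]
      omega

end Expr

namespace Cmd

def len : Cmd → ℕ
  | skip => 1
  | set _ i e => i.len + e.len
  | seq c d => c.len + d.len
  | ite e c d => e.len + c.len + d.len
  | loop _ p c => c.len + p.size + 20

/-- The arrays `0` and `1` and the loop variables are not overwritten, and stored values do not
contain products of variables. -/
def ok : Cmd → Bool
  | skip => true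
  | set a _ e => 2 ≤ a && e.lin
  | seq c d => c.ok && d.ok
  | ite _ c d => c.ok && d.ok
  | loop x _ c => 2 ≤ x && !c.writes.contains x && c.ok

/-- With `B` above all loop bounds this dominates the number of executed instructions. Both branches
of a conditional are counted, which keeps it a polynomial in `B`. -/
def steps (B : ℕ) : Cmd → ℕ
  | skip => 1
  | set _ _ _ => 1
  | seq c d => c.steps B + d.steps B
  | ite _ c d => 1 + c.steps B + d.steps B
  | loop _ _ c => 2 + B * (c.steps B + 2)

noncomputable def stepsPoly : Cmd → Polynomial ℕ
  | skip => 1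
  | set _ _ _ => 1
  | seq c d => c.stepsPoly + d.stepsPoly
  | ite _ c d => 1 + c.stepsPoly + d.stepsPoly
  | loop _ _ c => 2 + .X * (c.stepsPoly + 2)

theorem eval_stepsPoly (c : Cmd) (B : ℕ) : c.stepsPoly.eval B = c.steps B := by
  induction c <;> simp_all [stepsPoly, steps]

theorem ok_writes {c : Cmd} (h : c.ok = true) : 0 ∉ c.writes ∧ 1 ∉ c.writes := by
  induction c with
  | skip => simp [writes]
  | set a i e => simp only [ok, Bool.and_eq_true, decide_eq_true_eq] at h; simp [writes]; omega
  | seq c d hc hd =>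
    simp only [ok, Bool.and_eq_true] at h; simp [writes, hc h.1, hd h.2]
  | ite e c d hc hd =>
    simp only [ok, Bool.and_eq_true] at h; simp [writes, hc h.1, hd h.2]
  | loop x p c hc =>
    simp only [ok, Bool.and_eq_true, decide_eq_true_eq] at h; simp [writes, hc h.2]; omega

theorem Mem.size_set_le {m : Mem} {W W' x : ℕ} (h : ∀ a i, (m a i).size ≤ W) (hW : W ≤ W')
    (hx : x.size ≤ W') (a i b j : ℕ) : (m.set a i x b j).size ≤ W' := by
  rw [Middlebox.Mem.set_apply]
  split
  · exact hx
  · exact (h b j).trans hW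

theorem write_eq (σ : State) (a i x : ℕ) : σ.write a i x = ⟨σ.mem.set a i x, σ.out⟩ := rfl

/-- One common bound, `20 * l ^ 2 * (W + 1)`, serves for every elementary instruction. -/
theorem cost_arith {l i e W : ℕ} (hl : i + e ≤ l) (h1 : 1 ≤ l) :
    4 * i ^ 2 * (W + 1) + 4 * e ^ 2 * (W + 1) + (1 + i * (W + 1) + e * (W + 1))
      ≤ 20 * l ^ 2 * (W + 1) := by
  have : 4 * i ^ 2 + 4 * e ^ 2 + 1 + i + e ≤ 20 * l ^ 2 := by nlinarith
  nlinarith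

theorem cond_cost {m : Mem} {W l p : ℕ} (x : ℕ) (h : ∀ a i, (m a i).size ≤ W) (hl : p.size + 20 ≤ l) :
    (Expr.read 1 (.const p) - Expr.var x).cost m + 1 ≤ 20 * l ^ 2 * (W + 1) := by
  have hc := Expr.cost_le h (.read 1 (.const p) - .var x)
  have hlen : (Expr.read 1 (.const p) - Expr.var x).len = 5 + p.size := by
    change 1 + (1 + (1 + p.size)) + (1 + (1 + Nat.size 0)) = _
    rw [Nat.size_zero]; ring
  rw [hlen] at hc
  have := cost_arith (W := W) (l := l) (i := 5 + p.size) (e := 0) (by omega) (by omega)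
  omega

theorem write_cost {m : Mem} {W l : ℕ} {e : Expr} (h : ∀ a i, (m a i).size ≤ W)
    (he : e.len ≤ 5) (hl : 20 ≤ l) :
    (0 : Expr).cost m + e.cost m + (1 + ((0 : Expr).val m).size + (e.val m).size)
      ≤ 20 * l ^ 2 * (W + 1) := by
  have hl0 : (0 : Expr).len = 1 := by change 1 + Nat.size 0 = 1; rw [Nat.size_zero]
  have hw1 := Expr.cost_le h e
  have hw2 := Expr.cost_le h 0
  have hw3 := Expr.size_val_le h e
  have hw4 := Expr.size_val_le h 0
  rw [hl0] at hw2 hw4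
  have := cost_arith (W := W) (l := l) (i := 1) (e := e.len) (by omega) (by omega)
  omega

theorem loop_arith {j s X a b t u : ℕ} (ha : a ≤ X) (hb : b ≤ X) (ht : t ≤ s * X)
    (hu : u ≤ (j * (s + 2) + 1) * X) : a + (t + b) + u ≤ ((j + 1) * (s + 2) + 1) * X := by
  have : ((j + 1) * (s + 2) + 1) * X = (j * (s + 2) + 1) * X + s * X + X + X := by ring
  omega

/-- Compiled commands run as specified, and their cost is polynomial. -/
theorem exec {B V l : ℕ} (c : Cmd) (hok : c.ok = true) (hl : c.len ≤ l) (o : List ℕ) (m : Mem)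
    (W : ℕ) (hB : ∀ p, m 1 p ≤ B) (h0 : ∀ i, (m 0 i).size ≤ V) (h1 : ∀ i, (m 1 i).size ≤ V)
    (hW : ∀ a i, (m a i).size ≤ W) :
    ∃ t, Runs c.toProg ⟨m, o⟩ ⟨c.run m, o⟩ t ∧
      (∀ a i, (c.run m a i).size ≤ W + c.steps B * (l * (V + 1))) ∧
      t ≤ c.steps B * (20 * l ^ 2 * (W + c.steps B * (l * (V + 1)) + 1)) := by
  -- `W` must vary, since it grows by `l * (V + 1)` per step; `B` and `V` speak of the arrays 0 and
  -- 1 only, which stay fixed.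
  induction c generalizing m W with
  | skip =>
    refine ⟨1, .skip _, fun a i => (hW a i).trans (by omega), ?_⟩
    simp only [len] at hl
    simp only [steps]
    nlinarith [Nat.zero_le (W + 1 * (l * (V + 1))), pow_le_pow_left' hl 2]
  | set a i e =>
    simp only [ok, Bool.and_eq_true] at hok
    simp only [len] at hl
    refine ⟨_, Runs.write a i e ⟨m, o⟩, ?_, ?_⟩
    · refine Mem.size_set_le hW (by omega) ((Expr.size_lin_le h0 h1 hW hok.2).trans ?_) _ _
      simp only [steps]; nlinarith
    · have hi := Expr.cost_le hW i
      have he := Expr.cost_le hW e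
      have hi' := Expr.size_val_le hW i
      have he' := Expr.size_val_le hW e
      have : 1 ≤ l := by
        have : 1 ≤ i.len := by cases i <;> (simp [Expr.len]; try omega)
        omega
      have := cost_arith (W := W) hl this
      simp only [steps, one_mul]
      calc _ ≤ 20 * l ^ 2 * (W + 1) := by omega
        _ ≤ _ := Nat.mul_le_mul_left _ (by omega)
  | seq c d hc hd =>
    simp only [ok, Bool.and_eq_true] at hok
    simp only [len] at hl
    obtain ⟨t, ht, hs, htt⟩ := hc hok.1 (by omega) m W hB h0 h1 hW
    have f0 := c.run_frame (ok_writes hok.1).1 m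
    have f1 := c.run_frame (ok_writes hok.1).2 m
    obtain ⟨u, hu, hs', huu⟩ := hd hok.2 (by omega) (c.run m) _ (by simpa [f1] using hB)
      (by simpa [f0] using h0) (by simpa [f1] using h1) hs
    refine ⟨t + u, .seq ht hu, fun a i => (hs' a i).trans (by simp only [steps]; linarith), ?_⟩
    simp only [steps, add_mul]
    refine add_le_add (htt.trans ?_) (huu.trans ?_)
    · exact Nat.mul_le_mul_left _ (Nat.mul_le_mul_left _ (by omega))
    · exact Nat.mul_le_mul_left _ (Nat.mul_le_mul_left _ (by omega))
  | ite e c d hc hd =>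
    simp only [ok, Bool.and_eq_true] at hok
    simp only [len] at hl
    have he := Expr.cost_le hW e
    have h1l : 1 ≤ e.len := by cases e <;> (simp [Expr.len]; try omega)
    have hcost : e.cost m + 1 ≤ 20 * l ^ 2 * (W + 1) := by
      have := cost_arith (W := W) (l := l) (i := e.len) (e := 0) (by omega) (by omega)
      omega
    by_cases hv : e.val m = 0
    · obtain ⟨t, ht, hs, htt⟩ := hd hok.2 (by omega) m W hB h0 h1 hW
      have hr : (ite e c d).run m = d.run m := by simp [run_ite, hv]
      refine ⟨_, by rw [hr]; exact Runs.ite_false hv ht, fun a i => ?_, ?_⟩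
      · rw [hr]
        exact (hs a i).trans (by simp only [steps]; nlinarith [Nat.zero_le (l * (V + 1))])
      · simp only [steps, add_mul, one_mul]
        have a1 : 20 * l ^ 2 * (W + 1) ≤ 20 * l ^ 2 *
          (W + (l * (V + 1) + steps B c * (l * (V + 1)) + steps B d * (l * (V + 1))) + 1) :=
          Nat.mul_le_mul_left _ (by omega)
        have a2 : t ≤ d.steps B * (20 * l ^ 2 *
          (W + (l * (V + 1) + steps B c * (l * (V + 1)) + steps B d * (l * (V + 1))) + 1)) :=
          htt.trans (Nat.mul_le_mul_left _ (Nat.mul_le_mul_left _ (by omega)))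
        omega
    · obtain ⟨t, ht, hs, htt⟩ := hc hok.1 (by omega) m W hB h0 h1 hW
      have hr : (ite e c d).run m = c.run m := by simp [run_ite, hv]
      refine ⟨_, by rw [hr]; exact Runs.ite_true hv ht, fun a i => ?_, ?_⟩
      · rw [hr]
        exact (hs a i).trans (by simp only [steps]; nlinarith [Nat.zero_le (l * (V + 1))])
      · simp only [steps, add_mul, one_mul]
        have a1 : 20 * l ^ 2 * (W + 1) ≤ 20 * l ^ 2 *
          (W + (l * (V + 1) + steps B c * (l * (V + 1)) + steps B d * (l * (V + 1))) + 1) :=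
          Nat.mul_le_mul_left _ (by omega)
        have a2 : t ≤ c.steps B * (20 * l ^ 2 *
          (W + (l * (V + 1) + steps B c * (l * (V + 1)) + steps B d * (l * (V + 1))) + 1)) :=
          htt.trans (Nat.mul_le_mul_left _ (Nat.mul_le_mul_left _ (by omega)))
        omega
  | loop x p c ih =>
    simp only [ok, Bool.and_eq_true, decide_eq_true_eq, Bool.not_eq_true',
      List.contains_eq_mem, decide_eq_false_iff_not] at hok
    obtain ⟨⟨hx2, hx⟩, hok⟩ := hok
    simp only [len] at hl
    have hf0 := c.run_frame (ok_writes hok).1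
    have hf1 := c.run_frame (ok_writes hok).2
    have hfx := c.run_frame hx
    have hit0 : ∀ i, iter c.run x i m 0 = m 0 := fun i => iter_frame hf0 (by omega) i m
    have hit1 : ∀ i, iter c.run x i m 1 = m 1 := fun i => iter_frame hf1 (by omega) i m
    have hitx : ∀ i, iter c.run x i m x 0 = i := by
      intro i; cases i <;> simp [iter, Mem.set_apply]
    set g := l * (V + 1) with hg
    have hg1 : 2 ≤ g := by rw [hg]; nlinarith [show 2 ≤ l by omega]
    set κ := 20 * l ^ 2 with hκ
    set s := c.steps B with hs
    -- Induction on the number `j` of remaining rounds. A round adds `s * g` bits through the body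
    -- and at most `g` through the counter.
    have key : ∀ j i W', i + j = m 1 p → (∀ a b, (iter c.run x i m a b).size ≤ W') →
        ∃ t, Runs (.loop (.read 1 (.const p) - .var x) (.seq c.toProg (.write x 0 (.var x + 1))))
          ⟨iter c.run x i m, o⟩ ⟨iter c.run x (m 1 p) m, o⟩ t ∧
          (∀ a b, (iter c.run x (m 1 p) m a b).size ≤ W' + j * (s + 1) * g) ∧
          t ≤ (j * (s + 2) + 1) * (κ * (W' + j * (s + 1) * g + 1)) := by
      intro j
      induction j with
      | zero =>
        intro i W' hij hW'
        obtain rfl : i = m 1 p := by omega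
        refine ⟨_, .loop_done ?_, fun a b => (hW' a b).trans (by omega), ?_⟩
        · change Op.eval .sub _ _ = 0
          simp [Op.eval, hit1, hitx]
        · simpa using cond_cost x hW' (l := l) (p := p) (by omega)
      | succ j ihj =>
        intro i W' hij hW'
        obtain ⟨t, ht, hsz, htt⟩ := ih hok (by omega) (iter c.run x i m) W'
          (by simpa [hit1] using hB) (by simpa [hit0] using h0) (by simpa [hit1] using h1) hW'
        have hcx : c.run (iter c.run x i m) x 0 = i := by rw [hfx, hitx]
        have hset : ((c.run (iter c.run x i m)).set x ((0 : Expr).val (c.run (iter c.run x i m)))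
            ((Expr.var x + 1).val (c.run (iter c.run x i m)))) = iter c.run x (i + 1) m := by
          simp [iter, hcx]
        have hwr := Runs.write x 0 (.var x + 1) ⟨c.run (iter c.run x i m), o⟩
        rw [write_eq] at hwr
        dsimp only at hwr
        rw [hset] at hwr
        have hgs : (s + 1) * g = s * g + g := by ring
        have hsz' : ∀ a b, (iter c.run x (i + 1) m a b).size ≤ W' + (s + 1) * g := by
          intro a b
          refine Mem.size_set_le hsz (by omega) ?_ _ _ a b
          have h5 := Expr.size_add_le (c.run (iter c.run x i m) x 0) 1
          have h6 : _ ≤ W' + s * g := hsz x 0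
          rw [hcx] at h5 h6
          rw [Nat.size_one] at h5
          omega
        obtain ⟨u, hu, husz, huu⟩ := ihj (i + 1) _ (by omega) hsz'
        refine ⟨_, .loop_step ?_ (.seq ht hwr) hu,
          fun a b => (husz a b).trans (le_of_eq (by ring)), ?_⟩
        · change Op.eval .sub _ _ ≠ 0
          simp only [Op.eval, Expr.val_read, Expr.val_const, hit1, hitx]
          omega
        · have e1 : (j + 1) * (s + 1) * g = j * (s + 1) * g + s * g + g := by ring
          have z3 : W' + (s + 1) * g + j * (s + 1) * g + 1 = W' + (j + 1) * (s + 1) * g + 1 := by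
            ring
          rw [z3] at huu
          have hl1 : (Expr.var x + 1).len ≤ 5 := by
            change 1 + (1 + (1 + Nat.size 0)) + (1 + Nat.size 1) ≤ _
            rw [Nat.size_zero, Nat.size_one]
          refine loop_arith ((cond_cost x hW' (l := l) (p := p) (by omega)).trans ?_)
            ((write_cost hsz hl1 (by omega : 20 ≤ l)).trans ?_) (htt.trans ?_) huu
          · exact Nat.mul_le_mul_left _ (by omega)
          · exact Nat.mul_le_mul_left _ (by omega)
          · exact Nat.mul_le_mul_left _ (Nat.mul_le_mul_left _ (by omega))
    obtain ⟨t, ht, hsz, htt⟩ := key (m 1 p) 0 W (by omega)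
      (fun a b => Mem.size_set_le hW le_rfl (by simp) _ _ a b)
    have hw := Runs.write x 0 0 ⟨m, o⟩
    have c2 : m 1 p * (s + 1) ≤ 2 + B * (s + 2) := by nlinarith [hB p]
    have c5 := Nat.mul_le_mul_right g c2
    refine ⟨_, .seq hw ht, ?_, ?_⟩
    · intro a b
      refine (hsz a b).trans ?_
      simp only [steps]
      exact Nat.add_le_add_left c5 _
    · have hl0 : (0 : Expr).len ≤ 5 := by change 1 + Nat.size 0 ≤ 5; rw [Nat.size_zero]; omega
      have c1 := (write_cost hW hl0 (by omega : 20 ≤ l)).trans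
        (Nat.mul_le_mul_left κ (by omega : W + 1 ≤ W + (2 + B * (s + 2)) * g + 1))
      have c3 : m 1 p * (s + 2) + 1 ≤ 1 + B * (s + 2) := by nlinarith [hB p]
      have c4 : t ≤ (1 + B * (s + 2)) * (κ * (W + (2 + B * (s + 2)) * g + 1)) :=
        htt.trans (Nat.mul_le_mul c3 (Nat.mul_le_mul_left _ (by omega)))
      have e1 : (2 + B * (s + 2)) * (κ * (W + (2 + B * (s + 2)) * g + 1)) =
        κ * (W + (2 + B * (s + 2)) * g + 1) +
        (1 + B * (s + 2)) * (κ * (W + (2 + B * (s + 2)) * g + 1)) := by ring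
      simp only [steps]
      rw [← hs, e1]
      exact Nat.add_le_add c1 c4

end Cmd

end Middlebox

namespace Middlebox

/-! ## The algorithm -/

notation "aRK" => (2 : ℕ)
notation "aQU" => (3 : ℕ)
notation "aPR" => (4 : ℕ)
notation "aQC" => (5 : ℕ)
notation "xA" => (6 : ℕ)
notation "xB" => (7 : ℕ)
notation "xC" => (8 : ℕ)
notation "aRES" => (9 : ℕ)
notation "aPB" => (10 : ℕ)
notation "aLP" => (11 : ℕ)
notation "aCNT" => (12 : ℕ)
notation "aCAP" => (13 : ℕ)
notation "aRV" => (14 : ℕ)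
notation "aATT" => (15 : ℕ)
notation "aT" => (16 : ℕ)
notation "aPOS" => (17 : ℕ)
notation "aC0" => (18 : ℕ)
notation "aC2" => (19 : ℕ)
notation "aSUM" => (20 : ℕ)
notation "xP" => (21 : ℕ)
notation "xW" => (22 : ℕ)
notation "xJ" => (23 : ℕ)
notation "xV" => (24 : ℕ)
notation "aBP" => (25 : ℕ)
notation "aBC" => (26 : ℕ)
notation "aBT" => (27 : ℕ)
notation "aCM" => (28 : ℕ)
notation "aG1" => (29 : ℕ)
notation "aG2" => (30 : ℕ)
notation "aQB" => (31 : ℕ)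
notation "aLQ" => (32 : ℕ)
notation "aHS" => (33 : ℕ)
notation "aMS" => (34 : ℕ)
notation "aOUT" => (35 : ℕ)
notation "aOL" => (36 : ℕ)

namespace Expr

/-- The parameters: number of vertices, number of network nodes, number of units in the reference
capacity, and the source. -/
def nE : Expr := .read 1 (.const 0)
def NE : Expr := .read 1 (.const 2)
def unitE : Expr := .read 1 (.const 4)
def sE : Expr := .read 1 (.const 5)

/-- The index of an entry of a matrix of network nodes. -/
def ix (u v : Expr) : Expr := u * NE + v

/-- Nonzero iff the values are different. -/
def neq (e f : Expr) : Expr := (e - f) + (f - e)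

/-- The positions of the input data. -/
def capPos (u v : Expr) : Expr := 4 + 2 * (u * nE + v)
def procPos (v : Expr) : Expr := 4 + 2 * (nE * nE) + 2 * v
def pricePos (v : Expr) : Expr := 4 + 2 * (nE * nE) + 2 * nE + 2 * v
def demPos (i : Expr) : Expr := 4 + 2 * (nE * nE) + 4 * nE + 3 * i

/-- The rational number at position `i` of the input, in units of the `L`-th part of the rational
number at the reference position, rounded down. -/
def scaled (i : Expr) : Expr :=
  (.read 0 i * (.read 0 (.var aPOS + 1) * unitE)) / (.read 0 (i + 1) * .read 0 (.var aPOS))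

end Expr

namespace Cmd

open Middlebox.Expr

/-- Breadth-first search from the source in the digraph of the nonzero entries of `A`. -/
def bfs (A : ℕ) : Cmd :=
  .loop xA 2 (.set aRK (var xA) 0) ;;
  .set aQU 0 sE ;; .set aRK sE 1 ;; .set aQC 0 1 ;;
  .loop xA 2 (.ite (var aQC - var xA)
    (.loop xB 2 (.ite (.read A (ix (.read aQU (var xA)) (var xB)))
      (.ite (.read aRK (var xB)) .skip
        (.set aQU (var aQC) (var xB) ;; .set aPR (var xB) (.read aQU (var xA)) ;;
          .set aQC 0 (var aQC + 1) ;; .set aRK (var xB) (var aQC)))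
      .skip))
    .skip)

/-- Follow the predecessors from the last node back to the source. -/
def trace (B P : ℕ) : Cmd :=
  .set P 0 0 ;;
  .ite (.read aRK (NE - 1))
    (.set B 0 (NE - 1) ;; .set P 0 1 ;;
      .loop xA 2 (.ite (neq (.read B (var P - 1)) sE)
        (.set B (var P) (.read aPR (.read B (var P - 1))) ;; .set P 0 (var P + 1))
        .skip))
    .skip

def path (A B P : ℕ) : Cmd := bfs A ;; trace B P

/-- Push one unit of flow along the path in `aPB`. -/
def push : Cmd :=
  .loop xA 2 (.ite (var aLP - (var xA + 1))
    (.set aRES (ix (.read aPB (var xA + 1)) (.read aPB (var xA)))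
        (.read aRES (ix (.read aPB (var xA + 1)) (.read aPB (var xA))) - 1) ;;
      .set aRES (ix (.read aPB (var xA)) (.read aPB (var xA + 1)))
        (.read aRES (ix (.read aPB (var xA)) (.read aPB (var xA + 1))) + 1))
    .skip)

/-- At most `K` unit augmentations are made, however large the capacities are. A failed search
leaves the residual matrix unchanged, so all later rounds are idle. -/
def maxflow : Cmd :=
  .set aCNT 0 0 ;;
  .loop xC 3 (path aRES aPB aLP ;;
    .ite (var aLP) (.set aCNT 0 (var aCNT + 1) ;; push) .skip)

/-- The nodes to which the terminals are attached. -/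
def attach : Cmd :=
  .loop xA 0 (.set aATT (var xA) (var xA)) ;;
  .loop xA 1 (.set aATT (nE + var xA) (.read 0 (demPos (var xA))))

/-- The network with terminal capacities `aRV`. -/
def build : Cmd :=
  .loop xA 2 (.loop xB 2 (
    .ite (nE - var xA)
      (.ite (nE - var xB) (.set aCAP (ix (var xA) (var xB)) (scaled (capPos (var xA) (var xB))))
        (.ite ((NE - 1 - var xB) * (1 - neq (.read aATT (var xB - nE)) (var xA)))
          (.set aCAP (ix (var xA) (var xB)) (.read aRV (var xB - nE)))
          (.set aCAP (ix (var xA) (var xB)) 0)))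
      (.ite ((1 - neq (var xB) (NE - 1)) * (NE - 1 - var xA))
        (.set aCAP (ix (var xA) (var xB)) (.read aRV (var xA - nE)))
        (.set aCAP (ix (var xA) (var xB)) 0)) ;;
    .set aRES (ix (var xA) (var xB)) (.read aCAP (ix (var xA) (var xB)))))

/-- The terminals are the purchased vertices. -/
def procTerminals : Cmd :=
  .loop xA 0 (.ite (.read aT (var xA)) (.set aRV (var xA) (scaled (procPos (var xA))))
    (.set aRV (var xA) 0)) ;;
  .loop xA 1 (.set aRV (nE + var xA) 0)

/-- The terminals are the demands. -/
def demTerminals : Cmd :=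
  .loop xA 0 (.set aRV (var xA) 0) ;;
  .loop xA 1 (.set aRV (nE + var xA) (scaled (demPos (var xA) + 1)))

def procFlow : Cmd := procTerminals ;; build ;; maxflow
def demFlow : Cmd := demTerminals ;; build ;; maxflow

end Cmd

namespace Expr

/-- Nonzero iff the price of `v` is at most the budget. -/
def affordable (v : Expr) : Expr :=
  .read 0 2 * .read 0 (pricePos v + 1) + 1 - .read 0 (pricePos v)

/-- The price in units of the `2 n`-th part of the budget, rounded up. -/
def price (v : Expr) : Expr :=
  (.read 0 (pricePos v) * (2 * nE) + .read 0 (pricePos v + 1) * .read 0 2 - 1)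
    / (.read 0 (pricePos v + 1) * .read 0 2)

end Expr

namespace Cmd

open Middlebox.Expr

/-- Purchase the vertex `xV` if it is worth its price. -/
def consider : Cmd :=
  .ite (affordable (var xV)) (.ite (.read aT (var xV)) .skip (
    procFlow ;; .set aC0 0 (var aCNT) ;;
    .set aT (var xV) 1 ;; procFlow ;;
    .set aSUM 0 0 ;;
    .loop xA 0 (.ite (.read aT (var xA)) (.set aSUM 0 (var aSUM + price (var xA))) .skip) ;;
    .ite ((var xW * price (var xV) - 4 * nE * (var aCNT - var aC0)) + (var aSUM - 2 * nE))
      (.set aT (var xV) 0) .skip)) .skip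

/-- The index `xJ` selects the seed: one vertex if it names an affordable one, and the empty set if
it is at least `n`. A single pass suffices because the target `xW` is guessed outside. -/
def greedy : Cmd :=
  .loop xA 0 (.set aT (var xA) 0) ;;
  .ite (nE - var xJ) (.ite (affordable (var xJ)) (.set aT (var xJ) 1) .skip) .skip ;;
  .loop xV 0 consider

/-- Keep the purchases if they are better than the best ones so far. -/
def improve : Cmd :=
  procFlow ;; .set aCM 0 (var aCNT) ;;
  .ite (var aCM - var aC2) (.set aCM 0 (var aC2)) .skip ;;
  .ite (var aCM * .read 0 (var aPOS) * .read 0 (var aBP + 1)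
      - var aBC * .read 0 (var aBP) * .read 0 (var aPOS + 1))
    (.set aBC 0 (var aCM) ;; .set aBP 0 (var aPOS) ;;
      .loop xA 0 (.set aBT (var xA) (.read aT (var xA))))
    .skip

/-- Every position below `K` is tried as a reference, including positions where no rational number
begins. This is harmless: a pair of nonzero words is a legitimate unit for rounding, and with a zero
word all rounded capacities vanish and nothing is improved. -/
def search : Cmd :=
  .set aBP 0 4 ;; .set aBC 0 0 ;; .loop xA 0 (.set aBT (var xA) 0) ;;
  .loop xP 3 (.set aPOS 0 (var xP) ;; demFlow ;; .set aC2 0 (var aCNT) ;;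
    .loop xW 3 (.loop xJ 2 (greedy ;; improve)))

/-- Store the flow in `G`. -/
def saveFlow (G : ℕ) : Cmd :=
  .loop xA 2 (.loop xB 2 (.set G (ix (var xA) (var xB))
    (.read aCAP (ix (var xA) (var xB)) - .read aRES (ix (var xA) (var xB)))))

def bestFlows : Cmd :=
  .set aPOS 0 (var aBP) ;; .loop xA 0 (.set aT (var xA) (.read aBT (var xA))) ;;
  procFlow ;; saveFlow aG1 ;; demFlow ;; saveFlow aG2

/-- Remove one unit of flow along a path. -/
def pull (G B P : ℕ) : Cmd :=
  .loop xA 2 (.ite (var P - (var xA + 1))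
    (.set G (ix (.read B (var xA + 1)) (.read B (var xA)))
        (.read G (ix (.read B (var xA + 1)) (.read B (var xA))) - 1))
    .skip)

/-- The first node, on the way back from the processing vertex, on the path to the sink. -/
def hub : Cmd :=
  .loop xA 2 (.ite (var aLP - (var xA + 2))
    (.loop xB 2 (.ite (var aLQ - (var xB + 2))
      (.ite (neq (.read aPB (var aLP - (var xA + 1))) (.read aQB (var xB + 2))) .skip
        -- Positions are tried from the source towards the processing vertex and later hits
        -- overwrite earlier ones, so the hit nearest to the processing vertex survives.
        (.set aHS 0 (var aLP - (var xA + 1)) ;; .set aMS 0 (var xB + 2))) .skip)) .skip)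

def emit (e : Expr) : Cmd := .set aOUT (var aOL) e ;; .set aOL 0 (var aOL + 1)

/-- Paths are stored backwards, with the artificial sink and the terminal in entries 0 and 1. The
three loops print the way out, the way back without repeating the processing vertex, and the way to
the sink without repeating the hub. -/
def emitWalk : Cmd :=
  .loop xA 2 (.ite (var aLP - (var xA + 2)) (emit (.read aPB (var aLP - (var xA + 1)))) .skip) ;;
  .loop xA 2 (.ite (var aHS - (var xA + 2)) (emit (.read aPB (var xA + 3))) .skip) ;;
  .loop xA 2 (.ite (var aMS - (var xA + 2)) (emit (.read aQB (var aMS - (var xA + 1)))) .skip)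

/-- Terminals of demands start at node `2n`, whence the index of the pair. The factor 3 in the
denominator pays for up to three uses of an edge. -/
def emitRoute : Cmd :=
  emit (.read aQB 1 - 2 * nE) ;; emit (.read aPB 2) ;; emit (.read 0 (var aPOS)) ;;
  emit (3 * unitE * .read 0 (var aPOS + 1)) ;;
  emit ((var aLP - 2) + (var aHS - 2) + (var aMS - 2)) ;; emitWalk

def route : Cmd :=
  path aG1 aPB aLP ;; path aG2 aQB aLQ ;; pull aG1 aPB aLP ;; pull aG2 aQB aLQ ;; hub ;; emitRoute

def output : Cmd :=
  -- The double truncated difference turns an arbitrary mark into 0 or 1.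
  .set aOL 0 0 ;; .loop xA 0 (emit (1 - (1 - .read aBT (var xA)))) ;; emit (var aBC) ;;
  .loop xC 3 (.ite (var aBC - var xC) route .skip)

def main : Cmd := attach ;; search ;; bestFlows ;; output

theorem main_ok : main.ok = true := by decide

end Cmd

end Middlebox

namespace Middlebox

/-! ## Integral flows -/

/-- The list `b 0, …, b (l - 1)` is, in reverse order, a simple path from `s` to `N - 1` in the
digraph of the nonzero entries of `M`. -/
structure IsPath (N s : ℕ) (M : ℕ → ℕ → ℕ) (b : ℕ → ℕ) (l : ℕ) : Prop where
  pos : 1 ≤ l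
  first : b 0 = N - 1
  last : b (l - 1) = s
  lt : ∀ h < l, b h < N
  arc : ∀ h, h + 1 < l → M (b (h + 1)) (b h) ≠ 0
  inj : ∀ h < l, ∀ h' < l, b h = b h' → h = h'

/-- The set `S` of nodes separates `s` from `N - 1`. -/
structure IsCut (N s : ℕ) (S : Finset ℕ) : Prop where
  subset : S ⊆ Finset.range N
  mem : s ∈ S
  notMem : N - 1 ∉ S

/-- The capacity of a cut. -/
def cutCap (N : ℕ) (c : ℕ → ℕ → ℕ) (S : Finset ℕ) : ℕ :=
  ∑ u ∈ S, ∑ v ∈ Finset.range N \ S, c u v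

theorem IsPath.le {N s : ℕ} {M : ℕ → ℕ → ℕ} {b : ℕ → ℕ} {l : ℕ} (h : IsPath N s M b l) : l ≤ N := by
  have := Finset.card_le_card_of_injOn (s := Finset.range l) (t := Finset.range N) b
    (fun x hx => by simpa using h.lt x (by simpa using hx))
    (fun x hx y hy e => h.inj x (by simpa using hx) y (by simpa using hy) e)
  simpa using this

/-- `r` is a residual matrix of a flow of value `val` with capacities `c`. -/
structure IsRes (N s : ℕ) (c r : ℕ → ℕ → ℕ) (val : ℕ) : Prop where
  anti : ∀ u < N, ∀ v < N, r u v + r v u = c u v + c v u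
  net : ∀ u < N, ∑ v ∈ Finset.range N, ((c u v : ℤ) - r u v) =
    (if u = s then (val : ℤ) else 0) - (if u = N - 1 then (val : ℤ) else 0)

theorem IsRes.refl (N s : ℕ) (c : ℕ → ℕ → ℕ) : IsRes N s c c 0 := ⟨by simp, by simp⟩

theorem sum_antisymm {S : Finset ℕ} {f : ℕ → ℕ → ℤ} (h : ∀ u ∈ S, ∀ v ∈ S, f u v = - f v u) :
    ∑ u ∈ S, ∑ v ∈ S, f u v = 0 := by
  have : ∑ u ∈ S, ∑ v ∈ S, f u v = - ∑ u ∈ S, ∑ v ∈ S, f u v := by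
    conv_lhs => rw [Finset.sum_comm]
    rw [← Finset.sum_neg_distrib]
    refine Finset.sum_congr rfl fun u hu => ?_
    rw [← Finset.sum_neg_distrib]
    exact Finset.sum_congr rfl fun v hv => h v hv u hu
  omega

/-- The net flow across a cut. -/
theorem sum_across_cut {N s : ℕ} {f : ℕ → ℕ → ℤ} {val : ℤ} {S : Finset ℕ} (hS : IsCut N s S)
    (hf : ∀ u < N, ∀ v < N, f u v = - f v u)
    (hn : ∀ u < N, ∑ v ∈ Finset.range N, f u v =
      (if u = s then val else 0) - (if u = N - 1 then val else 0)) :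
    ∑ u ∈ S, ∑ v ∈ Finset.range N \ S, f u v = val := by
  have hlt : ∀ u ∈ S, u < N := fun u hu => by simpa using hS.subset hu
  have h1 : ∑ u ∈ S, ∑ v ∈ Finset.range N, f u v = val := by
    rw [Finset.sum_congr rfl fun u hu => hn u (hlt u hu), Finset.sum_sub_distrib]
    simp [hS.mem, hS.notMem]
  have h2 : ∑ u ∈ S, ∑ v ∈ S, f u v = 0 :=
    sum_antisymm fun u hu v hv => hf u (hlt u hu) v (hlt v hv)
  rw [← h1, ← sub_eq_zero, ← Finset.sum_sub_distrib, ← neg_eq_zero, ← Finset.sum_neg_distrib, ← h2]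
  refine Finset.sum_congr rfl fun u _ => ?_
  rw [← Finset.sum_sdiff hS.subset]
  ring

theorem IsRes.across {N s val : ℕ} {c r : ℕ → ℕ → ℕ} (h : IsRes N s c r val) {S : Finset ℕ}
    (hS : IsCut N s S) :
    ∑ u ∈ S, ∑ v ∈ Finset.range N \ S, ((c u v : ℤ) - r u v) = val :=
  sum_across_cut hS (fun u hu v hv => by have := h.anti u hu v hv; omega) h.net

theorem IsRes.le_cutCap {N s val : ℕ} {c r : ℕ → ℕ → ℕ} (h : IsRes N s c r val) {S : Finset ℕ}
    (hS : IsCut N s S) : val ≤ cutCap N c S := by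
  have := h.across hS
  have h2 : ∑ u ∈ S, ∑ v ∈ Finset.range N \ S, ((c u v : ℤ) - r u v) ≤ (cutCap N c S : ℤ) := by
    rw [cutCap]; push_cast
    exact Finset.sum_le_sum fun u _ => Finset.sum_le_sum fun v _ => by omega
  omega

/-- Without residual arcs leaving `S`, the flow saturates the cut; this is the certificate of
optimality that a failed search delivers. -/
theorem IsRes.cutCap_eq {N s val : ℕ} {c r : ℕ → ℕ → ℕ} (h : IsRes N s c r val) {S : Finset ℕ}
    (hS : IsCut N s S) (h0 : ∀ u ∈ S, ∀ v < N, v ∉ S → r u v = 0) : cutCap N c S = val := by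
  have := h.across hS
  have h2 : ∑ u ∈ S, ∑ v ∈ Finset.range N \ S, ((c u v : ℤ) - r u v) = (cutCap N c S : ℤ) := by
    rw [cutCap]; push_cast
    refine Finset.sum_congr rfl fun u hu => Finset.sum_congr rfl fun v hv => ?_
    simp only [Finset.mem_sdiff, Finset.mem_range] at hv
    simp [h0 u hu v hv.1 hv.2]
  omega

/-- Push one unit of flow along the arc from `u` to `v`. -/
def pushArc (r : ℕ → ℕ → ℕ) (u v : ℕ) : ℕ → ℕ → ℕ := fun x y =>
  if x = v ∧ y = u then r x y + 1 else if x = u ∧ y = v then r x y - 1 else r x y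

/-- Push one unit of flow along the last `i` arcs of a path. -/
def pushPath (r : ℕ → ℕ → ℕ) (b : ℕ → ℕ) : ℕ → ℕ → ℕ → ℕ
  | 0 => r
  | i + 1 => pushArc (pushPath r b i) (b (i + 1)) (b i)

theorem pushArc_cast {r : ℕ → ℕ → ℕ} {u v : ℕ} (h : r u v ≠ 0) (huv : u ≠ v) (x y : ℕ) :
    (pushArc r u v x y : ℤ) =
      r x y + (if x = v then if y = u then 1 else 0 else 0)
        - (if x = u then if y = v then 1 else 0 else 0) := by
  unfold pushArc
  by_cases h1 : x = v ∧ y = u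
  · obtain ⟨rfl, rfl⟩ := h1
    simp [huv.symm]
  · by_cases h2 : x = u ∧ y = v
    · obtain ⟨rfl, rfl⟩ := h2
      simp only [huv, false_and, if_false, and_self, if_true]
      omega
    · rw [if_neg h1, if_neg h2]
      split_ifs <;> simp_all

/-- A push lowers only the entry of the arc pushed along, so the arcs of a simple path that are
still to come keep their residual capacity. -/
theorem pushPath_ge {r : ℕ → ℕ → ℕ} {b : ℕ → ℕ} {i x y : ℕ}
    (h : ∀ j < i, ¬ (x = b (j + 1) ∧ y = b j)) : r x y ≤ pushPath r b i x y := by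
  induction i with
  | zero => rfl
  | succ i ih =>
    refine (ih fun j hj => h j (by omega)).trans ?_
    rw [pushPath, pushArc, if_neg (h i (by omega))]
    split <;> omega

theorem IsPath.pushPath_ne_zero {N s l : ℕ} {M : ℕ → ℕ → ℕ} {b : ℕ → ℕ} (h : IsPath N s M b l)
    {i : ℕ} (hi : i + 1 < l) : pushPath M b i (b (i + 1)) (b i) ≠ 0 := by
  have h1 := pushPath_ge (r := M) (b := b) (i := i) (x := b (i + 1)) (y := b i) (by
    rintro j hj ⟨_, e⟩
    have := h.inj _ (by omega) _ (by omega) e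
    omega)
  have := h.arc i hi
  omega

theorem IsPath.pushPath_isRes {N s l val : ℕ} {c r : ℕ → ℕ → ℕ} {b : ℕ → ℕ}
    (h : IsPath N s r b l) (hr : IsRes N s c r val) :
    IsRes N s c (pushPath r b (l - 1)) (val + 1) := by
  -- After `i` arcs, one extra unit runs from `b i` to `b 0`, so only the row sums of these two
  -- nodes have changed.
  have key : ∀ i, i + 1 ≤ l →
      (∀ u < N, ∀ v < N, pushPath r b i u v + pushPath r b i v u = c u v + c v u) ∧
      ∀ u < N, ∑ v ∈ Finset.range N, (pushPath r b i u v : ℤ) =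
        ∑ v ∈ Finset.range N, (r u v : ℤ) + (if u = b 0 then 1 else 0) - if u = b i then 1 else 0 := by
    intro i
    induction i with
    | zero => intro _; exact ⟨hr.anti, fun u _ => by simp [pushPath]⟩
    | succ i ih =>
      intro hi
      obtain ⟨h1, h2⟩ := ih (by omega)
      have hne : b (i + 1) ≠ b i := fun e => by
        have := h.inj _ (by omega) _ (by omega) e; omega
      have hc := pushArc_cast (h.pushPath_ne_zero (by omega : i + 1 < l)) hne
      refine ⟨fun u hu v hv => ?_, fun u hu => ?_⟩
      · have e1 := hc u v
        have e2 := hc v u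
        have := h1 u hu v hv
        rw [pushPath]
        zify at this ⊢
        rw [e1, e2]
        have e3 : (if u = b i then if v = b (i + 1) then (1 : ℤ) else 0 else 0) =
          if v = b (i + 1) then if u = b i then 1 else 0 else 0 := by split_ifs <;> rfl
        have e4 : (if v = b i then if u = b (i + 1) then (1 : ℤ) else 0 else 0) =
          if u = b (i + 1) then if v = b i then 1 else 0 else 0 := by split_ifs <;> rfl
        rw [e3, e4]
        linarith
      · rw [pushPath, Finset.sum_congr rfl fun v _ => hc u v, Finset.sum_sub_distrib,
          Finset.sum_add_distrib, h2 u hu]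
        have hb1 := h.lt (i + 1) (by omega)
        have hb0 := h.lt i (by omega)
        by_cases e1 : u = b i <;> by_cases e2 : u = b (i + 1)
        · exact absurd (e2.symm.trans e1) hne
        · simp [e1, hb1, hne.symm]
        · simp [e2, hb0, hne]
        · simp [e1, e2]
  obtain ⟨h1, h2⟩ := key (l - 1) (by have := h.pos; omega)
  refine ⟨h1, fun u hu => ?_⟩
  have := hr.net u hu
  rw [Finset.sum_sub_distrib] at this ⊢
  rw [h2 u hu, h.first, h.last]
  push_cast
  split_ifs at this ⊢ <;> linarith

/-- `val` is the maximum value of a flow, truncated at `K`. -/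
structure IsFlowVal (N s K : ℕ) (c : ℕ → ℕ → ℕ) (val : ℕ) : Prop where
  le : val ≤ K
  le_cut : ∀ S, IsCut N s S → val ≤ cutCap N c S
  eq : val = K ∨ ∃ S, IsCut N s S ∧ cutCap N c S = val

/-! ### Decomposition into paths -/

/-- `g` is a nonnegative flow of value `val`. -/
def IsGross (N s : ℕ) (g : ℕ → ℕ → ℕ) (val : ℕ) : Prop :=
  ∀ u < N, ∑ v ∈ Finset.range N, ((g u v : ℤ) - g v u) =
    (if u = s then (val : ℤ) else 0) - (if u = N - 1 then (val : ℤ) else 0)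

/-- The difference `c - r` is antisymmetric, and truncated subtraction takes its positive part.
Subtracting the reversed entry restores the signed value, so net flows are preserved. -/
theorem IsRes.isGross {N s val : ℕ} {c r : ℕ → ℕ → ℕ} (h : IsRes N s c r val) :
    IsGross N s (fun u v => c u v - r u v) val := by
  intro u hu
  rw [← h.net u hu]
  refine Finset.sum_congr rfl fun v hv => ?_
  have := h.anti u hu v (by simpa using hv)
  dsimp only
  omega

/-- Remove one unit of flow on the arc from `u` to `v`. -/
def pullArc (r : ℕ → ℕ → ℕ) (u v : ℕ) : ℕ → ℕ → ℕ := fun x y =>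
  if x = u ∧ y = v then r x y - 1 else r x y

def pullPath (r : ℕ → ℕ → ℕ) (b : ℕ → ℕ) : ℕ → ℕ → ℕ → ℕ
  | 0 => r
  | i + 1 => pullArc (pullPath r b i) (b (i + 1)) (b i)

/-- A simple path uses an arc at most once, and the arc carries flow, so the truncated subtraction
never truncates. -/
theorem IsPath.pullPath_add {N s l : ℕ} {M : ℕ → ℕ → ℕ} {b : ℕ → ℕ} (h : IsPath N s M b l)
    {i : ℕ} (hi : i + 1 ≤ l) (x y : ℕ) :
    pullPath M b i x y + (∑ j ∈ Finset.range i, if x = b (j + 1) ∧ y = b j then 1 else 0) = M x y := by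
  induction i with
  | zero => simp [pullPath]
  | succ i ih =>
    have ih := ih (by omega)
    rw [Finset.sum_range_succ, pullPath, pullArc]
    by_cases e : x = b (i + 1) ∧ y = b i
    · have h0 : (∑ j ∈ Finset.range i, if x = b (j + 1) ∧ y = b j then 1 else 0) = 0 := by
        refine Finset.sum_eq_zero fun j hj => if_neg ?_
        rintro ⟨_, e'⟩
        have := h.inj _ (by omega) _ (by simp at hj; omega) (e.2.symm.trans e')
        simp at hj; omega
      have := h.arc i (by omega)
      rw [← e.1, ← e.2] at this
      rw [if_pos e, if_pos e]
      omega
    · rw [if_neg e, if_neg e]; simpa using ih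

theorem IsPath.pullPath_isGross {N s l val : ℕ} {g : ℕ → ℕ → ℕ} {b : ℕ → ℕ}
    (h : IsPath N s g b l) (hg : IsGross N s g (val + 1)) :
    IsGross N s (pullPath g b (l - 1)) val := by
  -- The indicator of the last `i` arcs is a unit flow from `b i` to `b 0`; the sum telescopes.
  have key : ∀ i, i + 1 ≤ l → ∀ u < N,
      ∑ v ∈ Finset.range N, ((∑ j ∈ Finset.range i, if u = b (j + 1) ∧ v = b j then 1 else 0 : ℤ)
        - ∑ j ∈ Finset.range i, if v = b (j + 1) ∧ u = b j then 1 else 0) =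
        (if u = b i then 1 else 0) - if u = b 0 then 1 else 0 := by
    intro i
    induction i with
    | zero => intro _ u _; simp
    | succ i ih =>
      intro hi u hu
      have e : ∀ v, ((∑ j ∈ Finset.range (i + 1), if u = b (j + 1) ∧ v = b j then 1 else 0 : ℤ)
        - ∑ j ∈ Finset.range (i + 1), if v = b (j + 1) ∧ u = b j then 1 else 0) =
        ((∑ j ∈ Finset.range i, if u = b (j + 1) ∧ v = b j then 1 else 0 : ℤ)
        - ∑ j ∈ Finset.range i, if v = b (j + 1) ∧ u = b j then 1 else 0) +
        ((if u = b (i + 1) then (if v = b i then 1 else 0) else 0) -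
          (if u = b i then (if v = b (i + 1) then 1 else 0) else 0)) := by
        intro v
        rw [Finset.sum_range_succ, Finset.sum_range_succ]
        have e1 : (if v = b (i + 1) ∧ u = b i then (1 : ℤ) else 0) =
          if u = b i then (if v = b (i + 1) then 1 else 0) else 0 := by split_ifs <;> simp_all
        have e2 : (if u = b (i + 1) ∧ v = b i then (1 : ℤ) else 0) =
          if u = b (i + 1) then (if v = b i then 1 else 0) else 0 := by split_ifs <;> simp_all
        rw [e1, e2]; ring
      rw [Finset.sum_congr rfl fun v _ => e v, Finset.sum_add_distrib, ih (by omega) u hu]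
      have hb1 := h.lt (i + 1) (by omega)
      have hb0 := h.lt i (by omega)
      have s1 : ∑ v ∈ Finset.range N, (if u = b (i + 1) then (if v = b i then (1 : ℤ) else 0) else 0) =
          if u = b (i + 1) then 1 else 0 := by split_ifs <;> simp [hb0]
      have s2 : ∑ v ∈ Finset.range N, (if u = b i then (if v = b (i + 1) then (1 : ℤ) else 0) else 0) =
          if u = b i then 1 else 0 := by split_ifs <;> simp [hb1]
      rw [Finset.sum_sub_distrib, s1, s2]
      ring
  intro u hu
  have h1 := hg u hu
  have h2 := key (l - 1) (by have := h.pos; omega) u hu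
  rw [h.last, h.first] at h2
  have h3 : ∑ v ∈ Finset.range N, ((pullPath g b (l - 1) u v : ℤ) - pullPath g b (l - 1) v u) =
      ∑ v ∈ Finset.range N, ((g u v : ℤ) - g v u) -
      ∑ v ∈ Finset.range N, ((∑ j ∈ Finset.range (l - 1), if u = b (j + 1) ∧ v = b j then 1 else 0 : ℤ)
        - ∑ j ∈ Finset.range (l - 1), if v = b (j + 1) ∧ u = b j then 1 else 0) := by
    rw [← Finset.sum_sub_distrib]
    refine Finset.sum_congr rfl fun v _ => ?_
    have a1 := congrArg (Nat.cast : ℕ → ℤ) (h.pullPath_add (i := l - 1) (by have := h.pos; omega) u v)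
    have a2 := congrArg (Nat.cast : ℕ → ℤ) (h.pullPath_add (i := l - 1) (by have := h.pos; omega) v u)
    push_cast at a1 a2
    rw [← a1, ← a2]
    ring
  rw [h3, h1, h2]
  push_cast
  split_ifs <;> ring

/-- A flow of positive value has a flow path. -/
theorem IsGross.not_closed {N s val : ℕ} {g : ℕ → ℕ → ℕ} (h : IsGross N s g val) (hv : val ≠ 0)
    {S : Finset ℕ} (hS : IsCut N s S) : ¬ ∀ u ∈ S, ∀ v < N, v ∉ S → g u v = 0 := by
  intro h0
  have := sum_across_cut (val := val) hS (f := fun u v => (g u v : ℤ) - g v u)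
    (fun u _ v _ => by ring) h
  have h2 : ∑ u ∈ S, ∑ v ∈ Finset.range N \ S, ((g u v : ℤ) - g v u) ≤ 0 := by
    refine Finset.sum_nonpos fun u hu => Finset.sum_nonpos fun v hv => ?_
    simp only [Finset.mem_sdiff, Finset.mem_range] at hv
    rw [h0 u hu v hv.1 hv.2]
    simp
  omega

end Middlebox

/-! ### Path search as a program on matrices -/

namespace Middlebox

open Middlebox.Expr Middlebox.Cmd

@[simp] theorem Expr.val_nE (m : Mem) : nE.val m = m 1 0 := rfl
@[simp] theorem Expr.val_NE (m : Mem) : NE.val m = m 1 2 := rfl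
@[simp] theorem Expr.val_unitE (m : Mem) : unitE.val m = m 1 4 := rfl
@[simp] theorem Expr.val_sE (m : Mem) : sE.val m = m 1 5 := rfl
@[simp] theorem Expr.val_ix (m : Mem) (u v : Expr) :
    (ix u v).val m = u.val m * m 1 2 + v.val m := rfl
theorem Expr.val_neq (m : Mem) (u v : Expr) : (neq u v).val m ≠ 0 ↔ u.val m ≠ v.val m := by
  simp only [neq, val_add, val_sub]; omega
theorem Expr.val_neq' (m : Mem) (u v : Expr) : (neq u v).val m = 0 ↔ u.val m = v.val m := by
  simp only [neq, val_add, val_sub]; omega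

theorem Cmd.run_ite_pos {e : Expr} {c d : Cmd} {m : Mem} (h : e.val m ≠ 0) :
    (Cmd.ite e c d).run m = c.run m := by rw [run_ite, if_pos h]

theorem Cmd.run_ite_neg {e : Expr} {c d : Cmd} {m : Mem} (h : e.val m = 0) :
    (Cmd.ite e c d).run m = d.run m := by rw [run_ite, if_neg (by simpa using h)]

/-- An array as a matrix with rows of length `N`. -/
def mat (N : ℕ) (f : ℕ → ℕ) : ℕ → ℕ → ℕ := fun u v => f (u * N + v)

theorem ix_inj {N u v u' v' : ℕ} (hv : v < N) (hv' : v' < N) :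
    u * N + v = u' * N + v' ↔ u = u' ∧ v = v' := by
  constructor
  · intro h
    have h2 : (u * N + v) % N = (u' * N + v') % N := by rw [h]
    rw [Nat.mul_add_mod', Nat.mul_add_mod', Nat.mod_eq_of_lt hv, Nat.mod_eq_of_lt hv'] at h2
    subst h2
    exact ⟨Nat.eq_of_mul_eq_mul_right (by omega : 0 < N) (by omega), rfl⟩
  · rintro ⟨rfl, rfl⟩; rfl

/-! ### Breadth-first search -/

/-- A partial search tree: ranks, queue, predecessors, and number of nodes. -/
structure IsTree (N s : ℕ) (M : ℕ → ℕ → ℕ) (rk qu pr : ℕ → ℕ) (c : ℕ) : Prop where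
  pos : 1 ≤ c
  root : qu 0 = s
  queue : ∀ h < c, qu h < N ∧ rk (qu h) = h + 1
  rank : ∀ v < N, rk v ≠ 0 → rk v ≤ c ∧ qu (rk v - 1) = v
  pred : ∀ v < N, 2 ≤ rk v → pr v < N ∧ 1 ≤ rk (pr v) ∧ rk (pr v) < rk v ∧ M (pr v) v ≠ 0

variable {N s : ℕ} {M : ℕ → ℕ → ℕ} {rk qu pr : ℕ → ℕ} {c : ℕ}

theorem IsTree.le (h : IsTree N s M rk qu pr c) : c ≤ N := by
  have := Finset.card_le_card_of_injOn (s := Finset.range c) (t := Finset.range N) qu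
    (fun x hx => by simpa using (h.queue x (by simpa using hx)).1)
    (fun x hx y hy e => by
      have h1 := (h.queue x (by simpa using hx)).2
      have h2 := (h.queue y (by simpa using hy)).2
      rw [e] at h1; omega)
  simpa using this

/-- The new node gets a rank above all earlier ones, so its predecessor has a smaller rank, and the
old entries are not disturbed. -/
theorem IsTree.insert (h : IsTree N s M rk qu pr c) {i v : ℕ} (hi : i < c) (hv : v < N)
    (hM : M (qu i) v ≠ 0) (h0 : rk v = 0) :
    IsTree N s M (Function.update rk v (c + 1)) (Function.update qu c v)
      (Function.update pr v (qu i)) (c + 1) := by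
  have hq := h.queue i hi
  have hqv : qu i ≠ v := fun e => by rw [e] at hq; omega
  refine ⟨by omega, ?_, ?_, ?_, ?_⟩
  · rw [Function.update_of_ne (by have := h.pos; omega), h.root]
  · intro j hj
    by_cases e : j = c
    · subst e; simp [hv]
    · have := h.queue j (by omega)
      have hjv : qu j ≠ v := fun e' => by rw [e'] at this; omega
      rw [Function.update_of_ne e, Function.update_of_ne hjv]
      exact this
  · intro x hx
    by_cases e : x = v
    · subst e; simp
    · rw [Function.update_of_ne e]
      intro hx0
      have := h.rank x hx hx0
      rw [Function.update_of_ne (by omega)]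
      exact ⟨by omega, this.2⟩
  · intro x hx
    by_cases e : x = v
    · subst e
      intro _
      simp only [Function.update_self]
      rw [Function.update_of_ne hqv]
      exact ⟨hq.1, by omega, by omega, hM⟩
    · rw [Function.update_of_ne e, Function.update_of_ne e]
      intro h2
      obtain ⟨a1, a2, a3, a4⟩ := h.pred x hx h2
      have : pr x ≠ v := fun e' => by rw [e'] at a2; omega
      rw [Function.update_of_ne this]
      exact ⟨a1, a2, a3, a4⟩

/-- After round `i` all heads of arcs that leave the first `i + 1` queued nodes are visited. The
queue never holds more than `N` nodes, so `N` rounds close the visited set. -/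
theorem bfs_spec {A : ℕ} (hA : 8 ≤ A) {m : Mem} (hN : m 1 2 = N) (hs : m 1 5 = s) (hsN : s < N) :
    let m' := (bfs A).run m
    IsTree N s (mat N (m A)) (m' aRK) (m' aQU) (m' aPR) (m' aQC 0) ∧
      ∀ u < N, m' aRK u ≠ 0 → ∀ v < N, mat N (m A) u v ≠ 0 → m' aRK v ≠ 0 := by
  intro m'
  have hm' : m' = (bfs A).run m := rfl
  simp only [bfs, run_seq] at hm'
  have z := run_loop_inv (x := xA) (p := 2) (c := .set aRK (var xA) 0) (m := m)
    (fun i m => ∀ v < i, m aRK v = 0) (by simp [Mem.set_apply]) (by simp) (by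
      intro i m' hi hx _ h v hv
      simp only [run_set, val_read, val_const, val_zero, Mem.set_apply, hx]
      by_cases e : v = i
      · simp [e]
      · simpa [e] using h v (by omega))
  rw [hN] at z
  set m1 := (Cmd.loop xA 2 (.set aRK (var xA) 0)).run m with hm1
  have f1 : ∀ a, a ≠ 2 → a ≠ 6 → m1 a = m a := fun a h2 h6 =>
    run_frame _ (by simp [writes]; omega) m
  set m2 := (Cmd.set aQC 0 1).run ((Cmd.set aRK sE 1).run ((Cmd.set aQU 0 sE).run m1)) with hm2
  have f2 : ∀ a, a ≠ 2 → a ≠ 3 → a ≠ 5 → a ≠ 6 → m2 a = m a := fun a h2 h3 h5 h6 => by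
    rw [hm2, run_frame _ (by simp [writes]; omega), run_frame _ (by simp [writes]; omega),
      run_frame _ (by simp [writes]; omega), f1 a h2 h6]
  have s1 : m1 1 5 = s := by rw [f1 1 (by omega) (by omega), hs]
  have t2 : IsTree N s (mat N (m A)) (m2 aRK) (m2 aQU) (m2 aPR) (m2 aQC 0) := by
    have e1 : m2 aQC 0 = 1 := by simp [hm2, Mem.set_apply]
    have e2 : m2 aQU 0 = s := by simp [hm2, Mem.set_apply, s1]
    have e3 : ∀ v < N, m2 aRK v = if v = s then 1 else 0 := by
      intro v hv
      simp only [hm2, run_set, Mem.set_apply, val_sE, val_one, val_zero, s1]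
      simp [z v hv]
    rw [e1]
    refine ⟨le_rfl, e2, ?_, ?_, ?_⟩
    · intro h hh
      obtain rfl : h = 0 := by omega
      rw [e2]
      exact ⟨hsN, by rw [e3 s hsN]; simp⟩
    · intro v hv
      rw [e3 v hv]
      split
      · rename_i e; simp [e2, e]
      · simp
    · intro v hv h2
      rw [e3 v hv] at h2
      split at h2 <;> omega
  have hN2 : m2 1 2 = N := by rw [f2 1 (by omega) (by omega) (by omega) (by omega), hN]
  have hA2 : m2 A = m A := f2 A (by omega) (by omega) (by omega) (by omega)
  have key := run_loop_inv (x := xA) (p := 2) (m := m2)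
    (c := .ite (var aQC - var xA)
    (.loop xB 2 (.ite (.read A (ix (.read aQU (var xA)) (var xB)))
      (.ite (.read aRK (var xB)) .skip
        (.set aQU (var aQC) (var xB) ;; .set aPR (var xB) (.read aQU (var xA)) ;;
          .set aQC 0 (var aQC + 1) ;; .set aRK (var xB) (var aQC)))
      .skip)) .skip)
    (fun i m' => IsTree N s (mat N (m A)) (m' aRK) (m' aQU) (m' aPR) (m' aQC 0) ∧
      ∀ h < i, h < m' aQC 0 → ∀ v < N, mat N (m A) (m' aQU h) v ≠ 0 → m' aRK v ≠ 0)
    (fun i m' v h => by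
      rw [Mem.set_ne _ _ _ (by omega), Mem.set_ne _ _ _ (by omega), Mem.set_ne _ _ _ (by omega),
        Mem.set_ne _ _ _ (by omega)]; exact h)
    ⟨t2, by simp⟩ (by
      intro i m3 hi hx hf ⟨ht, hcl⟩
      have hN3 : m3 1 2 = N := by rw [hf 1 (by simp [writes]), hN2]
      have hA3 : m3 A = m A := by rw [hf A (by simp [writes]; omega), hA2]
      rw [run_ite]
      simp only [val_sub, val_read, val_const, hx]
      by_cases hic : m3 aQC 0 - i = 0
      · simp only [hic, ne_eq, not_true, if_false, run_skip]
        exact ⟨ht, fun h hh hc => hcl h (by omega) hc⟩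
      simp only [hic, ne_eq, not_false_eq_true, if_true]
      have inner := run_loop_inv (x := xB) (p := 2) (m := m3)
        (c := .ite (.read A (ix (.read aQU (var xA)) (var xB)))
          (.ite (.read aRK (var xB)) .skip
          (.set aQU (var aQC) (var xB) ;; .set aPR (var xB) (.read aQU (var xA)) ;;
          .set aQC 0 (var aQC + 1) ;; .set aRK (var xB) (var aQC))) .skip)
        (fun j m' => IsTree N s (mat N (m A)) (m' aRK) (m' aQU) (m' aPR) (m' aQC 0) ∧
          i < m' aQC 0 ∧
          (∀ h < i, h < m' aQC 0 → ∀ v < N, mat N (m A) (m' aQU h) v ≠ 0 → m' aRK v ≠ 0) ∧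
          ∀ v < j, mat N (m A) (m' aQU i) v ≠ 0 → m' aRK v ≠ 0)
        (fun i m' v h => by
          rw [Mem.set_ne _ _ _ (by omega), Mem.set_ne _ _ _ (by omega),
            Mem.set_ne _ _ _ (by omega), Mem.set_ne _ _ _ (by omega)]; exact h)
        ⟨ht, by omega, hcl, by simp⟩ (by
          intro j m4 hj hxj hf4 ⟨ht4, hi4, hcl4, hin4⟩
          have hN4 : m4 1 2 = N := by rw [hf4 1 (by simp [writes]), hN3]
          have hA4 : m4 A = m A := by rw [hf4 A (by simp [writes]; omega), hA3]
          have hx4 : m4 6 0 = i := by rw [hf4 6 (by simp [writes]), hx]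
          rw [hN3] at hj
          rw [run_ite]
          have hval : (Expr.read A (ix (.read aQU (var xA)) (var xB))).val m4 =
              mat N (m A) (m4 aQU i) j := by
            simp only [val_read, val_ix, val_const, hx4, hxj, hN4, hA4, mat]
          rw [hval]
          by_cases hM : mat N (m A) (m4 aQU i) j = 0
          · simp only [hM, ne_eq, not_true, if_false, run_skip]
            refine ⟨ht4, hi4, hcl4, fun v hv hne => ?_⟩
            rcases Nat.lt_succ_iff_lt_or_eq.mp hv with hv | rfl
            · exact hin4 v hv hne
            · exact absurd hM hne
          simp only [hM, ne_eq, not_false_eq_true, if_true]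
          rw [run_ite]
          simp only [val_read, val_const, hxj]
          by_cases hr : m4 aRK j = 0
          · have ins := ht4.insert hi4 hj hM hr
            simp only [hr, ne_eq, not_true, if_false, run_seq, run_set, val_read, val_const,
              val_add, val_one, val_zero, hxj]
            set c := m4 aQC 0
            have hc1 : m4 5 0 = c := rfl
            have e5 : ((((m4.set 3 c j).set 4 j (m4 3 i)).set 5 0 (c + 1)).set 2 j (c + 1)) 5 0
              = c + 1 := by simp [Mem.set_apply]
            have e2 : ((((m4.set 3 c j).set 4 j (m4 3 i)).set 5 0 (c + 1)).set 2 j (c + 1)) 2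
              = Function.update (m4 2) j (c + 1) := by
              rw [Mem.set_self, Mem.set_ne _ _ _ (by omega), Mem.set_ne _ _ _ (by omega),
                Mem.set_ne _ _ _ (by omega)]
            have e3 : ((((m4.set 3 c j).set 4 j (m4 3 i)).set 5 0 (c + 1)).set 2 j (c + 1)) 3
              = Function.update (m4 3) c j := by
              rw [Mem.set_ne _ _ _ (by omega), Mem.set_ne _ _ _ (by omega),
                Mem.set_ne _ _ _ (by omega), Mem.set_self]
            have e4 : ((((m4.set 3 c j).set 4 j (m4 3 i)).set 5 0 (c + 1)).set 2 j (c + 1)) 4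
              = Function.update (m4 4) j (m4 3 i) := by
              rw [Mem.set_ne _ _ _ (by omega), Mem.set_ne _ _ _ (by omega), Mem.set_self,
                Mem.set_ne _ _ _ (by omega)]
            have r1 : (m4.set 3 c j) 6 0 = i := by simp [Mem.set_apply, hx4]
            have r2 : (m4.set 3 c j) 7 0 = j := by simp [Mem.set_apply, hxj]
            have r3 : (m4.set 3 c j) 3 i = m4 3 i := by
              simp [Mem.set_apply]; intro h; omega
            have r4 : ((m4.set 3 c j).set 4 j (m4 3 i)) 5 0 = c := by
              simp [Mem.set_apply, hc1]
            have r5 : (((m4.set 3 c j).set 4 j (m4 3 i)).set 5 0 (c + 1)) 7 0 = j := by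
              simp [Mem.set_apply, hxj]
            have r6 : (((m4.set 3 c j).set 4 j (m4 3 i)).set 5 0 (c + 1)) 5 0 = c + 1 := by
              simp [Mem.set_apply]
            rw [r1, r2, r3, r4, r5, r6, e2, e3, e4, e5]
            refine ⟨ins, by omega, ?_, ?_⟩
            · intro h hh _ v hv
              rw [Function.update_of_ne (by omega : h ≠ c)]
              intro hne
              by_cases e : v = j
              · subst e; simp
              · rw [Function.update_of_ne e]; exact hcl4 h hh (by omega) v hv hne
            · intro v hv
              rw [Function.update_of_ne (by omega : i ≠ c)]
              intro hne
              by_cases e : v = j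
              · subst e; simp
              · rw [Function.update_of_ne e]; exact hin4 v (by omega) hne
          · simp only [hr, ne_eq, not_false_eq_true, if_true, run_skip]
            refine ⟨ht4, hi4, hcl4, fun v hv hne => ?_⟩
            rcases Nat.lt_succ_iff_lt_or_eq.mp hv with hv | rfl
            · exact hin4 v hv hne
            · exact hr)
      rw [hN3] at inner
      obtain ⟨i1, i2, i3, i4⟩ := inner
      refine ⟨i1, fun h hh hc v hv hne => ?_⟩
      rcases Nat.lt_succ_iff_lt_or_eq.mp hh with hh | rfl
      · exact i3 h hh hc v hv hne
      · exact i4 v hv hne)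
  rw [hN2, ← hm'] at key
  obtain ⟨k1, k2⟩ := key
  refine ⟨k1, fun u hu hru v hv hne => ?_⟩
  have := k1.rank u hu hru
  have hle := k1.le
  refine k2 (m' aRK u - 1) (by omega) (by omega) v hv ?_
  rw [this.2]; exact hne

end Middlebox

/-! ### Tracing back a path, and augmenting along it -/

namespace Middlebox

open Middlebox.Expr Middlebox.Cmd

variable {N s : ℕ} {M : ℕ → ℕ → ℕ} {rk qu pr : ℕ → ℕ} {c : ℕ}

/-- Ranks strictly decrease along the list of predecessors. This makes the nodes distinct and forces
the trace to arrive at the root within `N` rounds. -/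
theorem trace_spec {B P : ℕ} (hB : 8 ≤ B) (hP : 8 ≤ P) (hBP : B ≠ P) {m : Mem} (hN : m 1 2 = N)
    (hs : m 1 5 = s) (hsN : s < N) (ht : IsTree N s M (m aRK) (m aQU) (m aPR) (m aQC 0)) :
    let m' := (trace B P).run m
    (m' P 0 = 0 ∧ m aRK (N - 1) = 0) ∨ (m' P 0 ≠ 0 ∧ IsPath N s M (m' B) (m' P 0)) := by
  intro m'
  have hm' : m' = (trace B P).run m := rfl
  simp only [trace, run_seq, run_set, val_zero] at hm'
  set m1 := m.set P 0 0 with hm1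
  have f1 : ∀ a, a ≠ P → m1 a = m a := fun a h => Mem.set_ne _ _ _ h
  rw [run_ite] at hm'
  have hz : (Expr.read aRK (NE - 1)).val m1 = m aRK (N - 1) := by
    simp only [val_read, val_sub, val_NE, val_one]
    rw [f1 _ (by omega), f1 _ (by omega), hN]
  rw [hz] at hm'
  by_cases h0 : m aRK (N - 1) = 0
  · left
    simp only [h0, ne_eq, not_true, if_false, run_skip] at hm'
    exact ⟨by rw [hm']; simp [hm1, Mem.set_apply], h0⟩
  right
  simp only [h0, ne_eq, not_false_eq_true, if_true, run_seq, run_set] at hm'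
  set m2 := (m1.set B ((0 : Expr).val m1) ((NE - 1).val m1)) with hm2
  set m3 := m2.set P ((0 : Expr).val m2) ((1 : Expr).val m2) with hm3
  have f3 : ∀ a, a ≠ P → a ≠ B → m3 a = m a := fun a h h' => by
    rw [hm3, Mem.set_ne _ _ _ h, hm2, Mem.set_ne _ _ _ h', f1 a h]
  have hP3 : m3 P 0 = 1 := by simp [hm3, Mem.set_apply]
  have hB3 : m3 B 0 = N - 1 := by
    rw [hm3, Mem.set_ne _ _ _ hBP, hm2]
    simp only [Mem.set_apply, val_zero, and_self, if_true, val_sub, val_NE, val_one]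
    rw [f1 _ (by omega), hN]
  have hN3 : m3 1 2 = N := by rw [f3 1 (by omega) (by omega), hN]
  have key := run_loop_inv (x := xA) (p := 2) (m := m3)
    (c := .ite (neq (.read B (var P - 1)) sE)
        (.set B (var P) (.read aPR (.read B (var P - 1))) ;; .set P 0 (var P + 1)) .skip)
    (fun i m' => 1 ≤ m' P 0 ∧ m' B 0 = N - 1 ∧ (∀ h < m' P 0, m' B h < N ∧ m aRK (m' B h) ≠ 0) ∧
      (∀ h, h + 1 < m' P 0 → M (m' B (h + 1)) (m' B h) ≠ 0) ∧
      (∀ h' < m' P 0, ∀ h ≤ h', m aRK (m' B h') + (h' - h) ≤ m aRK (m' B h)) ∧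
      (m' B (m' P 0 - 1) = s ∨ m' P 0 = i + 1))
    (fun i m' v h => by
      rw [Mem.set_ne _ _ _ (by omega), Mem.set_ne _ _ _ (by omega)]; exact h)
    ⟨by omega, hB3, fun h hh => by
        obtain rfl : h = 0 := by omega
        rw [hB3]; exact ⟨by omega, h0⟩, fun h hh => by omega, fun h' hh' h hh => by
        obtain rfl : h' = 0 := by omega
        obtain rfl : h = 0 := by omega
        omega, Or.inr hP3⟩ (by
      intro i m4 hi hx hf ⟨i1, i2, i3, i4, i5, i6⟩
      have hs4 : m4 1 5 = s := by
        rw [hf 1 (by simp [writes]; omega), f3 1 (by omega) (by omega), hs]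
      have h44 : m4 4 = m 4 := by
        rw [hf 4 (by simp [writes]; omega), f3 4 (by omega) (by omega)]
      have hv := val_neq' m4 (.read B (var P - 1)) sE
      simp only [val_read, val_sub, val_const, val_one, val_sE, hs4] at hv
      set l := m4 P 0 with hl
      by_cases e : m4 B (l - 1) = s
      · rw [run_ite_neg (hv.2 e), run_skip]
        exact ⟨i1, i2, i3, i4, i5, Or.inl e⟩
      rw [run_ite_pos (fun h => e (hv.1 h))]
      simp only [run_seq, run_set, val_read, val_sub, val_add,
        val_const, val_one, val_zero]
      rw [← hl, h44]
      set y := m4 B (l - 1) with hy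
      obtain ⟨hyN, hy0⟩ := i3 (l - 1) (by omega)
      -- Rank 1 belongs to the root alone, and `y` is not the root.
      have hy2 : 2 ≤ m aRK y := by
        by_contra h
        have := (ht.rank y hyN hy0).2
        rw [show m aRK y - 1 = 0 by omega, ht.root] at this
        exact e this.symm
      obtain ⟨p1, p2, p3, p4⟩ := ht.pred y hyN hy2
      have e0 : (m4.set B l (m 4 y)) P 0 = l := by rw [Mem.set_ne _ _ _ hBP.symm]
      rw [e0]
      have eP : ((m4.set B l (m 4 y)).set P 0 (l + 1)) P 0 = l + 1 := by simp [Mem.set_apply]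
      have eB : ((m4.set B l (m 4 y)).set P 0 (l + 1)) B = Function.update (m4 B) l (m 4 y) := by
        rw [Mem.set_ne _ _ _ hBP, Mem.set_self]
      rw [eP, eB]
      have eu : ∀ h < l, Function.update (m4 B) l (m 4 y) h = m4 B h := fun h hh =>
        Function.update_of_ne (by omega) _ _
      have el : Function.update (m4 B) l (m 4 y) l = m 4 y := Function.update_self _ _ _
      refine ⟨by omega, by rw [eu 0 (by omega), i2], ?_, ?_, ?_, Or.inr ?_⟩
      · intro h hh
        rcases Nat.lt_succ_iff_lt_or_eq.mp hh with hh | rfl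
        · rw [eu h hh]; exact i3 h hh
        · rw [el]; exact ⟨p1, by omega⟩
      · intro h hh
        rcases Nat.lt_succ_iff_lt_or_eq.mp hh with hh | hh
        · rw [eu h (by omega), eu (h + 1) hh]; exact i4 h hh
        · have : h = l - 1 := by omega
          rw [hh, el, eu h (by omega), this]; exact p4
      · intro h' hh' h hh
        rcases Nat.lt_succ_iff_lt_or_eq.mp hh' with hh' | rfl
        · rw [eu h (by omega), eu h' (by omega)]; exact i5 h' hh' h hh
        · rw [el]
          by_cases e : h = l
          · rw [e, el]; omega
          · rw [eu h (by omega)]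
            have := i5 (l - 1) (by omega) h (by omega)
            rw [← hy] at this
            omega
      · rcases i6 with h | h
        · exact absurd h e
        · exact congrArg (· + 1) h)
  rw [hN3, ← hm'] at key
  obtain ⟨k1, k2, k3, k4, k5, k6⟩ := key
  refine ⟨by omega, k1, k2, ?_, fun h hh => (k3 h hh).1, k4, ?_⟩
  · rcases k6 with h | h
    · exact h
    -- Otherwise the list has `N + 1` entries of strictly decreasing positive rank, although ranks
    -- are at most `N`.
    · exfalso
      have a1 := k5 N (by omega) 0 (by omega)
      have a2 := (k3 0 (by omega))
      have a3 := (ht.rank _ a2.1 a2.2).1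
      have a4 := ht.le
      have a5 := (k3 N (by omega)).2
      omega
  · intro h hh h' hh' e
    rcases lt_trichotomy h h' with hlt | rfl | hlt
    · have := k5 h' hh' h hlt.le
      rw [e] at this; omega
    · rfl
    · have := k5 h hh h' hlt.le
      rw [e] at this; omega

theorem bfs_writes (A : ℕ) : (bfs A).writes = [6, 2, 3, 2, 5, 6, 7, 3, 4, 5, 2] := rfl

theorem trace_writes (B P : ℕ) : (trace B P).writes = [P, B, P, 6, B, P] := rfl

theorem path_writes (A B P : ℕ) :
    (path A B P).writes = [6, 2, 3, 2, 5, 6, 7, 3, 4, 5, 2, P, B, P, 6, B, P] := rfl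

/-- The search either finds a path or a cut without outgoing arcs. -/
theorem path_spec {A B P : ℕ} (hA : 8 ≤ A) (hB : 8 ≤ B) (hP : 8 ≤ P) (hBP : B ≠ P) {m : Mem}
    (hN : m 1 2 = N) (hs : m 1 5 = s) (hsN : s < N) :
    let m' := (path A B P).run m
    (m' P 0 = 0 ∧ ∃ S, IsCut N s S ∧ ∀ u ∈ S, ∀ v < N, v ∉ S → mat N (m A) u v = 0) ∨
      (m' P 0 ≠ 0 ∧ IsPath N s (mat N (m A)) (m' B) (m' P 0)) := by
  intro m'
  obtain ⟨h1, h2⟩ := bfs_spec hA hN hs hsN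
  have f1 : (bfs A).run m 1 = m 1 := run_frame _ (by simp [bfs_writes]) m
  rcases trace_spec hB hP hBP (m := (bfs A).run m) (by rw [f1, hN]) (by rw [f1, hs]) hsN h1 with h | h
  · left
    refine ⟨h.1, (Finset.range N).filter fun v => (bfs A).run m aRK v ≠ 0,
      ⟨Finset.filter_subset _ _, ?_, by simp [h.2]⟩, ?_⟩
    · have := (h1.queue 0 (by have := h1.pos; omega)).2
      rw [h1.root] at this
      simp only [Finset.mem_filter, Finset.mem_range]
      exact ⟨hsN, by omega⟩
    · intro u hu v hv hv'
      simp only [Finset.mem_filter, Finset.mem_range, not_and] at hu hv'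
      by_contra hne
      exact hv' hv (h2 u hu.1 hu.2 v hv hne)
  · exact Or.inr h

/-! ### Maximum flow -/

theorem IsRes.congr {val : ℕ} {c r r' : ℕ → ℕ → ℕ} (h : IsRes N s c r val)
    (hr : ∀ u < N, ∀ v < N, r' u v = r u v) : IsRes N s c r' val :=
  ⟨fun u hu v hv => by rw [hr u hu v hv, hr v hv u hu]; exact h.anti u hu v hv, fun u hu => by
    rw [← h.net u hu]
    exact Finset.sum_congr rfl fun v hv => by rw [hr u hu v (by simpa using hv)]⟩

theorem mat_set {m : Mem} {A u v x u' v' : ℕ} (hv : v < N) (hv' : v' < N) :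
    mat N ((m.set A (u * N + v) x) A) u' v' = if u' = u ∧ v' = v then x else mat N (m A) u' v' := by
  simp only [mat, Mem.set_apply, true_and, ix_inj hv' hv]

theorem push_spec {m : Mem} (hN : m 1 2 = N)
    (hp : IsPath N s (mat N (m aRES)) (m aPB) (m aLP 0)) :
    ∀ u < N, ∀ v < N, mat N (push.run m aRES) u v =
      pushPath (mat N (m aRES)) (m aPB) (m aLP 0 - 1) u v := by
  have key := run_loop_inv (x := xA) (p := 2) (m := m)
    (c := .ite (var aLP - (var xA + 1))
    (.set aRES (ix (.read aPB (var xA + 1)) (.read aPB (var xA)))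
        (.read aRES (ix (.read aPB (var xA + 1)) (.read aPB (var xA))) - 1) ;;
      .set aRES (ix (.read aPB (var xA)) (.read aPB (var xA + 1)))
        (.read aRES (ix (.read aPB (var xA)) (.read aPB (var xA + 1))) + 1))
    .skip)
    (fun i m' => ∀ u < N, ∀ v < N, mat N (m' aRES) u v =
      pushPath (mat N (m aRES)) (m aPB) (min i (m aLP 0 - 1)) u v)
    (fun i m' v h => by rw [Mem.set_ne _ _ _ (by omega)]; exact h)
    (fun u _ v _ => by simp [pushPath]) (by
      intro i m1 hi hx hf h
      have f1 : m1 1 = m 1 := hf 1 (by simp [writes])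
      have f10 : m1 10 = m 10 := hf 10 (by simp [writes])
      have f11 : m1 11 = m 11 := hf 11 (by simp [writes])
      rw [run_ite]
      simp only [val_sub, val_add, val_read, val_const, val_one, hx, f11]
      by_cases hl : m 11 0 - (i + 1) = 0
      · simp only [hl, ne_eq, not_true, if_false, run_skip]
        rw [show min (i + 1) (m 11 0 - 1) = min i (m 11 0 - 1) by omega]
        exact h
      simp only [hl, ne_eq, not_false_eq_true, if_true, run_seq, run_set, val_ix, val_sub, val_add,
        val_read, val_const, val_one, hx, f10, f1, hN]
      rw [show min (i + 1) (m 11 0 - 1) = i + 1 by omega]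
      rw [show min i (m 11 0 - 1) = i by omega] at h
      set p := m 10 (i + 1)
      set q := m 10 i
      have hp' : p < N := hp.lt _ (by omega)
      have hq' : q < N := hp.lt _ (by omega)
      have hpq : p ≠ q := fun e => by have := hp.inj _ (by omega) _ (by omega) e; omega
      set m2 := m1.set 9 (p * N + q) (m1 9 (p * N + q) - 1) with hm2
      have g : ∀ a, a ≠ 9 → m2 a = m1 a := fun a h => Mem.set_ne _ _ _ h
      rw [g 10 (by omega), g 6 (by omega), g 1 (by omega), f10, f1, hx, hN]
      intro u hu v hv
      rw [mat_set hp' hv, hm2, mat_set hq' hv]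
      simp only [pushPath, pushArc]
      have e1 : m1 9 (p * N + q) = mat N (m1 9) p q := rfl
      have e2 : (m1.set 9 (p * N + q) (m1 9 (p * N + q) - 1)) 9 (q * N + p) = mat N (m1 9) q p := by
        have := mat_set (m := m1) (A := 9) (u := p) (x := m1 9 (p * N + q) - 1) (u' := q) hq' hp'
        rw [if_neg (by omega)] at this
        exact this
      rw [e2, e1, h u hu v hv, h p hp' q hq', h q hq' p hp']
      by_cases c1 : u = q ∧ v = p
      · rw [if_pos c1, if_pos c1, c1.1, c1.2]
      · rw [if_neg c1, if_neg c1]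
        by_cases c2 : u = p ∧ v = q
        · rw [if_pos c2, if_pos c2, c2.1, c2.2]
        · rw [if_neg c2, if_neg c2])
  rw [hN, min_eq_right (by have := hp.le; omega)] at key
  exact key

theorem push_writes : push.writes = [6, 9, 9] := rfl

theorem maxflow_writes : maxflow.writes =
    [12, 8, 6, 2, 3, 2, 5, 6, 7, 3, 4, 5, 2, 11, 10, 11, 6, 10, 11, 12, 6, 9, 9] := rfl

/-- The invariant is that every round so far has augmented or else some cut is tight. Either
alternative certifies the count as the maximum truncated at `K`. -/
theorem maxflow_spec {K : ℕ} {m : Mem} (hN : m 1 2 = N) (hK : m 1 3 = K) (hs : m 1 5 = s)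
    (hsN : s < N) (hc : ∀ u < N, ∀ v < N, mat N (m aRES) u v = mat N (m aCAP) u v) :
    let m' := maxflow.run m
    IsFlowVal N s K (mat N (m aCAP)) (m' aCNT 0) ∧
      IsRes N s (mat N (m aCAP)) (mat N (m' aRES)) (m' aCNT 0) := by
  intro m'
  have hm' : m' = maxflow.run m := rfl
  simp only [maxflow, run_seq, run_set, val_zero] at hm'
  set m1 := m.set aCNT 0 0 with hm1
  have f1 : ∀ a, a ≠ 12 → m1 a = m a := fun a h => Mem.set_ne _ _ _ h
  have hK1 : m1 1 3 = K := by rw [f1 1 (by omega), hK]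
  have key := run_loop_inv (x := xC) (p := 3) (m := m1)
    (c := path aRES aPB aLP ;;
    .ite (var aLP) (.set aCNT 0 (var aCNT + 1) ;; push) .skip)
    (fun i m' => m' aCNT 0 ≤ i ∧ IsRes N s (mat N (m aCAP)) (mat N (m' aRES)) (m' aCNT 0) ∧
      (m' aCNT 0 = i ∨ ∃ S, IsCut N s S ∧ cutCap N (mat N (m aCAP)) S = m' aCNT 0))
    (fun i m' v h => by
      rw [Mem.set_ne _ _ _ (by omega), Mem.set_ne _ _ _ (by omega)]; exact h)
    ⟨by simp [hm1, Mem.set_apply], by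
      have : m1 12 0 = 0 := by simp [hm1, Mem.set_apply]
      rw [this, f1 9 (by omega)]
      exact (IsRes.refl N s _).congr hc, Or.inl (by simp [hm1, Mem.set_apply])⟩ (by
      intro i m2 hi hx hf ⟨i1, i2, i3⟩
      have h21 : m2 1 = m 1 := by
        rw [hf 1 (by simp [writes, path_writes, push_writes]), f1 1 (by omega)]
      have hps := path_spec (A := 9) (B := 10) (P := 11) (m := m2) (N := N) (s := s) (by omega)
        (by omega) (by omega) (by omega) (by rw [h21, hN]) (by rw [h21, hs]) hsN
      rw [run_seq]
      set m3 := (path 9 10 11).run m2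
      have f3 : ∀ a, a = 1 ∨ a = 9 ∨ 12 ≤ a → m3 a = m2 a := fun a h =>
        run_frame _ (by simp [path_writes]; omega) m2
      rcases hps with ⟨hl, S, hS, hS0⟩ | ⟨hl, hp⟩
      · rw [run_ite_neg (e := var 11) (m := m3) hl, run_skip]
        rw [f3 12 (by omega), f3 9 (by omega)]
        exact ⟨by omega, i2, Or.inr ⟨S, hS, i2.cutCap_eq hS hS0⟩⟩
      · rw [run_ite_pos (e := var 11) (m := m3) hl]
        simp only [run_seq, run_set, val_add, val_read, val_const, val_zero, val_one]
        rw [f3 12 (by omega)]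
        set m4 := m3.set 12 0 (m2 12 0 + 1) with hm4
        have f4 : ∀ a, a ≠ 12 → m4 a = m3 a := fun a h => Mem.set_ne _ _ _ h
        have e12 : push.run m4 12 0 = m2 12 0 + 1 := by
          rw [run_frame _ (by simp [push_writes]), hm4]; simp [Mem.set_apply]
        have hp4 : IsPath N s (mat N (m4 9)) (m4 10) (m4 11 0) := by
          rw [f4 9 (by omega), f4 10 (by omega), f4 11 (by omega), f3 9 (by omega)]
          exact hp
        have hpush := push_spec (by rw [f4 1 (by omega), f3 1 (by omega), h21, hN]) hp4
        have i2' : IsRes N s (mat N (m aCAP)) (mat N (m4 9)) (m2 12 0) := by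
          rw [f4 9 (by omega), f3 9 (by omega)]; exact i2
        have hres := (hp4.pushPath_isRes i2').congr hpush
        rw [e12]
        refine ⟨by omega, hres, ?_⟩
        rcases i3 with e | ⟨S, hS, e⟩
        · left; omega
        -- One more unit would exceed a cut that was already tight.
        · exfalso
          have := hres.le_cutCap hS
          omega)
  rw [hK1, ← hm'] at key
  exact ⟨⟨key.1, fun S hS => key.2.1.le_cutCap hS, key.2.2⟩, key.2.1⟩

/-! ### Flow decomposition -/

theorem saveFlow_spec {G : ℕ} (hG : 14 ≤ G) {m : Mem} (hN : m 1 2 = N) :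
    ∀ u < N, ∀ v < N, mat N ((saveFlow G).run m G) u v =
      mat N (m aCAP) u v - mat N (m aRES) u v := by
  have key := run_loop_inv (x := xA) (p := 2) (m := m)
    (c := .loop xB 2 (.set G (ix (var xA) (var xB))
      (.read aCAP (ix (var xA) (var xB)) - .read aRES (ix (var xA) (var xB)))))
    (fun i m' => ∀ u < i, ∀ v < N, mat N (m' G) u v = mat N (m aCAP) u v - mat N (m aRES) u v)
    (fun i m' v h => by rw [Mem.set_ne _ _ _ (by omega)]; exact h) (by simp) (by
      intro i m1 hi hx hf h
      have inner := run_loop_inv (x := xB) (p := 2) (m := m1)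
        (c := .set G (ix (var xA) (var xB))
          (.read aCAP (ix (var xA) (var xB)) - .read aRES (ix (var xA) (var xB))))
        (fun j m' => (∀ u < i, ∀ v < N, mat N (m' G) u v = mat N (m aCAP) u v - mat N (m aRES) u v) ∧
          ∀ v < j, mat N (m' G) i v = mat N (m aCAP) i v - mat N (m aRES) i v)
        (fun i m' v h => by rw [Mem.set_ne _ _ _ (by omega)]; exact h) ⟨h, by simp⟩ (by
          intro j m2 hj hxj hf2 ⟨h2, h3⟩
          have g : ∀ a, a ≠ 6 → a ≠ 7 → a ≠ G → m2 a = m a := fun a a6 a7 aG => by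
            rw [hf2 a (by simp [writes]; omega), hf a (by simp [writes]; omega)]
          have hx2 : m2 6 0 = i := by rw [hf2 6 (by simp [writes]; omega), hx]
          have hjN : j < N := by
            rw [hf 1 (by simp [writes]; omega), hN] at hj; exact hj
          simp only [run_set, val_ix, val_sub, val_read, val_const, hx2, hxj]
          rw [g 1 (by omega) (by omega) (by omega), g 13 (by omega) (by omega) (by omega),
            g 9 (by omega) (by omega) (by omega), hN]
          refine ⟨fun u hu v hv => ?_, fun v hv => ?_⟩
          · rw [mat_set hjN hv, if_neg (by omega), h2 u hu v hv]
          · rw [mat_set hjN (by omega)]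
            by_cases e : v = j
            · subst e; simp [mat]
            · rw [if_neg (by omega), h3 v (by omega)])
      rw [hf 1 (by simp [writes]; omega), hN] at inner
      intro u hu v hv
      rcases Nat.lt_succ_iff_lt_or_eq.mp hu with hu | rfl
      · exact inner.1 u hu v hv
      · exact inner.2 v hv)
  rw [hN] at key
  exact key

theorem pull_spec {G B P : ℕ} (hG : 8 ≤ G) (hB : 8 ≤ B) (hP : 8 ≤ P) (hBG : B ≠ G) (hPG : P ≠ G)
    {m : Mem} (hN : m 1 2 = N)
    (hp : IsPath N s (mat N (m G)) (m B) (m P 0)) :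
    ∀ u < N, ∀ v < N, mat N ((pull G B P).run m G) u v =
      pullPath (mat N (m G)) (m B) (m P 0 - 1) u v := by
  have key := run_loop_inv (x := xA) (p := 2) (m := m)
    (c := .ite (var P - (var xA + 1))
    (.set G (ix (.read B (var xA + 1)) (.read B (var xA)))
        (.read G (ix (.read B (var xA + 1)) (.read B (var xA))) - 1))
    .skip)
    (fun i m' => ∀ u < N, ∀ v < N, mat N (m' G) u v =
      pullPath (mat N (m G)) (m B) (min i (m P 0 - 1)) u v)
    (fun i m' v h => by rw [Mem.set_ne _ _ _ (by omega)]; exact h)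
    (fun u _ v _ => by simp [pullPath]) (by
      intro i m1 hi hx hf h
      have f1 : m1 1 = m 1 := hf 1 (by simp [writes]; omega)
      have f10 : m1 B = m B := hf B (by simp [writes]; omega)
      have f11 : m1 P = m P := hf P (by simp [writes]; omega)
      rw [run_ite]
      simp only [val_sub, val_add, val_read, val_const, val_one, hx, f11]
      by_cases hl : m P 0 - (i + 1) = 0
      · simp only [hl, ne_eq, not_true, if_false, run_skip]
        rw [show min (i + 1) (m P 0 - 1) = min i (m P 0 - 1) by omega]
        exact h
      simp only [hl, ne_eq, not_false_eq_true, if_true, run_set, val_ix, val_sub, val_add,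
        val_read, val_const, val_one, hx, f10, f1, hN]
      rw [show min (i + 1) (m P 0 - 1) = i + 1 by omega]
      rw [show min i (m P 0 - 1) = i by omega] at h
      have hp' : m B (i + 1) < N := hp.lt _ (by omega)
      have hq' : m B i < N := hp.lt _ (by omega)
      intro u hu v hv
      rw [mat_set hq' hv]
      simp only [pullPath, pullArc]
      have e1 : m1 G (m B (i + 1) * N + m B i) = mat N (m1 G) (m B (i + 1)) (m B i) := rfl
      rw [e1, h u hu v hv, h _ hp' _ hq']
      split
      · rename_i c; rw [c.1, c.2]
      · rfl)
  rw [hN, min_eq_right (by have := hp.le; omega)] at key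
  exact key

theorem saveFlow_writes (G : ℕ) : (saveFlow G).writes = [6, 7, G] := rfl
theorem pull_writes (G B P : ℕ) : (pull G B P).writes = [6, G] := rfl

end Middlebox

namespace Middlebox

open Middlebox.Expr Middlebox.Cmd

/-! ## The networks -/

/-- The input and the parameters derived from it. -/
structure Params where
  inp : ℕ → ℕ
  n : ℕ
  d : ℕ
  s : ℕ
  K : ℕ
  L : ℕ
  s_lt : s < n
  sink_lt : ∀ i < d, inp (4 + 2 * (n * n) + 4 * n + 3 * i) < n

namespace Params

variable (p : Params)

/-- The number of network nodes. -/
def N : ℕ := p.n + (p.n + p.d) + 1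

def capPos (u v : ℕ) : ℕ := 4 + 2 * (u * p.n + v)
def procPos (v : ℕ) : ℕ := 4 + 2 * (p.n * p.n) + 2 * v
def pricePos (v : ℕ) : ℕ := 4 + 2 * (p.n * p.n) + 2 * p.n + 2 * v
def demPos (i : ℕ) : ℕ := 4 + 2 * (p.n * p.n) + 4 * p.n + 3 * i

/-- The number at position `i` in units of the `L`-th part of the number at position `x`. -/
def scaled (x i : ℕ) : ℕ :=
  (p.inp i * (p.inp (x + 1) * p.L)) / (p.inp (i + 1) * p.inp x)

/-- The vertex to which a terminal is attached. -/
def att (j : ℕ) : ℕ := if j < p.n then j else p.inp (p.demPos (j - p.n))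

/-- The capacities of the network with terminal capacities `rv`. -/
def capF (x : ℕ) (rv : ℕ → ℕ) (u v : ℕ) : ℕ :=
  if u < p.n then
    if v < p.n then p.scaled x (p.capPos u v)
    else if v < p.N - 1 ∧ p.att (v - p.n) = u then rv (v - p.n) else 0
  else if v = p.N - 1 ∧ u < p.N - 1 then rv (u - p.n) else 0

def rvP (x : ℕ) (T : Finset ℕ) (j : ℕ) : ℕ := if j ∈ T then p.scaled x (p.procPos j) else 0

def rvD (x : ℕ) (j : ℕ) : ℕ := if j < p.n then 0 else p.scaled x (p.demPos (j - p.n) + 1)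

/-- The capacity of the cut given by a set of vertices. -/
def rcut (x : ℕ) (rv : ℕ → ℕ) (A : Finset ℕ) : ℕ :=
  (∑ u ∈ Finset.range p.n, ∑ v ∈ Finset.range p.n,
    if u ∈ A ∧ v ∉ A then p.scaled x (p.capPos u v) else 0) +
  ∑ j ∈ Finset.range (p.n + p.d), if p.att j ∈ A then rv j else 0

/-- The minimum capacity of a cut. -/
noncomputable def mcut (x : ℕ) (rv : ℕ → ℕ) : ℕ :=
  sInf (p.rcut x rv '' {A | A ⊆ Finset.range p.n ∧ p.s ∈ A})

/-- The maximum flow to the purchased vertices, truncated. -/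
noncomputable def flowP (x : ℕ) (T : Finset ℕ) : ℕ := min p.K (p.mcut x (p.rvP x T))

/-- The maximum flow to the sinks, truncated. -/
noncomputable def flowD (x : ℕ) : ℕ := min p.K (p.mcut x (p.rvD x))

variable {p}

theorem att_lt {j : ℕ} (hj : j < p.n + p.d) : p.att j < p.n := by
  unfold att
  split
  · assumption
  · exact p.sink_lt _ (by omega)

theorem mcut_le {x : ℕ} {rv : ℕ → ℕ} {A : Finset ℕ} (h : A ⊆ Finset.range p.n) (hs : p.s ∈ A) :
    p.mcut x rv ≤ p.rcut x rv A := Nat.sInf_le ⟨A, ⟨h, hs⟩, rfl⟩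

theorem exists_mcut (p : Params) (x : ℕ) (rv : ℕ → ℕ) :
    ∃ A, A ⊆ Finset.range p.n ∧ p.s ∈ A ∧ p.rcut x rv A = p.mcut x rv := by
  have : p.mcut x rv ∈ p.rcut x rv '' {A | A ⊆ Finset.range p.n ∧ p.s ∈ A} :=
    Nat.sInf_mem ⟨_, Finset.range p.n, ⟨le_rfl, by simpa using p.s_lt⟩, rfl⟩
  obtain ⟨A, ⟨h1, h2⟩, h3⟩ := this
  exact ⟨A, h1, h2, h3⟩

/-- A terminal forms a path of two arcs of equal capacity from its vertex to the artificial sink. It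
costs its capacity once if it or its vertex lies in `S`, and nothing otherwise. -/
theorem cutCap_capF {x : ℕ} {rv : ℕ → ℕ} {S : Finset ℕ} (hS : IsCut p.N p.s S) :
    cutCap p.N (p.capF x rv) S =
      (∑ u ∈ Finset.range p.n, ∑ v ∈ Finset.range p.n,
        if u ∈ S ∧ v ∉ S then p.scaled x (p.capPos u v) else 0) +
      ∑ j ∈ Finset.range (p.n + p.d),
        if p.n + j ∈ S then rv j else if p.att j ∈ S then rv j else 0 := by
  have e0 : cutCap p.N (p.capF x rv) S = ∑ u ∈ Finset.range p.N, ∑ v ∈ Finset.range p.N,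
      if u ∈ S ∧ v ∉ S then p.capF x rv u v else 0 := by
    rw [cutCap, ← Finset.sum_sdiff hS.subset, Finset.sum_eq_zero (s := Finset.range p.N \ S),
      zero_add]
    · refine Finset.sum_congr rfl fun u hu => ?_
      rw [← Finset.sum_sdiff hS.subset, Finset.sum_eq_zero (s := S), add_zero]
      · exact Finset.sum_congr rfl fun v hv => by
          simp only [Finset.mem_sdiff] at hv; simp [hu, hv.2]
      · intro v hv; simp [hv]
    · intro u hu
      simp only [Finset.mem_sdiff] at hu
      simp [hu.2]
  have hz : p.N - 1 = p.n + (p.n + p.d) := by simp [N]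
  have hzS := hS.notMem
  rw [hz] at hzS
  have r1 : ∀ u ∈ Finset.range p.n, (∑ v ∈ Finset.range p.N,
      if u ∈ S ∧ v ∉ S then p.capF x rv u v else 0) =
      (∑ v ∈ Finset.range p.n, if u ∈ S ∧ v ∉ S then p.scaled x (p.capPos u v) else 0) +
      ∑ j ∈ Finset.range (p.n + p.d),
        if u = p.att j then (if p.n + j ∈ S then 0 else if p.att j ∈ S then rv j else 0) else 0 := by
    intro u hu
    have hu : u < p.n := by simpa using hu
    rw [N, Finset.sum_range_succ, Finset.sum_range_add]
    have e3 : (if u ∈ S ∧ p.n + (p.n + p.d) ∉ S then p.capF x rv u (p.n + (p.n + p.d)) else 0) = 0 := by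
      simp [capF, hu, hz]
    rw [e3, add_zero]
    congr 1
    · refine Finset.sum_congr rfl fun v hv => ?_
      have hv : v < p.n := by simpa using hv
      simp [capF, hu, hv]
    · refine Finset.sum_congr rfl fun j hj => ?_
      have hj : j < p.n + p.d := by simpa using hj
      by_cases e : u = p.att j
      · subst e
        simp only [capF, hu, if_true, hz]
        by_cases h1 : p.n + j ∈ S <;> by_cases h2 : p.att j ∈ S <;> simp [h1, h2, hj]
      · have e' : ¬ p.att j = u := fun h => e h.symm
        simp [capF, hu, e, e']
  have r2 : ∀ j ∈ Finset.range (p.n + p.d), (∑ v ∈ Finset.range p.N,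
      if p.n + j ∈ S ∧ v ∉ S then p.capF x rv (p.n + j) v else 0) =
      if p.n + j ∈ S then rv j else 0 := by
    intro j hj
    have hj : j < p.n + p.d := by simpa using hj
    rw [N, Finset.sum_range_succ, Finset.sum_eq_zero]
    · by_cases h1 : p.n + j ∈ S <;> simp [capF, h1, hz, hzS, hj]
    · intro v hv
      have hv : v < p.n + (p.n + p.d) := by simpa using hv
      have : v ≠ p.n + (p.n + p.d) := by omega
      simp [capF, hz, this]
  have e1 : cutCap p.N (p.capF x rv) S = (∑ u ∈ Finset.range p.n, ∑ v ∈ Finset.range p.N,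
      if u ∈ S ∧ v ∉ S then p.capF x rv u v else 0) + (∑ j ∈ Finset.range (p.n + p.d),
      ∑ v ∈ Finset.range p.N, if p.n + j ∈ S ∧ v ∉ S then p.capF x rv (p.n + j) v else 0) + 0 := by
    rw [e0]
    conv_lhs => rw [N, Finset.sum_range_succ, Finset.sum_range_add]
    congr 1
    exact Finset.sum_eq_zero fun v _ => by simp [hzS]
  rw [e1, Finset.sum_congr rfl r1, Finset.sum_congr rfl r2, Finset.sum_add_distrib, add_zero,
    add_assoc, Finset.sum_comm (s := Finset.range p.n) (t := Finset.range (p.n + p.d)),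
    ← Finset.sum_add_distrib]
  congr 1
  refine Finset.sum_congr rfl fun j hj => ?_
  have hj : j < p.n + p.d := by simpa using hj
  rw [Finset.sum_ite_eq']
  have := att_lt hj
  simp only [Finset.mem_range, this, if_true]
  split_ifs <;> simp

theorem rcut_le_cutCap {x : ℕ} {rv : ℕ → ℕ} {S : Finset ℕ} (hS : IsCut p.N p.s S) :
    p.mcut x rv ≤ cutCap p.N (p.capF x rv) S := by
  refine (mcut_le (A := S.filter (· < p.n)) (fun v hv => ?_) ?_).trans ?_
  · simp only [Finset.mem_filter] at hv; simpa using hv.2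
  · simp [hS.mem, p.s_lt]
  rw [cutCap_capF hS, rcut]
  refine add_le_add (Finset.sum_le_sum fun u hu => Finset.sum_le_sum fun v hv => ?_)
    (Finset.sum_le_sum fun j hj => ?_)
  · have hu : u < p.n := by simpa using hu
    have hv : v < p.n := by simpa using hv
    simp [hu, hv]
  · have hj : p.att j < p.n := att_lt (by simpa using hj)
    simp only [Finset.mem_filter, hj, and_true]
    split_ifs <;> simp

/-- Each terminal is put on the side of the vertex to which it is attached, so that none costs more
than necessary. -/
theorem exists_cutCap_le {A : Finset ℕ} (h : A ⊆ Finset.range p.n) (hs : p.s ∈ A) (x : ℕ)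
    (rv : ℕ → ℕ) : ∃ S, IsCut p.N p.s S ∧ cutCap p.N (p.capF x rv) S ≤ p.rcut x rv A := by
  have hA : ∀ v ∈ A, v < p.n := fun v hv => by simpa using h hv
  have hc : IsCut p.N p.s (A ∪ ((Finset.range (p.n + p.d)).filter fun j => p.att j ∈ A).image (p.n + ·)) := by
    refine ⟨fun v hv => ?_, by simp [hs], ?_⟩
    · simp only [Finset.mem_union, Finset.mem_image, Finset.mem_filter, Finset.mem_range] at hv ⊢
      rcases hv with hv | ⟨j, ⟨hj, _⟩, rfl⟩
      · have := hA v hv; simp only [N]; omega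
      · simp only [N]; omega
    · simp only [Finset.mem_union, Finset.mem_image, Finset.mem_filter, Finset.mem_range, N]
      rintro (hv | ⟨j, ⟨hj, _⟩, e⟩)
      · have := hA _ hv; omega
      · omega
  refine ⟨_, hc, ?_⟩
  rw [cutCap_capF hc, rcut]
  have hlt : ∀ v < p.n, (v ∈ A ∪ ((Finset.range (p.n + p.d)).filter fun j => p.att j ∈ A).image
      (p.n + ·) ↔ v ∈ A) := by
    intro v hv
    simp only [Finset.mem_union, Finset.mem_image, Finset.mem_filter, Finset.mem_range,
      or_iff_left_iff_imp]
    rintro ⟨j, _, e⟩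
    omega
  refine add_le_add (Finset.sum_le_sum fun u hu => Finset.sum_le_sum fun v hv => ?_)
    (Finset.sum_le_sum fun j hj => ?_)
  · simp only [hlt u (by simpa using hu), hlt v (by simpa using hv), le_refl]
  · have hj : j < p.n + p.d := by simpa using hj
    have : (p.n + j ∈ A ∪ ((Finset.range (p.n + p.d)).filter fun j => p.att j ∈ A).image
      (p.n + ·) ↔ p.att j ∈ A) := by
      simp only [Finset.mem_union, Finset.mem_image, Finset.mem_filter, Finset.mem_range]
      constructor
      · rintro (hv | ⟨i, ⟨_, h⟩, e⟩)
        · have := hA _ hv; omega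
        · rwa [show j = i by omega]
      · exact fun h => Or.inr ⟨j, ⟨hj, h⟩, rfl⟩
    simp only [this, hlt _ (att_lt hj)]
    split_ifs <;> simp

theorem flowVal_eq {x val : ℕ} {rv : ℕ → ℕ} (h : IsFlowVal p.N p.s p.K (p.capF x rv) val) :
    val = min p.K (p.mcut x rv) := by
  obtain ⟨A, hA, hs, e⟩ := p.exists_mcut x rv
  obtain ⟨S, hS, hle⟩ := exists_cutCap_le hA hs x rv
  have h1 := h.le
  have h2 := h.le_cut S hS
  rcases h.eq with h3 | ⟨S', hS', h3⟩
  · omega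
  · have := rcut_le_cutCap (x := x) (rv := rv) hS'
    omega

/-! ### Submodularity -/

/-- The usual uncrossing of directed cuts, here with varying terminal capacities: terminals attached
in both sets need `h3`, those attached in exactly one need `h1` or `h2`. -/
theorem rcut_uncross {x : ℕ} {r ra rb rab : ℕ → ℕ} (h1 : ∀ j, r j ≤ ra j) (h2 : ∀ j, r j ≤ rb j)
    (h3 : ∀ j, r j + rab j ≤ ra j + rb j) (A B : Finset ℕ) :
    p.rcut x r (A ∪ B) + p.rcut x rab (A ∩ B) ≤ p.rcut x ra A + p.rcut x rb B := by
  simp only [rcut]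
  have e1 : (∑ u ∈ Finset.range p.n, ∑ v ∈ Finset.range p.n,
        if u ∈ A ∪ B ∧ v ∉ A ∪ B then p.scaled x (p.capPos u v) else 0) +
      (∑ u ∈ Finset.range p.n, ∑ v ∈ Finset.range p.n,
        if u ∈ A ∩ B ∧ v ∉ A ∩ B then p.scaled x (p.capPos u v) else 0) ≤
      (∑ u ∈ Finset.range p.n, ∑ v ∈ Finset.range p.n,
        if u ∈ A ∧ v ∉ A then p.scaled x (p.capPos u v) else 0) +
      ∑ u ∈ Finset.range p.n, ∑ v ∈ Finset.range p.n,
        if u ∈ B ∧ v ∉ B then p.scaled x (p.capPos u v) else 0 := by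
    simp only [← Finset.sum_add_distrib]
    refine Finset.sum_le_sum fun u _ => Finset.sum_le_sum fun v _ => ?_
    simp only [Finset.mem_union, Finset.mem_inter]
    by_cases a : u ∈ A <;> by_cases b : u ∈ B <;> by_cases c : v ∈ A <;> by_cases d : v ∈ B <;>
      simp [a, b, c, d]
  have e2 : (∑ j ∈ Finset.range (p.n + p.d), if p.att j ∈ A ∪ B then r j else 0) +
      (∑ j ∈ Finset.range (p.n + p.d), if p.att j ∈ A ∩ B then rab j else 0) ≤
      (∑ j ∈ Finset.range (p.n + p.d), if p.att j ∈ A then ra j else 0) +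
      ∑ j ∈ Finset.range (p.n + p.d), if p.att j ∈ B then rb j else 0 := by
    simp only [← Finset.sum_add_distrib]
    refine Finset.sum_le_sum fun j _ => ?_
    have := h1 j
    have := h2 j
    have := h3 j
    simp only [Finset.mem_union, Finset.mem_inter]
    by_cases a : p.att j ∈ A <;> by_cases b : p.att j ∈ B <;> simp [a, b] <;> omega
  omega

theorem mcut_mono {x : ℕ} {r r' : ℕ → ℕ} (h : ∀ j, r j ≤ r' j) : p.mcut x r ≤ p.mcut x r' := by
  obtain ⟨A, hA, hs, e⟩ := p.exists_mcut x r'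
  rw [← e]
  refine (mcut_le hA hs).trans (Nat.add_le_add_left (Finset.sum_le_sum fun j _ => ?_) _)
  split_ifs
  · exact h j
  · exact le_rfl

theorem flowP_mono {x : ℕ} {X Y : Finset ℕ} (h : X ⊆ Y) : p.flowP x X ≤ p.flowP x Y := by
  refine min_le_min_left _ (mcut_mono fun j => ?_)
  unfold rvP
  by_cases hj : j ∈ X
  · simp [hj, h hj]
  · simp [hj]

/-- Take minimum cuts `A` for `insert v X` and `B` for `Y`. Their union is a cut for `X` and their
intersection one for `insert v Y`, and the terminal capacities satisfy the hypotheses of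
`rcut_uncross`. -/
theorem flowP_submod {x v : ℕ} {X Y : Finset ℕ} (h : X ⊆ Y) :
    p.flowP x X + p.flowP x (insert v Y) ≤ p.flowP x (insert v X) + p.flowP x Y := by
  -- Monotonicity enters through the truncation at `K`, which preserves submodularity of monotone
  -- functions.
  have m1 : p.flowP x X ≤ p.flowP x (insert v X) := flowP_mono (Finset.subset_insert _ _)
  have m2 : p.flowP x X ≤ p.flowP x Y := flowP_mono h
  obtain ⟨A, hA, hsA, eA⟩ := p.exists_mcut x (p.rvP x (insert v X))
  obtain ⟨B, hB, hsB, eB⟩ := p.exists_mcut x (p.rvP x Y)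
  have key := rcut_uncross (p := p) (x := x) (r := p.rvP x X) (ra := p.rvP x (insert v X))
    (rb := p.rvP x Y) (rab := p.rvP x (insert v Y))
    (fun j => by
      unfold rvP
      by_cases hj : j ∈ X <;> simp [hj])
    (fun j => by
      unfold rvP
      by_cases hj : j ∈ X
      · simp [hj, h hj]
      · simp [hj])
    (fun j => by
      unfold rvP
      by_cases hj : j ∈ X
      · simp [hj, h hj]
      · by_cases hv : j = v
        · subst hv; simp [hj]
        · simp [hj, hv])
    A B
  have k1 := mcut_le (p := p) (x := x) (rv := p.rvP x X) (A := A ∪ B) (Finset.union_subset hA hB)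
    (by simp [hsA])
  have k2 := mcut_le (p := p) (x := x) (rv := p.rvP x (insert v Y)) (A := A ∩ B)
    (Finset.inter_subset_left.trans hA) (by simp [hsA, hsB])
  unfold flowP at *
  omega

end Params

end Middlebox

/-! ### The networks in memory and their maximum flows -/

namespace Middlebox

open Middlebox.Expr Middlebox.Cmd

/-- The memory holds the input and the parameters. -/
structure Params.Holds (p : Params) (m : Mem) : Prop where
  inp : m 0 = p.inp
  n : m 1 0 = p.n
  d : m 1 1 = p.d
  N : m 1 2 = p.N
  K : m 1 3 = p.K
  L : m 1 4 = p.L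
  s : m 1 5 = p.s

/-- Moreover, it holds the vertices to which the terminals are attached. -/
structure Params.Ready (p : Params) (m : Mem) : Prop extends p.Holds m where
  att : ∀ j < p.n + p.d, m aATT j = p.att j

variable {p : Params}

theorem Params.Holds.frame {m m' : Mem} (h : p.Holds m) (h0 : m' 0 = m 0) (h1 : m' 1 = m 1) :
    p.Holds m' :=
  ⟨h0 ▸ h.inp, h1 ▸ h.n, h1 ▸ h.d, h1 ▸ h.N, h1 ▸ h.K, h1 ▸ h.L, h1 ▸ h.s⟩

theorem Params.Ready.frame {m m' : Mem} (h : p.Ready m) (h0 : m' 0 = m 0) (h1 : m' 1 = m 1)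
    (h15 : m' aATT = m aATT) : p.Ready m' :=
  ⟨h.toHolds.frame h0 h1, by rw [h15]; exact h.att⟩

theorem Params.s_lt_N (p : Params) : p.s < p.N := by have := p.s_lt; unfold N; omega

section
variable {m : Mem} (h : p.Holds m)
include h

theorem val_capPos (u v : Expr) : (capPos u v).val m = p.capPos (u.val m) (v.val m) := by
  simp [capPos, Params.capPos, h.n]
theorem val_procPos (v : Expr) : (procPos v).val m = p.procPos (v.val m) := by
  simp [procPos, Params.procPos, h.n]
theorem val_pricePos (v : Expr) : (pricePos v).val m = p.pricePos (v.val m) := by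
  simp [pricePos, Params.pricePos, h.n]
theorem val_demPos (v : Expr) : (demPos v).val m = p.demPos (v.val m) := by
  simp [demPos, Params.demPos, h.n]
theorem val_scaled (i : Expr) : (scaled i).val m = p.scaled (m aPOS 0) (i.val m) := by
  simp [scaled, Params.scaled, h.inp, h.L]

end

/-- Filling an initial segment of an array. -/
theorem run_fill {x q a : ℕ} {i e : Expr} {m : Mem} (hxa : x ≠ a) {o : ℕ} (F : ℕ → ℕ)
    (hF : ∀ j m', j < m 1 q → m' x 0 = j → (∀ b, b ≠ x → b ≠ a → m' b = m b) →
      i.val m' = o + j ∧ e.val m' = F j) :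
    ∀ j, (Cmd.loop x q (.set a i e)).run m a j =
      if o ≤ j ∧ j < o + m 1 q then F (j - o) else m a j := by
  have key := run_loop_inv (x := x) (p := q) (c := .set a i e) (m := m)
    (fun i m' => ∀ j, m' a j = if o ≤ j ∧ j < o + i then F (j - o) else m a j)
    (fun i m' v h => by rw [Mem.set_ne _ _ _ hxa.symm]; exact h)
    (fun j => by rw [if_neg (by omega)]) (by
      intro j m' hj hx hf h k
      obtain ⟨h1, h2⟩ := hF j m' hj hx (fun b hb hb' => hf b (by simp [writes, hb, hb']))
      rw [run_set, Mem.set_apply, h1, h2, h]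
      by_cases e : k = o + j
      · subst e; simp
      · rw [if_neg (by simp [e])]
        by_cases c : o ≤ k ∧ k < o + j
        · rw [if_pos c, if_pos (by omega)]
        · rw [if_neg c, if_neg (by omega)])
  exact key

theorem attach_spec {m : Mem} (h : p.Holds m) : p.Ready (attach.run m) := by
  have hw : ∀ a, a ≠ 6 → a ≠ 15 → attach.run m a = m a := fun a h6 h15 =>
    run_frame _ (by simp [attach, writes]; omega) m
  refine ⟨h.frame (hw 0 (by omega) (by omega)) (hw 1 (by omega) (by omega)), fun j hj => ?_⟩
  have e1 := run_fill (x := 6) (q := 0) (a := 15) (i := var 6) (e := var 6) (m := m) (by omega)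
    (o := 0) id (fun j m' _ hx _ => by simp [hx])
  set m1 := (Cmd.loop 6 0 (.set 15 (var 6) (var 6))).run m with hm1
  have f1 : ∀ a, a ≠ 6 → a ≠ 15 → m1 a = m a := fun a h6 h15 =>
    run_frame _ (by simp [writes]; omega) m
  have h1 : p.Holds m1 := h.frame (f1 0 (by omega) (by omega)) (f1 1 (by omega) (by omega))
  have e2 := run_fill (x := 6) (q := 1) (a := 15) (i := nE + var 6) (e := .read 0 (demPos (var 6)))
    (m := m1) (by omega) (o := p.n) (fun j => p.inp (p.demPos j)) (fun j m' _ hx hf => by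
      have h' : p.Holds m' := h1.frame (hf 0 (by omega) (by omega)) (hf 1 (by omega) (by omega))
      simp [val_demPos h', h'.inp, h'.n, hx])
  have : attach.run m = (Cmd.loop 6 1 (.set 15 (nE + var 6) (.read 0 (demPos (var 6))))).run m1 := rfl
  rw [this, e2, e1, Params.att, h1.d, h.n]
  by_cases c : j < p.n
  · rw [if_neg (by omega), if_pos (by omega), if_pos c]; rfl
  · rw [if_pos (by omega), if_neg c]

/-- The set of marked vertices. -/
def tset (n : ℕ) (f : ℕ → ℕ) : Finset ℕ := (Finset.range n).filter fun v => f v ≠ 0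

theorem mem_tset {n v : ℕ} {f : ℕ → ℕ} : v ∈ tset n f ↔ v < n ∧ f v ≠ 0 := by simp [tset]

theorem tset_congr {n : ℕ} {f g : ℕ → ℕ} (h : ∀ v < n, f v = g v) : tset n f = tset n g := by
  ext v; simp only [mem_tset]
  constructor <;> rintro ⟨h1, h2⟩
  · exact ⟨h1, by rwa [← h v h1]⟩
  · exact ⟨h1, by rwa [h v h1]⟩

theorem procTerminals_spec {m : Mem} (h : p.Holds m) :
    ∀ j < p.n + p.d, procTerminals.run m aRV j = p.rvP (m aPOS 0) (tset p.n (m aT)) j := by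
  intro j hj
  have key := run_loop_inv (x := xA) (p := 0) (m := m)
    (c := .ite (.read aT (var xA)) (.set aRV (var xA) (scaled (procPos (var xA))))
      (.set aRV (var xA) 0))
    (fun i m' => ∀ j < i, m' aRV j = p.rvP (m aPOS 0) (tset p.n (m aT)) j)
    (fun i m' v h => by rw [Mem.set_ne _ _ _ (by omega)]; exact h) (by simp) (by
      intro i m' hi hx hf h2
      rw [h.n] at hi
      have h' : p.Holds m' := h.frame (hf 0 (by simp [writes])) (hf 1 (by simp [writes]))
      have f16 : m' 16 = m 16 := hf 16 (by simp [writes])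
      have f17 : m' 17 = m 17 := hf 17 (by simp [writes])
      have hv : (Expr.read aT (var xA)).val m' = m 16 i := by simp [hx, f16]
      intro j hj
      by_cases c : m 16 i = 0
      · rw [run_ite_neg (by rw [hv, c])]
        simp only [run_set, val_read, val_const, val_zero, Mem.set_apply, hx, true_and]
        by_cases e : j = i
        · subst e; simp [Params.rvP, mem_tset, c]
        · rw [if_neg e, h2 j (by omega)]
      · rw [run_ite_pos (by rw [hv]; exact c)]
        simp only [run_set, val_read, val_const, Mem.set_apply, hx, true_and,
          val_scaled h', val_procPos h', f17]
        by_cases e : j = i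
        · subst e; simp [Params.rvP, mem_tset, c, hi]
        · rw [if_neg e, h2 j (by omega)])
  rw [h.n] at key
  set m1 := (Cmd.loop xA 0 (.ite (.read aT (var xA)) (.set aRV (var xA) (scaled (procPos (var xA))))
      (.set aRV (var xA) 0))).run m
  have h1 : p.Holds m1 := h.frame (run_frame _ (by simp [writes]) m) (run_frame _ (by simp [writes]) m)
  have e2 := run_fill (x := 6) (q := 1) (a := 14) (i := nE + var 6) (e := 0)
    (m := m1) (by omega) (o := p.n) (fun j => 0) (fun j m' _ hx hf => by
      have h' : p.Holds m' := h1.frame (hf 0 (by omega) (by omega)) (hf 1 (by omega) (by omega))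
      simp [h'.n, hx])
  have : procTerminals.run m = (Cmd.loop 6 1 (.set 14 (nE + var 6) 0)).run m1 := rfl
  rw [this, e2, h1.d]
  by_cases c : j < p.n
  · rw [if_neg (by omega), key j c]
  · rw [if_pos (by omega), Params.rvP, if_neg (by simp [mem_tset, c])]

theorem demTerminals_spec {m : Mem} (h : p.Holds m) :
    ∀ j < p.n + p.d, demTerminals.run m aRV j = p.rvD (m aPOS 0) j := by
  intro j hj
  have e1 := run_fill (x := 6) (q := 0) (a := 14) (i := var 6) (e := 0) (m := m) (by omega)
    (o := 0) (fun _ => 0) (fun j m' _ hx _ => by simp [hx])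
  set m1 := (Cmd.loop 6 0 (.set 14 (var 6) 0)).run m with hm1
  have f1 : ∀ a, a ≠ 6 → a ≠ 14 → m1 a = m a := fun a h6 h15 =>
    run_frame _ (by simp [writes]; omega) m
  have h1 : p.Holds m1 := h.frame (f1 0 (by omega) (by omega)) (f1 1 (by omega) (by omega))
  have e2 := run_fill (x := 6) (q := 1) (a := 14) (i := nE + var 6) (e := scaled (demPos (var 6) + 1))
    (m := m1) (by omega) (o := p.n) (fun j => p.scaled (m aPOS 0) (p.demPos j + 1)) (fun j m' _ hx hf => by
      have h' : p.Holds m' := h1.frame (hf 0 (by omega) (by omega)) (hf 1 (by omega) (by omega))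
      have f17 : m' 17 = m 17 := by rw [hf 17 (by omega) (by omega), f1 17 (by omega) (by omega)]
      simp [val_demPos h', val_scaled h', h'.n, hx, f17])
  have : demTerminals.run m = (Cmd.loop 6 1 (.set 14 (nE + var 6) (scaled (demPos (var 6) + 1)))).run m1 := rfl
  rw [this, e2, e1, h1.d, h.n, Params.rvD]
  by_cases c : j < p.n
  · rw [if_neg (by omega), if_pos (by omega), if_pos c]
  · rw [if_pos (by omega), if_neg c]

/-- The entry of the network matrix. -/
theorem build_spec {m : Mem} (h : p.Ready m) {rv : ℕ → ℕ} (hrv : ∀ j < p.n + p.d, m aRV j = rv j) :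
    ∀ u < p.N, ∀ v < p.N, mat p.N (build.run m aCAP) u v = p.capF (m aPOS 0) rv u v ∧
      mat p.N (build.run m aRES) u v = p.capF (m aPOS 0) rv u v := by
  have hz : p.N - 1 = p.n + (p.n + p.d) := by simp [Params.N]
  set body : Cmd := .ite (nE - var xA)
      (.ite (nE - var xB) (.set aCAP (ix (var xA) (var xB)) (scaled (capPos (var xA) (var xB))))
        (.ite ((NE - 1 - var xB) * (1 - neq (.read aATT (var xB - nE)) (var xA)))
          (.set aCAP (ix (var xA) (var xB)) (.read aRV (var xB - nE)))
          (.set aCAP (ix (var xA) (var xB)) 0)))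
      (.ite ((1 - neq (var xB) (NE - 1)) * (NE - 1 - var xA))
        (.set aCAP (ix (var xA) (var xB)) (.read aRV (var xA - nE)))
        (.set aCAP (ix (var xA) (var xB)) 0)) with hbody
  have hbw : body.writes = [13, 13, 13, 13, 13] := rfl
  -- The nested conditionals compute one entry of the matrix. A product encodes a conjunction, and
  -- `1 - neq` tests for equality.
  have hb : ∀ m' : Mem, p.Ready m' → (∀ j < p.n + p.d, m' aRV j = rv j) → m' aPOS 0 = m aPOS 0 →
      m' 7 0 < p.N → m' 6 0 < p.N →
      body.run m' = m'.set 13 (m' 6 0 * p.N + m' 7 0) (p.capF (m aPOS 0) rv (m' 6 0) (m' 7 0)) := by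
    intro m' hr hrv' hpos hvN huN
    rw [hbody]
    have hix : (ix (var xA) (var xB)).val m' = m' 6 0 * p.N + m' 7 0 := by simp [hr.N]
    by_cases c1 : m' 6 0 < p.n
    · rw [run_ite_pos (by simp [hr.n]; omega)]
      by_cases c2 : m' 7 0 < p.n
      · rw [run_ite_pos (by simp [hr.n]; omega), run_set, hix]
        congr 1
        simp [val_scaled hr.toHolds, val_capPos hr.toHolds, hpos, Params.capF, c1, c2]
      · rw [run_ite_neg (by simp [hr.n]; omega)]
        have hatt : m' 7 0 < p.N - 1 → m' 15 (m' 7 0 - p.n) = p.att (m' 7 0 - p.n) := fun hlt =>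
          hr.att _ (by omega)
        have hnq := val_neq' m' (.read aATT (var xB - nE)) (var xA)
        simp only [val_read, val_sub, val_const, val_nE, hr.n] at hnq
        by_cases c3 : m' 7 0 < p.N - 1 ∧ p.att (m' 7 0 - p.n) = m' 6 0
        · rw [run_ite_pos, run_set, hix]
          · congr 1
            simp only [val_read, val_sub, val_const, val_nE, hr.n, Params.capF, c1, c2, c3,
              if_true, if_false, and_self]
            exact hrv' _ (by omega)
          · simp only [val_mul, val_sub, val_NE, val_one, hr.N, val_read, val_const]
            rw [hnq.2 (by rw [hatt c3.1]; exact c3.2)]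
            have := c3.1
            simp only [Nat.sub_zero, mul_one]
            omega
        · rw [run_ite_neg, run_set, hix]
          · congr 1
            simp [Params.capF, c1, c2, c3]
          · simp only [val_mul, val_sub, val_NE, val_one, hr.N, val_read, val_const]
            by_cases c4 : m' 7 0 < p.N - 1
            · have : (neq (.read aATT (var xB - nE)) (var xA)).val m' ≠ 0 := fun h0 => by
                have := hnq.1 h0
                rw [hatt c4] at this
                exact c3 ⟨c4, this⟩
              rw [show 1 - (neq (.read aATT (var xB - nE)) (var xA)).val m' = 0 by omega, mul_zero]
            · rw [show p.N - 1 - m' 7 0 = 0 by omega, zero_mul]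
    · rw [run_ite_neg (by simp [hr.n]; omega)]
      have hnq := val_neq' m' (var xB) (NE - 1)
      simp only [val_read, val_sub, val_const, val_NE, val_one, hr.N] at hnq
      by_cases c3 : m' 7 0 = p.N - 1 ∧ m' 6 0 < p.N - 1
      · rw [run_ite_pos, run_set, hix]
        · congr 1
          simp only [val_read, val_sub, val_const, val_nE, hr.n, Params.capF, c1, c3, if_true,
            if_false, and_self]
          exact hrv' _ (by omega)
        · simp only [val_mul, val_sub, val_NE, val_one, hr.N, val_read, val_const]
          rw [hnq.2 c3.1]
          have := c3.2
          simp only [Nat.sub_zero, one_mul]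
          omega
      · rw [run_ite_neg, run_set, hix]
        · congr 1
          simp [Params.capF, c1, c3]
        · simp only [val_mul, val_sub, val_NE, val_one, hr.N, val_read, val_const]
          by_cases c4 : m' 7 0 = p.N - 1
          · rw [show p.N - 1 - m' 6 0 = 0 by omega, mul_zero]
          · have : (neq (var xB) (NE - 1)).val m' ≠ 0 := fun h0 => c4 (hnq.1 h0)
            rw [show 1 - (neq (var xB) (NE - 1)).val m' = 0 by omega, zero_mul]
  set F := p.capF (m aPOS 0) rv
  have key := run_loop_inv (x := xA) (p := 2) (m := m)
    (c := .loop xB 2 (body ;;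
      .set aRES (ix (var xA) (var xB)) (.read aCAP (ix (var xA) (var xB)))))
    (fun i m' => ∀ u < i, ∀ v < p.N, mat p.N (m' aCAP) u v = F u v ∧ mat p.N (m' aRES) u v = F u v)
    (fun i m' v h => by
      rw [Mem.set_ne _ _ _ (by omega), Mem.set_ne _ _ _ (by omega)]; exact h) (by simp) (by
      intro i m1 hi hx hf h1
      rw [h.N] at hi
      have g1 : ∀ a, a = 0 ∨ a = 1 ∨ a = 14 ∨ a = 15 ∨ a = 17 → m1 a = m a := fun a ha =>
        hf a (by simp [writes, hbw]; omega)
      have inner := run_loop_inv (x := xB) (p := 2) (m := m1)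
        (c := body ;; .set aRES (ix (var xA) (var xB)) (.read aCAP (ix (var xA) (var xB))))
        (fun j m' => (∀ u < i, ∀ v < p.N, mat p.N (m' aCAP) u v = F u v ∧ mat p.N (m' aRES) u v = F u v) ∧
          ∀ v < j, mat p.N (m' aCAP) i v = F i v ∧ mat p.N (m' aRES) i v = F i v)
        (fun i m' v h => by
          rw [Mem.set_ne _ _ _ (by omega), Mem.set_ne _ _ _ (by omega)]; exact h) ⟨h1, by simp⟩ (by
          intro j m2 hj hxj hf2 ⟨h2, h3⟩
          have g : ∀ a, a = 0 ∨ a = 1 ∨ a = 14 ∨ a = 15 ∨ a = 17 → m2 a = m a := fun a ha => by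
            rw [hf2 a (by simp [writes, hbw]; omega), g1 a ha]
          have hx2 : m2 6 0 = i := by rw [hf2 6 (by simp [writes, hbw]), hx]
          have hjN : j < p.N := by rw [g1 1 (by omega), h.N] at hj; exact hj
          have hr2 : p.Ready m2 := h.frame (g 0 (by omega)) (g 1 (by omega)) (g 15 (by omega))
          rw [run_seq, hb m2 hr2 (by rw [g 14 (by omega)]; exact hrv) (by rw [g 17 (by omega)])
            (by omega) (by omega), hx2, hxj]
          set m3 := m2.set 13 (i * p.N + j) (F i j) with hm3
          have k6 : m3 6 0 = i := by rw [hm3, Mem.set_ne _ _ _ (by omega), hx2]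
          have k7 : m3 7 0 = j := by rw [hm3, Mem.set_ne _ _ _ (by omega), hxj]
          have k1 : m3 1 2 = p.N := by rw [hm3, Mem.set_ne _ _ _ (by omega), hr2.N]
          have k13 : m3 13 (i * p.N + j) = F i j := by rw [hm3]; simp [Mem.set_apply]
          have k9 : m3 9 = m2 9 := Mem.set_ne _ _ _ (by omega)
          simp only [run_set, val_ix, val_read, val_const, k6, k7, k1, k13]
          have kk : ∀ u v, v < p.N → mat p.N ((m3.set 9 (i * p.N + j) (F i j)) 13) u v =
              if u = i ∧ v = j then F i j else mat p.N (m2 13) u v := fun u v hv => by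
            rw [Mem.set_ne _ _ _ (by omega), hm3, mat_set hjN hv]
          have kk' : ∀ u v, v < p.N → mat p.N ((m3.set 9 (i * p.N + j) (F i j)) 9) u v =
              if u = i ∧ v = j then F i j else mat p.N (m2 9) u v := fun u v hv => by
            rw [mat_set hjN hv, k9]
          refine ⟨fun u hu v hv => ?_, fun v hv => ?_⟩
          · rw [kk u v hv, kk' u v hv, if_neg (by omega), if_neg (by omega)]
            exact h2 u hu v hv
          · rw [kk i v (by omega), kk' i v (by omega)]
            by_cases e : v = j
            · subst e; simp
            · rw [if_neg (by omega), if_neg (by omega)]; exact h3 v (by omega))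
      rw [g1 1 (by omega), h.N] at inner
      intro u hu v hv
      rcases Nat.lt_succ_iff_lt_or_eq.mp hu with hu | rfl
      · exact inner.1 u hu v hv
      · exact inner.2 v hv)
  rw [h.N] at key
  exact key

theorem IsRes.congr_cap {N s val : ℕ} {c c' r : ℕ → ℕ → ℕ} (h : IsRes N s c r val)
    (hr : ∀ u < N, ∀ v < N, c' u v = c u v) : IsRes N s c' r val :=
  ⟨fun u hu v hv => by rw [hr u hu v hv, hr v hv u hu]; exact h.anti u hu v hv, fun u hu => by
    rw [← h.net u hu]
    exact Finset.sum_congr rfl fun v hv => by rw [hr u hu v (by simpa using hv)]⟩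

theorem cutCap_congr {N s : ℕ} {c c' : ℕ → ℕ → ℕ} {S : Finset ℕ} (hS : IsCut N s S)
    (hr : ∀ u < N, ∀ v < N, c' u v = c u v) : cutCap N c' S = cutCap N c S :=
  Finset.sum_congr rfl fun u hu => Finset.sum_congr rfl fun v hv =>
    hr u (by simpa using hS.subset hu) v (by simp at hv; exact hv.1)

theorem IsFlowVal.congr {N s K val : ℕ} {c c' : ℕ → ℕ → ℕ} (h : IsFlowVal N s K c val)
    (hr : ∀ u < N, ∀ v < N, c' u v = c u v) : IsFlowVal N s K c' val :=
  ⟨h.le, fun S hS => by rw [cutCap_congr hS hr]; exact h.le_cut S hS, h.eq.imp_right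
    fun ⟨S, hS, e⟩ => ⟨S, hS, by rw [cutCap_congr hS hr, e]⟩⟩

theorem buildFlow_spec {m : Mem} (h : p.Ready m) {rv : ℕ → ℕ}
    (hrv : ∀ j < p.n + p.d, m aRV j = rv j) :
    let m' := (build ;; maxflow).run m
    m' aCNT 0 = min p.K (p.mcut (m aPOS 0) rv) ∧
      (∀ u < p.N, ∀ v < p.N, mat p.N (m' aCAP) u v = p.capF (m aPOS 0) rv u v) ∧
      IsRes p.N p.s (p.capF (m aPOS 0) rv) (mat p.N (m' aRES)) (m' aCNT 0) := by
  intro m'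
  have hb := build_spec h hrv
  set m1 := build.run m with hm1
  have f : ∀ a, a ≠ 6 → a ≠ 7 → a ≠ 9 → a ≠ 13 → m1 a = m a := fun a _ _ _ _ =>
    run_frame _ (by simp [build, writes]; omega) m
  have f1 := f 1 (by omega) (by omega) (by omega) (by omega)
  have hm' : m' = maxflow.run m1 := rfl
  have hmf := maxflow_spec (m := m1) (N := p.N) (s := p.s) (K := p.K) (by rw [f1, h.N])
    (by rw [f1, h.K]) (by rw [f1, h.s]) p.s_lt_N (fun u hu v hv => by
      rw [(hb u hu v hv).1, (hb u hu v hv).2])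
  rw [← hm'] at hmf
  obtain ⟨h1, h2⟩ := hmf
  have hc : ∀ u < p.N, ∀ v < p.N, p.capF (m aPOS 0) rv u v = mat p.N (m1 aCAP) u v :=
    fun u hu v hv => ((hb u hu v hv).1).symm
  refine ⟨Params.flowVal_eq (h1.congr hc), fun u hu v hv => ?_, h2.congr_cap hc⟩
  rw [hm', run_frame _ (by simp [maxflow_writes]), hc u hu v hv]

theorem procFlow_spec {m : Mem} (h : p.Ready m) :
    let m' := procFlow.run m
    m' aCNT 0 = p.flowP (m aPOS 0) (tset p.n (m aT)) ∧
      (∀ u < p.N, ∀ v < p.N, mat p.N (m' aCAP) u v =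
        p.capF (m aPOS 0) (p.rvP (m aPOS 0) (tset p.n (m aT))) u v) ∧
      IsRes p.N p.s (p.capF (m aPOS 0) (p.rvP (m aPOS 0) (tset p.n (m aT))))
        (mat p.N (m' aRES)) (m' aCNT 0) := by
  have f : ∀ a, a ≠ 6 → a ≠ 14 → procTerminals.run m a = m a := fun a _ _ =>
    run_frame _ (by simp [procTerminals, writes]; omega) m
  have := buildFlow_spec (m := procTerminals.run m) (h.frame (f 0 (by omega) (by omega))
    (f 1 (by omega) (by omega)) (f 15 (by omega) (by omega))) (procTerminals_spec h.toHolds)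
  rw [f 17 (by omega) (by omega)] at this
  exact this

theorem demFlow_spec {m : Mem} (h : p.Ready m) :
    let m' := demFlow.run m
    m' aCNT 0 = p.flowD (m aPOS 0) ∧
      (∀ u < p.N, ∀ v < p.N, mat p.N (m' aCAP) u v =
        p.capF (m aPOS 0) (p.rvD (m aPOS 0)) u v) ∧
      IsRes p.N p.s (p.capF (m aPOS 0) (p.rvD (m aPOS 0))) (mat p.N (m' aRES)) (m' aCNT 0) := by
  have f : ∀ a, a ≠ 6 → a ≠ 14 → demTerminals.run m a = m a := fun a _ _ =>
    run_frame _ (by simp [demTerminals, writes]; omega) m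
  have := buildFlow_spec (m := demTerminals.run m) (h.frame (f 0 (by omega) (by omega))
    (f 1 (by omega) (by omega)) (f 15 (by omega) (by omega))) (demTerminals_spec h.toHolds)
  rw [f 17 (by omega) (by omega)] at this
  exact this

theorem flow_writes : procFlow.writes = [6, 14, 14, 6, 14, 6, 7, 13, 13, 13, 13, 13, 9, 12, 8, 6, 2,
      3, 2, 5, 6, 7, 3, 4, 5, 2, 11, 10, 11, 6, 10, 11, 12, 6, 9, 9] ∧
    demFlow.writes = [6, 14, 6, 14, 6, 7, 13, 13, 13, 13, 13, 9, 12, 8, 6, 2,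
      3, 2, 5, 6, 7, 3, 4, 5, 2, 11, 10, 11, 6, 10, 11, 12, 6, 9, 9] := ⟨rfl, rfl⟩

theorem flow_frame {a : ℕ} (ha : a = 0 ∨ a = 1 ∨ 15 ≤ a) (m : Mem) :
    procFlow.run m a = m a ∧ demFlow.run m a = m a :=
  ⟨run_frame _ (by rw [flow_writes.1]; simp; omega) m,
    run_frame _ (by rw [flow_writes.2]; simp; omega) m⟩

end Middlebox

namespace Middlebox

open Middlebox.Expr Middlebox.Cmd

/-! ## The greedy choice of purchases -/

namespace Params

variable (p : Params)

/-- The price of `v` is at most the budget. -/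
def Aff (v : ℕ) : Prop := p.inp (p.pricePos v) ≤ p.inp 2 * p.inp (p.pricePos v + 1)

/-- The price in units of the `2 n`-th part of the budget, rounded up. -/
def price (v : ℕ) : ℕ :=
  (p.inp (p.pricePos v) * (2 * p.n) + p.inp (p.pricePos v + 1) * p.inp 2 - 1)
    / (p.inp (p.pricePos v + 1) * p.inp 2)

-- The gain must be at least `w / (4n)` per unit of price. Spending `2n` at this rate is worth `w /
-- 2`, while vertices of total price `3n` below this rate can add at most `3w / 4`.
open Classical in
noncomputable def step (x w : ℕ) (T : Finset ℕ) (v : ℕ) : Finset ℕ :=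
  if p.Aff v ∧ v ∉ T ∧ w * p.price v ≤ 4 * p.n * (p.flowP x (insert v T) - p.flowP x T) ∧
    ∑ u ∈ insert v T, p.price u ≤ 2 * p.n then insert v T else T

noncomputable def pick (x w : ℕ) (T : Finset ℕ) : ℕ → Finset ℕ
  | 0 => T
  | i + 1 => p.step x w (pick x w T i) i

open Classical in
noncomputable def start (j : ℕ) : Finset ℕ := if j < p.n ∧ p.Aff j then {j} else ∅

noncomputable def greedyT (x w j : ℕ) : Finset ℕ := p.pick x w (p.start j) p.n

/-- Affordable sets of purchases, in terms of rounded prices. -/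
structure Valid (T : Finset ℕ) : Prop where
  subset : T ⊆ Finset.range p.n
  aff : ∀ v ∈ T, p.Aff v
  sum_le : ∑ v ∈ T, p.price v ≤ 2 * p.n

variable {p}

theorem price_le {v : ℕ} (h : p.Aff v) : p.price v ≤ 2 * p.n := by
  unfold price Aff at *
  set a := p.inp (p.pricePos v)
  set b := p.inp (p.pricePos v + 1)
  set k := p.inp 2
  rcases Nat.eq_zero_or_pos (b * k) with h0 | h0
  · rw [h0]; simp
  · rw [← Nat.lt_succ_iff, Nat.div_lt_iff_lt_mul h0]
    have : a * (2 * p.n) ≤ k * b * (2 * p.n) := Nat.mul_le_mul_right _ h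
    have e : (2 * p.n + 1) * (b * k) = k * b * (2 * p.n) + b * k := by ring
    rw [Nat.succ_eq_add_one, e]
    omega

theorem subset_step (x w : ℕ) (T : Finset ℕ) (v : ℕ) : T ⊆ p.step x w T v := by
  unfold step
  split_ifs
  · exact Finset.subset_insert _ _
  · exact le_rfl

theorem Valid.step {x w v : ℕ} {T : Finset ℕ} (h : p.Valid T) (hv : v < p.n) :
    p.Valid (p.step x w T v) := by
  unfold Params.step
  split_ifs with c
  · refine ⟨Finset.insert_subset (by simpa using hv) h.subset, ?_, c.2.2.2⟩
    intro u hu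
    rcases Finset.mem_insert.mp hu with rfl | hu
    · exact c.1
    · exact h.aff u hu
  · exact h

theorem pick_mono {x w : ℕ} {T : Finset ℕ} {i j : ℕ} (h : i ≤ j) : p.pick x w T i ⊆ p.pick x w T j := by
  induction j, h using Nat.le_induction with
  | base => exact le_rfl
  | succ j _ ih => exact ih.trans (subset_step _ _ _ _)

theorem Valid.pick {x w : ℕ} {T : Finset ℕ} (h : p.Valid T) {i : ℕ} (hi : i ≤ p.n) :
    p.Valid (p.pick x w T i) := by
  induction i with
  | zero => exact h
  | succ i ih => exact (ih (by omega)).step hi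

theorem valid_empty : p.Valid ∅ := ⟨by simp, by simp, by simp⟩

theorem valid_start (j : ℕ) : p.Valid (p.start j) := by
  unfold start
  split_ifs with c
  · exact ⟨by simpa using c.1, by simpa using c.2, by simpa using price_le c.2⟩
  · exact valid_empty

theorem valid_greedyT (x w j : ℕ) : p.Valid (p.greedyT x w j) := (valid_start j).pick le_rfl

theorem start_subset_greedyT (x w j : ℕ) : p.start j ⊆ p.greedyT x w j := pick_mono (Nat.zero_le _)

theorem step_density {x w v : ℕ} {T : Finset ℕ} (h : w * ∑ u ∈ T, p.price u ≤ 4 * p.n * p.flowP x T)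
    (hv : v ∉ T) (hd : w * p.price v ≤ 4 * p.n * (p.flowP x (insert v T) - p.flowP x T)) :
    w * ∑ u ∈ insert v T, p.price u ≤ 4 * p.n * p.flowP x (insert v T) := by
  have hm : p.flowP x T ≤ p.flowP x (insert v T) := flowP_mono (Finset.subset_insert _ _)
  obtain ⟨e, he⟩ := Nat.exists_eq_add_of_le hm
  rw [he] at hd ⊢
  rw [Nat.add_sub_cancel_left] at hd
  rw [Finset.sum_insert hv, mul_add, mul_add]
  omega

theorem pick_density {x w : ℕ} (i : ℕ) :
    w * ∑ u ∈ p.pick x w ∅ i, p.price u ≤ 4 * p.n * p.flowP x (p.pick x w ∅ i) := by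
  induction i with
  | zero => simp [pick]
  | succ i ih =>
    rw [pick, step]
    split_ifs with c
    · exact step_density ih c.2.1 c.2.2.1
    · exact ih

/-- One of the greedy runs yields a constant fraction of the target `w`. -/
theorem exists_greedyT {x w : ℕ} {O : Finset ℕ} (hO : O ⊆ Finset.range p.n)
    (haff : ∀ v ∈ O, p.Aff v) (hsum : ∑ v ∈ O, p.price v ≤ 3 * p.n) (hw : w ≤ p.flowP x O) :
    ∃ j < p.N, w ≤ 4 * p.flowP x (p.greedyT x w j) := by
  have hn : 0 < p.n := by have := p.s_lt; omega
  set F := p.greedyT x w p.n with hF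
  have hst : p.start p.n = ∅ := by simp [start]
  have hFp : F = p.pick x w ∅ p.n := by rw [hF, greedyT, hst]
  -- If some prefix of the pass with one further affordable vertex carries `w / 2`, then by
  -- submodularity the prefix or the vertex alone carries `w / 4`. The former lies in `F`, the
  -- latter in the run seeded with it.
  by_cases hbud : ∃ v, v < p.n ∧ p.Aff v ∧ w ≤ 2 * p.flowP x (insert v (p.pick x w ∅ v))
  · obtain ⟨v, hv, hva, hvw⟩ := hbud
    have h1 := flowP_submod (p := p) (x := x) (v := v) (Finset.empty_subset (p.pick x w ∅ v))
    have h2 : p.flowP x (p.pick x w ∅ v) ≤ p.flowP x F := by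
      rw [hFp]; exact flowP_mono (pick_mono hv.le)
    have h3 : p.flowP x {v} ≤ p.flowP x (p.greedyT x w v) := by
      have := start_subset_greedyT (p := p) x w v
      rw [start, if_pos ⟨hv, hva⟩] at this
      exact flowP_mono this
    rw [insert_empty_eq] at h1
    by_cases c : w ≤ 4 * p.flowP x F
    · exact ⟨p.n, by unfold N; omega, c⟩
    · exact ⟨v, by unfold N; omega, by omega⟩
  · push Not at hbud
    refine ⟨p.n, by unfold N; omega, ?_⟩
    rw [← hF]
    -- Otherwise no dense vertex of `O` outside `F` can have been refused for lack of budget: prefix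
    -- and vertex would then cost more than `2n` at rate `w / (4n)`, hence carry `w / 2`. So it was
    -- refused for its small gain.
    have hmarg : ∀ o ∈ O, o ∈ F ∨ 4 * p.n * (p.flowP x (insert o (p.pick x w ∅ o)) -
        p.flowP x (p.pick x w ∅ o)) ≤ w * p.price o := by
      intro o ho
      have hon : o < p.n := by simpa using hO ho
      by_contra! hc
      obtain ⟨h1, h2⟩ := hc
      have hsub : p.pick x w ∅ (o + 1) ⊆ F := by rw [hFp]; exact pick_mono hon
      have hoT : o ∉ p.pick x w ∅ o := fun h => h1 (hsub (pick_mono (Nat.le_succ o) h))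
      have hns : o ∉ p.pick x w ∅ (o + 1) := fun h => h1 (hsub h)
      rw [pick, step] at hns
      split_ifs at hns with c
      · exact hns (Finset.mem_insert_self _ _)
      have hbig : 2 * p.n < ∑ u ∈ insert o (p.pick x w ∅ o), p.price u := by
        by_contra hle
        exact c ⟨haff o ho, hoT, h2.le, by omega⟩
      have hd := step_density (pick_density o) hoT h2.le
      have := hbud o hon (haff o ho)
      have h3 : w * (2 * p.n) ≤ 4 * p.n * p.flowP x (insert o (p.pick x w ∅ o)) :=
        (Nat.mul_le_mul_left _ hbig.le).trans hd
      have h4 : (2 * p.n) * w ≤ (2 * p.n) * (2 * p.flowP x (insert o (p.pick x w ∅ o))) := by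
        calc _ = w * (2 * p.n) := by ring
          _ ≤ _ := h3
          _ = _ := by ring
      have := Nat.le_of_mul_le_mul_left h4 (by omega)
      omega
    -- The vertices of `O` are added to `F` one at a time. By submodularity each gains no more than
    -- it did when the pass looked at it.
    have key : ∀ Q : Finset ℕ, Q ⊆ O →
        4 * p.n * p.flowP x (F ∪ Q) ≤ 4 * p.n * p.flowP x F + w * ∑ o ∈ Q, p.price o := by
      intro Q
      induction Q using Finset.induction_on with
      | empty => intro _; simp
      | insert o Q ho ih =>
        intro hQ
        have ih := ih ((Finset.subset_insert _ _).trans hQ)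
        have hoO := hQ (Finset.mem_insert_self _ _)
        rw [Finset.sum_insert ho, Finset.union_insert, mul_add]
        rcases hmarg o hoO with h | h
        · rw [Finset.insert_eq_of_mem (Finset.mem_union_left _ h)]; omega
        · have hsub : p.pick x w ∅ o ⊆ F ∪ Q := by
            refine Finset.Subset.trans ?_ Finset.subset_union_left
            rw [hFp]; exact pick_mono (by have := hO hoO; simp at this; omega)
          have h1 := flowP_submod (p := p) (x := x) (v := o) hsub
          have h2 : p.flowP x (insert o (F ∪ Q)) ≤ p.flowP x (F ∪ Q) +
              (p.flowP x (insert o (p.pick x w ∅ o)) - p.flowP x (p.pick x w ∅ o)) := by omega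
          have h3 := Nat.mul_le_mul_left (4 * p.n) h2
          rw [mul_add] at h3
          omega
    have h1 := key O le_rfl
    have h2 : p.flowP x O ≤ p.flowP x (F ∪ O) := flowP_mono Finset.subset_union_right
    have h3 : 4 * p.n * w ≤ 4 * p.n * p.flowP x F + w * (3 * p.n) :=
      (Nat.mul_le_mul_left _ (hw.trans h2)).trans (h1.trans
        (Nat.add_le_add_left (Nat.mul_le_mul_left _ hsum) _))
    -- The missed part is at most `3n * w` out of `4n * w`, which leaves a quarter.
    have h4 : p.n * w ≤ p.n * (4 * p.flowP x F) := by nlinarith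
    exact Nat.le_of_mul_le_mul_left h4 hn

-- Correctness of the greedy program and of the search

end Params

variable {p : Params}

theorem val_affordable {m : Mem} (h : p.Holds m) (v : Expr) :
    (affordable v).val m ≠ 0 ↔ p.Aff (v.val m) := by
  simp only [affordable, val_sub, val_add, val_mul, val_read, val_two, val_one, val_pricePos h, h.inp,
    Params.Aff]
  omega

theorem val_price {m : Mem} (h : p.Holds m) (v : Expr) : (Expr.price v).val m = p.price (v.val m) := by
  simp [Expr.price, Params.price, val_pricePos h, h.inp, h.n]

theorem tset_update {n v : ℕ} {f : ℕ → ℕ} (hv : v < n) :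
    tset n (Function.update f v 1) = insert v (tset n f) := by
  ext u
  by_cases e : u = v
  · subst e; simp [mem_tset, hv]
  · simp [mem_tset, e]

theorem tset_update_zero {n v : ℕ} {f : ℕ → ℕ} (h0 : f v = 0) :
    tset n (Function.update f v 0) = tset n f := by
  rw [← h0, Function.update_eq_self]

theorem sum_tset {n : ℕ} (f g : ℕ → ℕ) :
    ∑ v ∈ tset n f, g v = ∑ v ∈ Finset.range n, if f v ≠ 0 then g v else 0 :=
  Finset.sum_filter _ _

theorem consider_writes : ∀ a ∈ consider.writes, a ≤ 14 ∧ 2 ≤ a ∨ a = 16 ∨ a = 18 ∨ a = 20 := by decide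

theorem consider_spec {m : Mem} (h : p.Ready m) (hv : m xV 0 < p.n) :
    tset p.n (consider.run m aT) =
      p.step (m aPOS 0) (m xW 0) (tset p.n (m aT)) (m xV 0) := by
  set T := tset p.n (m aT) with hT
  set v := m xV 0 with hvd
  set x := m aPOS 0 with hx
  have haf := val_affordable h.toHolds (var xV)
  simp only [val_read, val_const] at haf
  rw [← hvd] at haf
  by_cases c1 : p.Aff v
  swap
  · rw [consider, run_ite_neg (by by_contra hne; exact c1 (haf.1 hne)), run_skip, Params.step,
      if_neg (fun hc => c1 hc.1)]
  rw [consider, run_ite_pos (haf.2 c1)]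
  by_cases c2 : m aT v = 0
  swap
  · rw [run_ite_pos (by simpa [← hvd] using c2), run_skip, Params.step,
      if_neg (fun hc => hc.2.1 (mem_tset.2 ⟨hv, c2⟩))]
  have hvT : v ∉ T := fun hc => (mem_tset.1 hc).2 c2
  rw [run_ite_neg (by simpa [← hvd] using c2)]
  simp only [run_seq]
  set m1 := procFlow.run m with hm1
  have s1 := (procFlow_spec h).1
  rw [← hm1, ← hx, ← hT] at s1
  have f1 : ∀ a, a = 0 ∨ a = 1 ∨ 15 ≤ a → m1 a = m a := fun a ha => (flow_frame ha m).1
  set m2 := (Cmd.set aC0 0 (var aCNT)).run m1 with hm2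
  have f2 : ∀ a, a ≠ 18 → m2 a = m1 a := fun a ha => Mem.set_ne _ _ _ ha
  have c0 : m2 18 0 = p.flowP x T := by simp [hm2, Mem.set_apply, s1]
  set m3 := (Cmd.set aT (var xV) 1).run m2 with hm3
  have f3 : ∀ a, a ≠ 16 → m3 a = m2 a := fun a ha => Mem.set_ne _ _ _ ha
  have t3 : m3 16 = Function.update (m 16) v 1 := by
    rw [hm3, run_set, Mem.set_self, f2 16 (by omega), f1 16 (by omega)]
    simp [f2 24, f1 24, ← hvd]
  have r3 : p.Ready m3 := h.frame
    (by rw [f3 0 (by omega), f2 0 (by omega), f1 0 (by omega)])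
    (by rw [f3 1 (by omega), f2 1 (by omega), f1 1 (by omega)])
    (by rw [f3 15 (by omega), f2 15 (by omega), f1 15 (by omega)])
  have s4 := (procFlow_spec r3).1
  set m4 := procFlow.run m3 with hm4
  have f4 : ∀ a, a = 0 ∨ a = 1 ∨ 15 ≤ a → m4 a = m3 a := fun a ha => (flow_frame ha m3).1
  rw [f3 17 (by omega), f2 17 (by omega), f1 17 (by omega), t3, tset_update hv, ← hx, ← hT] at s4
  set m5 := (Cmd.set aSUM 0 0).run m4 with hm5
  have f5 : ∀ a, a ≠ 20 → m5 a = m4 a := fun a ha => Mem.set_ne _ _ _ ha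
  have r5 : p.Ready m5 := r3.frame
    (by rw [f5 0 (by omega), f4 0 (by omega)]) (by rw [f5 1 (by omega), f4 1 (by omega)])
    (by rw [f5 15 (by omega), f4 15 (by omega)])
  have t5 : m5 16 = m3 16 := by rw [f5 16 (by omega), f4 16 (by omega)]
  have key := run_loop_inv (x := xA) (p := 0) (m := m5)
    (c := .ite (.read aT (var xA)) (.set aSUM 0 (var aSUM + Expr.price (var xA))) .skip)
    (fun i m' => m' aSUM 0 = ∑ u ∈ Finset.range i, if m3 16 u ≠ 0 then p.price u else 0)
    (fun i m' v h => by rw [Mem.set_ne _ _ _ (by omega)]; exact h)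
    (by simp [hm5, Mem.set_apply]) (by
      intro i m' hi hx' hf hs
      have r' : p.Ready m' := r5.frame (hf 0 (by simp [writes])) (hf 1 (by simp [writes]))
        (hf 15 (by simp [writes]))
      have t' : m' 16 = m3 16 := by rw [hf 16 (by simp [writes]), t5]
      have hv' : (Expr.read aT (var xA)).val m' = m3 16 i := by simp [hx', t']
      rw [Finset.sum_range_succ]
      by_cases c : m3 16 i = 0
      · rw [run_ite_neg (by rw [hv', c]), run_skip, hs]; simp [c]
      · rw [run_ite_pos (by rw [hv']; exact c), run_set]
        simp [Mem.set_apply, val_price r'.toHolds, hx', hs, c])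
  rw [r5.n] at key
  set m6 := (Cmd.loop xA 0
    (.ite (.read aT (var xA)) (.set aSUM 0 (var aSUM + Expr.price (var xA))) .skip)).run m5 with hm6
  have f6 : ∀ a, a ≠ 6 → a ≠ 20 → m6 a = m5 a := fun a _ _ =>
    run_frame _ (by simp [writes]; omega) m5
  have hs6 : m6 20 0 = ∑ u ∈ insert v T, p.price u := by
    rw [key, ← sum_tset, t3, tset_update hv]
  have r6 : p.Ready m6 := r5.frame (f6 0 (by omega) (by omega)) (f6 1 (by omega) (by omega))
    (f6 15 (by omega) (by omega))
  have t6 : m6 16 = Function.update (m 16) v 1 := by rw [f6 16 (by omega) (by omega), t5, t3]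
  have g6 : ∀ a, 21 ≤ a → m6 a = m a := fun a ha => by
    rw [f6 a (by omega) (by omega), f5 a (by omega), f4 a (by omega), f3 a (by omega),
      f2 a (by omega), f1 a (by omega)]
  have v6 : m6 24 0 = v := by rw [g6 24 (by omega)]
  have cn6 : m6 12 0 = p.flowP x (insert v T) := by
    rw [f6 12 (by omega) (by omega), f5 12 (by omega), s4]
  have c06 : m6 18 0 = p.flowP x T := by
    rw [f6 18 (by omega) (by omega), f5 18 (by omega), f4 18 (by omega), f3 18 (by omega), c0]
  have hval : (((var xW * Expr.price (var xV) - 4 * nE * (var aCNT - var aC0)) +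
      (var aSUM - 2 * nE) : Expr)).val m6 =
      (m xW 0 * p.price v - 4 * p.n * (p.flowP x (insert v T) - p.flowP x T)) +
        (∑ u ∈ insert v T, p.price u - 2 * p.n) := by
    simp only [val_add, val_sub, val_mul, val_read, val_const, val_four, val_two, val_nE, r6.n,
      val_price r6.toHolds, v6, cn6, c06, hs6, g6 22 (by omega)]
  by_cases c : m xW 0 * p.price v ≤ 4 * p.n * (p.flowP x (insert v T) - p.flowP x T) ∧
      ∑ u ∈ insert v T, p.price u ≤ 2 * p.n
  · rw [run_ite_neg (by rw [hval]; omega), run_skip, t6, tset_update hv, Params.step,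
      if_pos ⟨c1, hvT, c⟩]
  · rw [run_ite_pos (by rw [hval]; omega), run_set, Mem.set_self, t6, Params.step,
      if_neg (fun hc => c hc.2.2)]
    have : (var xV).val m6 = v := v6
    rw [this, val_zero, Function.update_idem, tset_update_zero c2]

theorem greedy_writes : ∀ a ∈ greedy.writes, a ≤ 14 ∧ 2 ≤ a ∨ a = 16 ∨ a = 18 ∨ a = 20 ∨ a = 24 := by
  decide

theorem greedy_spec {m : Mem} (h : p.Ready m) :
    tset p.n (greedy.run m aT) = p.greedyT (m aPOS 0) (m xW 0) (m xJ 0) := by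
  have e1 := run_fill (x := 6) (q := 0) (a := 16) (i := var 6) (e := 0) (m := m) (by omega)
    (o := 0) (fun _ => 0) (fun j m' _ hx _ => by simp [hx])
  set m1 := (Cmd.loop 6 0 (.set 16 (var 6) 0)).run m with hm1
  have f1 : ∀ a, a ≠ 6 → a ≠ 16 → m1 a = m a := fun a _ _ =>
    run_frame _ (by simp [writes]; omega) m
  have h1 : p.Ready m1 := h.frame (f1 0 (by omega) (by omega)) (f1 1 (by omega) (by omega))
    (f1 15 (by omega) (by omega))
  have t1 : tset p.n (m1 16) = ∅ := by
    ext v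
    simp only [mem_tset, e1, h.n, Finset.notMem_empty, iff_false, not_and]
    intro hv
    rw [if_pos (by omega)]; simp
  set c2 : Cmd := .ite (nE - var xJ) (.ite (affordable (var xJ)) (.set aT (var xJ) 1) .skip) .skip
  set m2 := c2.run m1 with hm2
  have f2 : ∀ a, a ≠ 16 → m2 a = m1 a := fun a _ =>
    run_frame _ (by simp [c2, writes]; omega) m1
  have h2 : p.Ready m2 := h1.frame (f2 0 (by omega)) (f2 1 (by omega)) (f2 15 (by omega))
  have hj : m1 23 0 = m 23 0 := by rw [f1 23 (by omega) (by omega)]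
  have t2 : tset p.n (m2 16) = p.start (m xJ 0) := by
    have haf := val_affordable h1.toHolds (var xJ)
    simp only [val_read, val_const, hj] at haf
    rw [Params.start]
    by_cases a1 : m 23 0 < p.n
    · rw [hm2, run_ite_pos (by simp [h1.n, hj]; omega)]
      by_cases a2 : p.Aff (m 23 0)
      · rw [run_ite_pos (haf.2 a2), if_pos ⟨a1, a2⟩, run_set, Mem.set_self]
        simp only [val_read, val_const, hj, val_one]
        rw [tset_update a1, t1]; rfl
      · rw [run_ite_neg (by by_contra hne; exact a2 (haf.1 hne)), if_neg (fun hc => a2 hc.2),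
          run_skip, t1]
    · rw [hm2, run_ite_neg (by simp [h1.n, hj]; omega), if_neg (fun hc => a1 hc.1), run_skip, t1]
  have key := run_loop_inv (x := xV) (p := 0) (m := m2) (c := consider)
    (fun i m' => tset p.n (m' 16) = p.pick (m aPOS 0) (m xW 0) (p.start (m xJ 0)) i)
    (fun i m' v h => by rw [Mem.set_ne _ _ _ (by omega)]; exact h) t2 (by
      intro i m3 hi hx hf h3
      rw [h2.n] at hi
      have hf' : ∀ a, a ≤ 1 ∨ a = 15 ∨ a = 17 ∨ a = 19 ∨ (21 ≤ a ∧ a ≠ 24) → m3 a = m2 a := fun a ha =>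
        hf a (fun hc => by
          rcases List.mem_cons.mp hc with rfl | hc
          · omega
          · have := consider_writes a hc; omega)
      have r3 : p.Ready m3 := h2.frame (hf' 0 (by omega)) (hf' 1 (by omega)) (hf' 15 (by omega))
      rw [consider_spec r3 (by omega), h3, hx, hf' 17 (by omega), hf' 22 (by omega), f2 17 (by omega),
        f2 22 (by omega), f1 17 (by omega) (by omega), f1 22 (by omega) (by omega)]
      rfl)
  rw [h2.n] at key
  exact key

/-! ### The search -/

theorem Params.scaled_ne_zero {x i : ℕ} (h : p.scaled x i ≠ 0) : p.inp x ≠ 0 ∧ p.inp (x + 1) ≠ 0 := by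
  constructor <;> intro h0 <;> exact h (by simp [Params.scaled, h0])

theorem Params.flowP_ne_zero {x : ℕ} {T : Finset ℕ} (h : p.flowP x T ≠ 0) :
    p.inp x ≠ 0 ∧ p.inp (x + 1) ≠ 0 := by
  by_contra hc
  have h0 : ∀ i, p.scaled x i = 0 := fun i => by
    by_contra hne; exact hc (scaled_ne_zero hne)
  refine h ?_
  obtain ⟨A, _, _, e⟩ := p.exists_mcut x (p.rvP x T)
  have : p.mcut x (p.rvP x T) = 0 := by rw [← e]; simp [rcut, rvP, h0]
  simp [flowP, this]

/-- The best purchases so far: `D` contains the choices that have been compared. -/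
structure Params.Best (p : Params) (m : Mem) (D : ℕ → ℕ → ℕ → Prop) : Prop where
  valid : p.Valid (tset p.n (m aBT))
  le_flowP : m aBC 0 ≤ p.flowP (m aBP 0) (tset p.n (m aBT))
  le_flowD : m aBC 0 ≤ p.flowD (m aBP 0)
  den : p.inp (m aBP 0 + 1) ≠ 0
  best : ∀ x w j, D x w j → p.inp x ≠ 0 → p.inp (x + 1) ≠ 0 →
    min (p.flowP x (p.greedyT x w j)) (p.flowD x) * p.inp x * p.inp (m aBP 0 + 1) ≤
      m aBC 0 * p.inp (m aBP 0) * p.inp (x + 1)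

theorem Params.Best.mono {m m' : Mem} {D D' : ℕ → ℕ → ℕ → Prop} (h : p.Best m D)
    (hD : ∀ x w j, D' x w j → D x w j) (h25 : m' aBP = m aBP) (h26 : m' aBC = m aBC)
    (h27 : m' aBT = m aBT) : p.Best m' D' := by
  refine ⟨by rw [h27]; exact h.valid, by rw [h25, h26, h27]; exact h.le_flowP,
    by rw [h25, h26]; exact h.le_flowD, by rw [h25]; exact h.den, ?_⟩
  rw [h25, h26]
  exact fun x w j hd => h.best x w j (hD x w j hd)

theorem improve_writes : ∀ a ∈ improve.writes, a ≤ 14 ∧ 2 ≤ a ∨ 25 ≤ a ∧ a ≤ 28 := by decide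

/-- Counts that belong to different units are compared after multiplication with the reference
numbers, and fractions by cross multiplication. -/
theorem improve_spec {m : Mem} (h : p.Ready m) {D : ℕ → ℕ → ℕ → Prop} (hb : p.Best m D)
    (hC2 : m aC2 0 = p.flowD (m aPOS 0)) {w j : ℕ}
    (hT : tset p.n (m aT) = p.greedyT (m aPOS 0) w j) :
    p.Best (improve.run m) (fun x' w' j' => D x' w' j' ∨ (x' = m aPOS 0 ∧ w' = w ∧ j' = j)) := by
  set x := m aPOS 0 with hx
  set T := tset p.n (m aT) with hTd
  set c := min (p.flowP x T) (p.flowD x) with hc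
  rw [improve]
  simp only [run_seq]
  set m1 := procFlow.run m with hm1
  have f1 : ∀ a, a = 0 ∨ a = 1 ∨ 15 ≤ a → m1 a = m a := fun a ha => (flow_frame ha m).1
  have s1 := (procFlow_spec h).1
  rw [← hm1] at s1
  set m2 := (Cmd.set aCM 0 (var aCNT)).run m1 with hm2
  have f2 : ∀ a, a ≠ 28 → m2 a = m1 a := fun a ha => Mem.set_ne _ _ _ ha
  have c2 : m2 28 0 = p.flowP x T := by simp [hm2, Mem.set_apply, s1, ← hx, ← hTd]
  set cc : Cmd := .ite (var aCM - var aC2) (.set aCM 0 (var aC2)) .skip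
  set m3 := cc.run m2 with hm3
  have f3 : ∀ a, a ≠ 28 → m3 a = m2 a := fun a ha => run_frame _ (by simp [cc, writes]; omega) m2
  have f3' : ∀ a, a = 0 ∨ a = 1 ∨ 15 ≤ a → a ≠ 28 → m3 a = m a := fun a ha h28 => by
    rw [f3 a h28, f2 a h28, f1 a ha]
  have c3 : m3 28 0 = c := by
    have e19 : m2 19 0 = p.flowD x := by rw [f2 19 (by omega), f1 19 (by omega), hC2]
    by_cases hle : p.flowP x T ≤ p.flowD x
    · rw [hm3, run_ite_neg (by simp [c2, e19]; omega), run_skip, c2, hc, min_eq_left hle]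
    · rw [hm3, run_ite_pos (by simp [c2, e19]; omega), run_set, hc, min_eq_right (by omega)]
      simp [Mem.set_apply, e19]
  have h3 : p.Ready m3 := h.frame (f3' 0 (by omega) (by omega)) (f3' 1 (by omega) (by omega))
    (f3' 15 (by omega) (by omega))
  have e17 : m3 17 = m 17 := f3' 17 (by omega) (by omega)
  have e25 : m3 25 = m 25 := f3' 25 (by omega) (by omega)
  have e26 : m3 26 = m 26 := f3' 26 (by omega) (by omega)
  have e27 : m3 27 = m 27 := f3' 27 (by omega) (by omega)
  have e16 : m3 16 = m 16 := f3' 16 (by omega) (by omega)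
  have hval : ((var aCM * .read 0 (var aPOS) * .read 0 (var aBP + 1)
      - var aBC * .read 0 (var aBP) * .read 0 (var aPOS + 1) : Expr)).val m3 =
      c * p.inp x * p.inp (m aBP 0 + 1) - m aBC 0 * p.inp (m aBP 0) * p.inp (x + 1) := by
    simp only [val_sub, val_mul, val_read, val_const, val_add, val_one, c3, e17, e25, e26, h3.inp, ← hx]
  by_cases hlt : m aBC 0 * p.inp (m aBP 0) * p.inp (x + 1) < c * p.inp x * p.inp (m aBP 0 + 1)
  · rw [run_ite_pos (by rw [hval]; omega)]
    simp only [run_seq]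
    set m4 := (Cmd.set aBC 0 (var aCM)).run m3 with hm4
    set m5 := (Cmd.set aBP 0 (var aPOS)).run m4 with hm5
    have f5 : ∀ a, a ≠ 25 → a ≠ 26 → m5 a = m3 a := fun a h5 h6 => by
      rw [hm5, run_set, Mem.set_ne _ _ _ h5, hm4, run_set, Mem.set_ne _ _ _ h6]
    have e6 := run_fill (x := 6) (q := 0) (a := 27) (i := var 6) (e := .read aT (var 6)) (m := m5)
      (by omega) (o := 0) (m aT) (fun j m' _ hx hf => by
        have := hf 16 (by omega) (by omega)
        rw [f5 16 (by omega) (by omega), e16] at this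
        simp [hx, this])
    set m6 := (Cmd.loop 6 0 (.set 27 (var 6) (.read aT (var 6)))).run m5 with hm6
    have f6 : ∀ a, a ≠ 6 → a ≠ 27 → m6 a = m5 a := fun a _ _ =>
      run_frame _ (by simp [writes]; omega) m5
    have hn5 : m5 1 0 = p.n := by rw [f5 1 (by omega) (by omega), h3.n]
    have t6 : tset p.n (m6 27) = T := by
      refine tset_congr fun v hv => ?_
      rw [e6, hn5, if_pos (by omega)]; rfl
    have c6 : m6 26 0 = c := by
      rw [f6 26 (by omega) (by omega), hm5, run_set, Mem.set_ne _ _ _ (by omega), hm4, run_set]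
      simp [Mem.set_apply, c3]
    have p6 : m6 25 0 = x := by
      have : m4 17 = m 17 := by rw [hm4, run_set, Mem.set_ne _ _ _ (by omega), e17]
      rw [f6 25 (by omega) (by omega), hm5, run_set]
      simp [Mem.set_apply, this, ← hx]
    -- A strict improvement needs a positive count, and this excludes references with a zero
    -- numerator or denominator.
    have hc0 : c ≠ 0 := fun h0 => by rw [h0] at hlt; simp at hlt
    have hx0 := Params.flowP_ne_zero (p := p) (x := x) (T := T) (by omega)
    refine ⟨?_, ?_, ?_, ?_, ?_⟩
    · rw [t6, hT]; exact Params.valid_greedyT _ _ _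
    · rw [t6, c6, p6]; omega
    · rw [c6, p6]; omega
    · rw [p6]; exact hx0.2
    · intro x' w' j' hd hx' hx1'
      rw [c6, p6]
      rcases hd with hd | ⟨rfl, rfl, rfl⟩
      · have h1 := hb.best x' w' j' hd hx' hx1'
        set q := min (p.flowP x' (p.greedyT x' w' j')) (p.flowD x')
        -- The two comparisons are chained after multiplying by the denominator of the previous
        -- reference, which is nonzero.
        have hpos : 0 < p.inp (m aBP 0 + 1) := Nat.pos_of_ne_zero hb.den
        refine Nat.le_of_mul_le_mul_left (?_ : p.inp (m aBP 0 + 1) * _ ≤ p.inp (m aBP 0 + 1) * _) hpos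
        calc p.inp (m aBP 0 + 1) * (q * p.inp x' * p.inp (x + 1))
            = (q * p.inp x' * p.inp (m aBP 0 + 1)) * p.inp (x + 1) := by ring
          _ ≤ (m aBC 0 * p.inp (m aBP 0) * p.inp (x' + 1)) * p.inp (x + 1) := Nat.mul_le_mul_right _ h1
          _ = (m aBC 0 * p.inp (m aBP 0) * p.inp (x + 1)) * p.inp (x' + 1) := by ring
          _ ≤ (c * p.inp x * p.inp (m aBP 0 + 1)) * p.inp (x' + 1) := Nat.mul_le_mul_right _ hlt.le
          _ = _ := by ring
      · rw [← hT]
  · rw [run_ite_neg (by rw [hval]; omega), run_skip]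
    have hb3 : p.Best m3 D := hb.mono (fun _ _ _ h => h) e25 e26 e27
    refine ⟨hb3.valid, hb3.le_flowP, hb3.le_flowD, hb3.den, ?_⟩
    intro x' w' j' hd hx' hx1'
    rcases hd with hd | ⟨rfl, rfl, rfl⟩
    · exact hb3.best x' w' j' hd hx' hx1'
    · rw [← hT, e25, e26]; exact not_lt.mp hlt

set_option maxRecDepth 4000 in
theorem search_writes : ∀ a ∈ search.writes, 2 ≤ a ∧ a ≠ 15 := by decide

theorem search_spec {m : Mem} (h : p.Ready m) (h5 : p.inp 5 ≠ 0) :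
    p.Ready (search.run m) ∧
    p.Best (search.run m) (fun x w j => x < p.K ∧ w < p.K ∧ j < p.N) := by
  have hw := search_writes
  refine ⟨h.frame (run_frame _ (fun hc => by have := hw 0 hc; omega) m)
    (run_frame _ (fun hc => by have := hw 1 hc; omega) m)
    (run_frame _ (fun hc => by have := hw 15 hc; omega) m), ?_⟩
  rw [search]
  simp only [run_seq]
  set m1 := (Cmd.set aBP 0 4).run m with hm1
  set m2 := (Cmd.set aBC 0 0).run m1 with hm2
  have f2 : ∀ a, a ≠ 25 → a ≠ 26 → m2 a = m a := fun a h5 h6 => by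
    rw [hm2, run_set, Mem.set_ne _ _ _ h6, hm1, run_set, Mem.set_ne _ _ _ h5]
  have h2 : p.Ready m2 := h.frame (f2 0 (by omega) (by omega)) (f2 1 (by omega) (by omega))
    (f2 15 (by omega) (by omega))
  have e3 := run_fill (x := 6) (q := 0) (a := 27) (i := var 6) (e := 0) (m := m2) (by omega)
    (o := 0) (fun _ => 0) (fun j m' _ hx _ => by simp [hx])
  set m3 := (Cmd.loop 6 0 (.set 27 (var 6) 0)).run m2 with hm3
  have f3 : ∀ a, a ≠ 6 → a ≠ 27 → m3 a = m2 a := fun a _ _ =>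
    run_frame _ (by simp [writes]; omega) m2
  have h3 : p.Ready m3 := h2.frame (f3 0 (by omega) (by omega)) (f3 1 (by omega) (by omega))
    (f3 15 (by omega) (by omega))
  have hb3 : p.Best m3 (fun _ _ _ => False) := by
    have t3 : tset p.n (m3 27) = ∅ := by
      ext v
      simp only [mem_tset, e3, h2.n, Finset.notMem_empty, iff_false, not_and]
      intro hv
      rw [if_pos (by omega)]; simp
    have c3 : m3 26 0 = 0 := by
      rw [f3 26 (by omega) (by omega), hm2]; simp [Mem.set_apply]
    have p3 : m3 25 0 = 4 := by
      rw [f3 25 (by omega) (by omega), hm2, run_set, Mem.set_ne _ _ _ (by omega), hm1]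
      simp [Mem.set_apply]
    refine ⟨by rw [t3]; exact Params.valid_empty, by omega, by omega, by rw [p3]; exact h5, ?_⟩
    exact fun _ _ _ hf => hf.elim
  have hwb : ∀ a ∈ (greedy ;; improve).writes,
      a ≤ 14 ∧ 2 ≤ a ∨ a = 16 ∨ a = 18 ∨ a = 20 ∨ a = 24 ∨ 25 ≤ a ∧ a ≤ 28 := by
    intro a ha
    rcases List.mem_append.mp ha with ha | ha
    · have := greedy_writes a ha; omega
    · have := improve_writes a ha; omega
  have key := run_loop_inv (x := xP) (p := 3) (m := m3)
    (c := .set aPOS 0 (var xP) ;; demFlow ;; .set aC2 0 (var aCNT) ;;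
      .loop xW 3 (.loop xJ 2 (greedy ;; improve)))
    (fun i m' => p.Best m' (fun x w j => x < i ∧ w < p.K ∧ j < p.N))
    (fun i m' v hb => hb.mono (fun _ _ _ h => h) (Mem.set_ne _ _ _ (by omega))
      (Mem.set_ne _ _ _ (by omega)) (Mem.set_ne _ _ _ (by omega)))
    (hb3.mono (fun x _ _ h => by omega) rfl rfl rfl) (by
      intro i m4 hi hx hf hb4
      have hwo : ∀ a, a = 0 ∨ a = 1 ∨ a = 15 → m4 a = m3 a := fun a ha => hf a (fun hc => by
        simp only [writes, List.mem_cons, List.mem_append, List.not_mem_nil, or_false, flow_writes] at hc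
        rcases hc with hc | hc | hc | hc | hc | hc | hc | hc
        · omega
        · omega
        · omega
        · omega
        · omega
        · omega
        · have := greedy_writes a hc; omega
        · have := improve_writes a hc; omega)
      have h4 : p.Ready m4 := h3.frame (hwo 0 (by omega)) (hwo 1 (by omega)) (hwo 15 (by omega))
      simp only [run_seq]
      set m5 := (Cmd.set aPOS 0 (var xP)).run m4 with hm5
      have f5 : ∀ a, a ≠ 17 → m5 a = m4 a := fun a ha => Mem.set_ne _ _ _ ha
      have p5 : m5 17 0 = i := by simp [hm5, Mem.set_apply, hx]
      have h5 : p.Ready m5 := h4.frame (f5 0 (by omega)) (f5 1 (by omega)) (f5 15 (by omega))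
      have s6 := (demFlow_spec h5).1
      set m6 := demFlow.run m5 with hm6
      have f6 : ∀ a, a = 0 ∨ a = 1 ∨ 15 ≤ a → m6 a = m5 a := fun a ha => (flow_frame ha m5).2
      set m7 := (Cmd.set aC2 0 (var aCNT)).run m6 with hm7
      have f7 : ∀ a, a ≠ 19 → m7 a = m6 a := fun a ha => Mem.set_ne _ _ _ ha
      have c7 : m7 19 0 = p.flowD i := by simp [hm7, Mem.set_apply, s6, p5]
      have g7 : ∀ a, a = 0 ∨ a = 1 ∨ 15 ≤ a → a ≠ 19 → m7 a = m5 a := fun a ha h19 => by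
        rw [f7 a h19, f6 a ha]
      have p7 : m7 17 0 = i := by rw [g7 17 (by omega) (by omega), p5]
      have h7 : p.Ready m7 := h5.frame (g7 0 (by omega) (by omega)) (g7 1 (by omega) (by omega))
        (g7 15 (by omega) (by omega))
      have hb7 : p.Best m7 (fun x w j => x < i ∧ w < p.K ∧ j < p.N) :=
        hb4.mono (fun _ _ _ h => h) (by rw [g7 25 (by omega) (by omega), f5 25 (by omega)])
          (by rw [g7 26 (by omega) (by omega), f5 26 (by omega)])
          (by rw [g7 27 (by omega) (by omega), f5 27 (by omega)])
      have mid := run_loop_inv (x := xW) (p := 3) (m := m7) (c := .loop xJ 2 (greedy ;; improve))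
        (fun iw m' => p.Best m' (fun x w j => (x < i ∧ w < p.K ∧ j < p.N) ∨
          (x = i ∧ w < iw ∧ j < p.N)))
        (fun _ m' v hb => hb.mono (fun _ _ _ h => h) (Mem.set_ne _ _ _ (by omega))
          (Mem.set_ne _ _ _ (by omega)) (Mem.set_ne _ _ _ (by omega)))
        (hb7.mono (fun x w j h => by omega) rfl rfl rfl) (by
          intro iw m8 hiw hxw hf8 hb8
          have g8 : ∀ a, a = 0 ∨ a = 1 ∨ a = 15 ∨ a = 17 ∨ a = 19 → m8 a = m7 a := fun a ha =>
            hf8 a (fun hc => by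
              rcases List.mem_cons.mp hc with hc | hc
              · omega
              rcases List.mem_cons.mp hc with hc | hc
              · omega
              have := hwb a hc; omega)
          have h8 : p.Ready m8 := h7.frame (g8 0 (by omega)) (g8 1 (by omega)) (g8 15 (by omega))
          have inner := run_loop_inv (x := xJ) (p := 2) (m := m8) (c := greedy ;; improve)
            (fun ij m' => p.Best m' (fun x w j => ((x < i ∧ w < p.K ∧ j < p.N) ∨
              (x = i ∧ w < iw ∧ j < p.N)) ∨ (x = i ∧ w = iw ∧ j < ij)))
            (fun _ m' v hb => hb.mono (fun _ _ _ h => h) (Mem.set_ne _ _ _ (by omega))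
              (Mem.set_ne _ _ _ (by omega)) (Mem.set_ne _ _ _ (by omega)))
            (hb8.mono (fun x w j h => by omega) rfl rfl rfl) (by
              intro ij m9 hij hxj hf9 hb9
              have g9 : ∀ a, a = 0 ∨ a = 1 ∨ a = 15 ∨ a = 17 ∨ a = 19 ∨ a = 22 → m9 a = m8 a :=
                fun a ha => hf9 a (fun hc => by
                  rcases List.mem_cons.mp hc with hc | hc
                  · omega
                  have := hwb a hc; omega)
              have h9 : p.Ready m9 := h8.frame (g9 0 (by omega)) (g9 1 (by omega)) (g9 15 (by omega))
              have ht := greedy_spec h9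
              rw [run_seq]
              set m10 := greedy.run m9 with hm10
              have g10 : ∀ a, a = 0 ∨ a = 1 ∨ a = 15 ∨ a = 17 ∨ a = 19 ∨ a = 25 ∨ a = 26 ∨ a = 27 →
                  m10 a = m9 a := fun a ha => run_frame _ (fun hc => by
                    have := greedy_writes a hc; omega) m9
              have h10 : p.Ready m10 := h9.frame (g10 0 (by omega)) (g10 1 (by omega))
                (g10 15 (by omega))
              have p10 : m10 17 0 = i := by
                rw [g10 17 (by omega), g9 17 (by omega), g8 17 (by omega), p7]
              have hcmp := improve_spec h10 (hb9.mono (fun _ _ _ h => h) (g10 25 (by omega))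
                (g10 26 (by omega)) (g10 27 (by omega))) (w := iw) (j := ij)
                (by rw [p10, g10 19 (by omega), g9 19 (by omega), g8 19 (by omega), c7])
                (by rw [ht, g10 17 (by omega), hxj, g9 22 (by omega), hxw])
              rw [p10] at hcmp
              exact hcmp.mono (fun x w j h => by omega) rfl rfl rfl)
          rw [h8.N] at inner
          exact inner.mono (fun x w j h => by omega) rfl rfl rfl)
      rw [h7.K] at mid
      exact mid.mono (fun x w j h => by omega) rfl rfl rfl)
  rw [h3.K] at key
  exact key

end Middlebox

namespace Middlebox

open Middlebox.Expr Middlebox.Cmd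

variable {p : Params}

/-! ## The best flows -/

/-- `g` is a flow of value `val` that respects the capacities `c` and does not use both directions
of an edge. -/
structure Params.IsFlow (p : Params) (c g : ℕ → ℕ → ℕ) (val : ℕ) : Prop where
  gross : IsGross p.N p.s g val
  le : ∀ u < p.N, ∀ v < p.N, g u v ≤ c u v
  one : ∀ u < p.N, ∀ v < p.N, g u v = 0 ∨ g v u = 0

theorem IsGross.congr {N s val : ℕ} {g g' : ℕ → ℕ → ℕ} (h : IsGross N s g val)
    (hg : ∀ u < N, ∀ v < N, g' u v = g u v) : IsGross N s g' val := by
  intro u hu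
  rw [← h u hu]
  refine Finset.sum_congr rfl fun v hv => ?_
  have hv : v < N := by simpa using hv
  rw [hg u hu v hv, hg v hv u hu]

/-- Of the two opposite differences `c - r` at most one is positive, so truncation cancels flow
along both directions of an edge. -/
theorem Params.isFlow_of_isRes {c r g : ℕ → ℕ → ℕ} {val : ℕ} (h : IsRes p.N p.s c r val)
    (hg : ∀ u < p.N, ∀ v < p.N, g u v = c u v - r u v) : p.IsFlow c g val := by
  refine ⟨h.isGross.congr hg, fun u hu v hv => ?_, fun u hu v hv => ?_⟩
  · rw [hg u hu v hv]; omega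
  · have := h.anti u hu v hv
    rw [hg u hu v hv, hg v hv u hu]; omega

theorem bestFlows_spec {m : Mem} (h : p.Ready m) :
    let m' := bestFlows.run m
    p.Ready m' ∧ m' aPOS 0 = m aBP 0 ∧ m' aBT = m aBT ∧ m' aBC = m aBC ∧
      p.IsFlow (p.capF (m aBP 0) (p.rvP (m aBP 0) (tset p.n (m aBT)))) (mat p.N (m' aG1))
        (p.flowP (m aBP 0) (tset p.n (m aBT))) ∧
      p.IsFlow (p.capF (m aBP 0) (p.rvD (m aBP 0))) (mat p.N (m' aG2)) (p.flowD (m aBP 0)) := by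
  intro m'
  have hm' : m' = bestFlows.run m := rfl
  rw [bestFlows] at hm'
  simp only [run_seq] at hm'
  set x := m aBP 0 with hx
  set m1 := (Cmd.set aPOS 0 (var aBP)).run m with hm1
  have f1 : ∀ a, a ≠ 17 → m1 a = m a := fun a ha => Mem.set_ne _ _ _ ha
  have p1 : m1 17 0 = x := by simp [hm1, Mem.set_apply, hx]
  have h1 : p.Ready m1 := h.frame (f1 0 (by omega)) (f1 1 (by omega)) (f1 15 (by omega))
  have e2 := run_fill (x := 6) (q := 0) (a := 16) (i := var 6) (e := .read aBT (var 6)) (m := m1)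
    (by omega) (o := 0) (m aBT) (fun j m' _ hx hf => by
      have := hf 27 (by omega) (by omega)
      rw [f1 27 (by omega)] at this
      simp [hx, this])
  set m2 := (Cmd.loop 6 0 (.set 16 (var 6) (.read aBT (var 6)))).run m1 with hm2
  have f2 : ∀ a, a ≠ 6 → a ≠ 16 → m2 a = m1 a := fun a _ _ =>
    run_frame _ (by simp [writes]; omega) m1
  have h2 : p.Ready m2 := h1.frame (f2 0 (by omega) (by omega)) (f2 1 (by omega) (by omega))
    (f2 15 (by omega) (by omega))
  have t2 : tset p.n (m2 16) = tset p.n (m aBT) := tset_congr fun v hv => by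
    rw [e2, h1.n, if_pos (by omega)]; rfl
  have p2 : m2 17 0 = x := by rw [f2 17 (by omega) (by omega), p1]
  have s3 := procFlow_spec h2
  rw [t2, p2] at s3
  set m3 := procFlow.run m2 with hm3
  have f3 : ∀ a, a = 0 ∨ a = 1 ∨ 15 ≤ a → m3 a = m2 a := fun a ha => (flow_frame ha m2).1
  have h3 : p.Ready m3 := h2.frame (f3 0 (by omega)) (f3 1 (by omega)) (f3 15 (by omega))
  have s4 := saveFlow_spec (G := 29) (by omega) (m := m3) h3.N
  set m4 := (saveFlow 29).run m3 with hm4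
  have f4 : ∀ a, a ≠ 6 → a ≠ 7 → a ≠ 29 → m4 a = m3 a := fun a _ _ _ =>
    run_frame _ (by simp [saveFlow_writes]; omega) m3
  have h4 : p.Ready m4 := h3.frame (f4 0 (by omega) (by omega) (by omega))
    (f4 1 (by omega) (by omega) (by omega)) (f4 15 (by omega) (by omega) (by omega))
  have p4 : m4 17 0 = x := by
    rw [f4 17 (by omega) (by omega) (by omega), f3 17 (by omega), p2]
  have s5 := demFlow_spec h4
  rw [p4] at s5
  set m5 := demFlow.run m4 with hm5
  have f5 : ∀ a, a = 0 ∨ a = 1 ∨ 15 ≤ a → m5 a = m4 a := fun a ha => (flow_frame ha m4).2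
  have h5 : p.Ready m5 := h4.frame (f5 0 (by omega)) (f5 1 (by omega)) (f5 15 (by omega))
  have s6 := saveFlow_spec (G := 30) (by omega) (m := m5) h5.N
  rw [← hm'] at s6
  have f6 : ∀ a, a ≠ 6 → a ≠ 7 → a ≠ 30 → m' a = m5 a := fun a _ _ _ => by
    rw [hm']; exact run_frame _ (by simp [saveFlow_writes]; omega) m5
  have g6 : ∀ a, a = 25 ∨ a = 26 ∨ a = 27 → m' a = m a := fun a ha => by
    rw [f6 a (by omega) (by omega) (by omega), f5 a (by omega), f4 a (by omega) (by omega) (by omega),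
      f3 a (by omega), f2 a (by omega) (by omega), f1 a (by omega)]
  refine ⟨h5.frame (f6 0 (by omega) (by omega) (by omega)) (f6 1 (by omega) (by omega) (by omega))
    (f6 15 (by omega) (by omega) (by omega)), ?_, g6 27 (by omega), g6 26 (by omega), ?_, ?_⟩
  · rw [f6 17 (by omega) (by omega) (by omega), f5 17 (by omega), p4]
  · rw [f6 29 (by omega) (by omega) (by omega), f5 29 (by omega), ← s3.1]
    exact Params.isFlow_of_isRes s3.2.2 fun u hu v hv => by rw [s4 u hu v hv, s3.2.1 u hu v hv]
  · rw [← s5.1]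
    exact Params.isFlow_of_isRes s5.2.2 fun u hu v hv => by rw [s6 u hu v hv, s5.2.1 u hu v hv]

/-! ## Routes -/

theorem IsPath.mono {N s l : ℕ} {M M' : ℕ → ℕ → ℕ} {b : ℕ → ℕ} (h : IsPath N s M b l)
    (hM : ∀ u < N, ∀ v < N, M u v ≤ M' u v) : IsPath N s M' b l :=
  ⟨h.pos, h.first, h.last, h.lt, fun i hi => by
    have := hM _ (h.lt (i + 1) hi) _ (h.lt i (by omega))
    have := h.arc i hi
    omega, h.inj⟩

/-- The shape of the paths in a network. -/
theorem Params.path_shape {x l : ℕ} {rv b : ℕ → ℕ} (h : IsPath p.N p.s (p.capF x rv) b l) :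
    3 ≤ l ∧ (∃ j < p.n + p.d, b 1 = p.n + j ∧ rv j ≠ 0 ∧ b 2 = p.att j) ∧
      (∀ i, 2 ≤ i → i < l → b i < p.n) ∧
      ∀ i, 2 ≤ i → i + 1 < l → p.scaled x (p.capPos (b (i + 1)) (b i)) ≠ 0 := by
  have hz : p.N - 1 = p.n + (p.n + p.d) := by simp [Params.N]
  have hs := p.s_lt
  have hpos := h.pos
  have hl1 : l ≠ 1 := by
    rintro rfl
    have h1 := h.first
    have h2 := h.last
    simp only [Nat.sub_self] at h2
    omega
  -- The artificial sink is entered from terminals only, and a terminal only from the vertex to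
  -- which it is attached.
  have a0 := h.arc 0 (by omega)
  rw [zero_add, h.first, Params.capF, hz] at a0
  by_cases c1 : b 1 < p.n
  · rw [if_pos c1, if_neg (by omega), if_neg (by omega)] at a0
    exact absurd rfl a0
  rw [if_neg c1] at a0
  by_cases c2 : b 1 < p.n + (p.n + p.d)
  swap
  · rw [if_neg (by omega)] at a0; exact absurd rfl a0
  rw [if_pos ⟨rfl, c2⟩] at a0
  have hl2 : l ≠ 2 := by
    rintro rfl
    have h2 := h.last
    simp only [Nat.reduceSub] at h2
    omega
  have a1 := h.arc 1 (by omega)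
  rw [Params.capF, hz] at a1
  by_cases c3 : b 2 < p.n
  swap
  · rw [if_neg c3, if_neg (by omega)] at a1; exact absurd rfl a1
  rw [if_pos c3, if_neg c1] at a1
  have hatt : p.att (b 1 - p.n) = b 2 := by
    by_contra hne
    rw [if_neg (fun hc => hne hc.2)] at a1
    exact a1 rfl
  -- Arcs into a vertex of the graph start at a vertex of the graph, so the rest of the path never
  -- meets a terminal.
  have key : ∀ i, i + 2 < l → b (i + 2) < p.n := by
    intro i
    induction i with
    | zero => intro _; exact c3
    | succ i ih =>
      intro hi
      have ih := ih (by omega)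
      by_contra hc
      have a := h.arc (i + 2) (by omega)
      rw [Params.capF, hz, if_neg hc, if_neg (by omega)] at a
      exact a rfl
  have key' : ∀ i, 2 ≤ i → i < l → b i < p.n := fun i hi hil => by
    have := key (i - 2) (by omega)
    rwa [Nat.sub_add_cancel hi] at this
  refine ⟨by omega, ⟨b 1 - p.n, by omega, by omega, a0, hatt.symm⟩, key', fun i hi hil => ?_⟩
  have a := h.arc i hil
  rwa [Params.capF, if_pos (key' _ (by omega) hil), if_pos (key' _ hi (by omega))] at a

/-- A unit of flow: a path to a processing vertex and a path to a sink, in reverse order, with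
their lengths, and the positions of the first common vertex on the way back. -/
structure Rec where
  PB : ℕ → ℕ
  QB : ℕ → ℕ
  lp : ℕ
  lq : ℕ
  hs : ℕ
  ms : ℕ

/-- The field `first` makes the way back disjoint from `Q` until the hub, so that the way back
followed by the end of `Q` is simple. -/
structure Params.RecOk (p : Params) (x : ℕ) (T : Finset ℕ) (r : Rec) : Prop where
  pathP : IsPath p.N p.s (p.capF x (p.rvP x T)) r.PB r.lp
  pathQ : IsPath p.N p.s (p.capF x (p.rvD x)) r.QB r.lq
  hs_ge : 2 ≤ r.hs
  hs_lt : r.hs < r.lp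
  ms_ge : 2 ≤ r.ms
  ms_lt : r.ms < r.lq
  hub : r.PB r.hs = r.QB r.ms
  first : ∀ h, 2 ≤ h → h < r.hs → ∀ m, 2 ≤ m → m < r.lq → r.PB h ≠ r.QB m

def Rec.walk (r : Rec) : List ℕ :=
  (List.range (r.lp - 2)).map (fun i => r.PB (r.lp - (i + 1))) ++
  ((List.range (r.hs - 2)).map (fun i => r.PB (i + 3)) ++
    (List.range (r.ms - 2)).map (fun i => r.QB (r.ms - (i + 1))))

def Params.block (p : Params) (x : ℕ) (r : Rec) : List ℕ :=
  [r.QB 1 - 2 * p.n, r.PB 2, p.inp x, 3 * p.L * p.inp (x + 1),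
    (r.lp - 2) + (r.hs - 2) + (r.ms - 2)] ++ r.walk

/-- The number of times that a path uses an arc. -/
def arcUse (b : ℕ → ℕ) (l u v : ℕ) : ℕ :=
  ∑ j ∈ Finset.range (l - 1), if u = b (j + 1) ∧ v = b j then 1 else 0

theorem hub_spec {m : Mem} {N lp lq : ℕ} (hN : m 1 2 = N) (hlp : m aLP 0 = lp) (hlq : m aLQ 0 = lq)
    (hpN : lp ≤ N) (hqN : lq ≤ N) (h3 : 3 ≤ lp) (hq3 : 3 ≤ lq)
    (heq : m aPB (lp - 1) = m aQB (lq - 1)) :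
    let m' := hub.run m
    2 ≤ m' aHS 0 ∧ m' aHS 0 < lp ∧ 2 ≤ m' aMS 0 ∧ m' aMS 0 < lq ∧
      m aPB (m' aHS 0) = m aQB (m' aMS 0) ∧
      ∀ h, 2 ≤ h → h < m' aHS 0 → ∀ k, 2 ≤ k → k < lq → m aPB h ≠ m aQB k := by
  have key := run_loop_inv (x := xA) (p := 2) (m := m)
    (c := .ite (var aLP - (var xA + 2))
    (.loop xB 2 (.ite (var aLQ - (var xB + 2))
      (.ite (neq (.read aPB (var aLP - (var xA + 1))) (.read aQB (var xB + 2))) .skip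
        (.set aHS 0 (var aLP - (var xA + 1)) ;; .set aMS 0 (var xB + 2))) .skip)) .skip)
    -- Nothing is recorded before the first round. That round starts from the source, which lies on
    -- both paths, so from then on a common vertex is recorded.
    (fun i m' => 1 ≤ i → 2 ≤ m' aHS 0 ∧ m' aHS 0 < lp ∧ 2 ≤ m' aMS 0 ∧ m' aMS 0 < lq ∧
      m aPB (m' aHS 0) = m aQB (m' aMS 0) ∧
      ∀ h, 2 ≤ h → lp - i ≤ h → h < m' aHS 0 → ∀ k, 2 ≤ k → k < lq → m aPB h ≠ m aQB k)
    (fun i m' v h => by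
      rw [Mem.set_ne _ _ _ (by omega), Mem.set_ne _ _ _ (by omega)]; exact h)
    (by omega) (by
      intro i m1 hi hx hf h _
      have f1 : ∀ a, a ≠ 6 → a ≠ 7 → a ≠ 33 → a ≠ 34 → m1 a = m a := fun a _ _ _ _ =>
        hf a (by simp [writes]; omega)
      by_cases c1 : lp ≤ i + 2
      · rw [run_ite_neg (by simp [f1 11, hlp, hx]; omega), run_skip]
        obtain ⟨h1, h2, h3, h4, h5, h6⟩ := h (by omega)
        exact ⟨h1, h2, h3, h4, h5, fun k hk hk' => h6 k hk (by omega)⟩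
      rw [run_ite_pos (by simp [f1 11, hlp, hx]; omega)]
      set h0 := lp - (i + 1) with hh0
      have inner := run_loop_inv (x := xB) (p := 2) (m := m1)
        (c := .ite (var aLQ - (var xB + 2))
          (.ite (neq (.read aPB (var aLP - (var xA + 1))) (.read aQB (var xB + 2))) .skip
          (.set aHS 0 (var aLP - (var xA + 1)) ;; .set aMS 0 (var xB + 2))) .skip)
        (fun j m' => (m' aHS = m1 aHS ∧ m' aMS = m1 aMS ∧
            ∀ k, 2 ≤ k → k < j + 2 → k < lq → m aPB h0 ≠ m aQB k) ∨
          (m' aHS 0 = h0 ∧ 2 ≤ m' aMS 0 ∧ m' aMS 0 < lq ∧ m aPB h0 = m aQB (m' aMS 0)))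
        (fun i m' v h => by
          rw [Mem.set_ne _ _ _ (by omega), Mem.set_ne _ _ _ (by omega)]; exact h)
        (Or.inl ⟨rfl, rfl, fun k _ _ => by omega⟩) (by
          intro j m2 hj hxj hf2 h2
          have f2 : ∀ a, a ≠ 6 → a ≠ 7 → a ≠ 33 → a ≠ 34 → m2 a = m a := fun a h6 h7 h33 h34 => by
            rw [hf2 a (by simp [writes]; omega), f1 a h6 h7 h33 h34]
          have hx2 : m2 6 0 = i := by rw [hf2 6 (by simp [writes]), hx]
          by_cases c2 : lq ≤ j + 2
          · rw [run_ite_neg (by simp [f2 32, hlq, hxj]; omega), run_skip]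
            rcases h2 with ⟨a1, a2, a3⟩ | h2
            · exact Or.inl ⟨a1, a2, fun k hk _ hkq => a3 k hk (by omega) hkq⟩
            · exact Or.inr h2
          rw [run_ite_pos (by simp [f2 32, hlq, hxj]; omega)]
          have hnq := val_neq' m2 (.read aPB (var aLP - (var xA + 1))) (.read aQB (var xB + 2))
          simp only [val_read, val_sub, val_add, val_const, val_one, val_two, hx2, hxj] at hnq
          rw [f2 10 (by omega) (by omega) (by omega) (by omega),
            f2 11 (by omega) (by omega) (by omega) (by omega),
            f2 31 (by omega) (by omega) (by omega) (by omega), hlp, ← hh0] at hnq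
          by_cases c3 : m 10 h0 = m 31 (j + 2)
          · rw [run_ite_neg (hnq.2 c3)]
            right
            have e11 : m2 11 0 = lp := by rw [f2 11 (by omega) (by omega) (by omega) (by omega), hlp]
            simp [Mem.set_apply, hx2, hxj, e11, ← hh0, c3]
            omega
          · rw [run_ite_pos (fun hc => c3 (hnq.1 hc)), run_skip]
            rcases h2 with ⟨a1, a2, a3⟩ | h2
            · refine Or.inl ⟨a1, a2, fun k hk hk' hkq => ?_⟩
              by_cases e : k = j + 2
              · rw [e]; exact c3
              · exact a3 k hk (by omega) hkq
            · exact Or.inr h2)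
      rw [f1 1 (by omega) (by omega) (by omega) (by omega), hN] at inner
      rcases inner with ⟨a1, a2, a3⟩ | ⟨a1, a2, a3, a4⟩
      · have hi1 : 1 ≤ i := by
          by_contra hc
          obtain rfl : i = 0 := by omega
          exact a3 (lq - 1) (by omega) (by omega) (by omega) heq
        obtain ⟨h1, h2, h3, h4, h5, h6⟩ := h hi1
        rw [a1, a2]
        refine ⟨h1, h2, h3, h4, h5, fun k hk hk' hkh => ?_⟩
        by_cases e : k = h0
        · rw [e]; exact fun q hq hq' => a3 q hq (by omega) hq'
        · exact h6 k hk (by omega) hkh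
      · rw [a1]
        refine ⟨by omega, by omega, a2, a3, a4, fun k hk hk' hkh => by omega⟩)
  rw [hN] at key
  obtain ⟨h1, h2, h3, h4, h5, h6⟩ := key (by omega)
  exact ⟨h1, h2, h3, h4, h5, fun h hh hh' => h6 h hh (by omega) hh'⟩

/-! ### Output -/

/-- The words written so far. -/
def outL (m : Mem) : List ℕ := (List.range (m aOL 0)).map (m aOUT)

theorem outL_congr {m m' : Mem} (h1 : m' aOUT = m aOUT) (h2 : m' aOL = m aOL) : outL m' = outL m := by
  rw [outL, outL, h1, h2]

theorem outL_emit (e : Expr) (m : Mem) : outL ((emit e).run m) = outL m ++ [e.val m] := by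
  have h1 : (emit e).run m aOL 0 = m aOL 0 + 1 := by
    simp [emit, Mem.set_apply]
  have h2 : (emit e).run m aOUT = Function.update (m aOUT) (m aOL 0) (e.val m) := by
    rw [emit, run_seq, run_set, Mem.set_ne _ _ _ (by omega), run_set, Mem.set_self]; rfl
  rw [outL, h1, h2, List.range_succ, List.map_append, outL]
  congr 1
  · refine List.map_congr_left fun i hi => Function.update_of_ne ?_ _ _
    simp only [List.mem_range] at hi; omega
  · simp

theorem emit_frame (e : Expr) (m : Mem) {a : ℕ} (h1 : a ≠ 35) (h2 : a ≠ 36) :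
    (emit e).run m a = m a := run_frame _ (by simp [emit, writes]; omega) m

theorem outL_loop {q k : ℕ} {cond e : Expr} {m : Mem} (F : ℕ → ℕ) (hk : k ≤ m 1 q)
    (hF : ∀ i m', m' xA 0 = i → (∀ a, a ≠ 6 → a ≠ 35 → a ≠ 36 → m' a = m a) →
      (cond.val m' ≠ 0 ↔ i < k) ∧ (i < k → e.val m' = F i)) :
    outL ((Cmd.loop xA q (.ite cond (emit e) .skip)).run m) = outL m ++ (List.range k).map F := by
  have key := run_loop_inv (x := xA) (p := q) (m := m) (c := .ite cond (emit e) .skip)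
    (fun i m' => outL m' = outL m ++ (List.range (min i k)).map F)
    (fun i m' v h => by
      rw [outL_congr (Mem.set_ne _ _ _ (by omega)) (Mem.set_ne _ _ _ (by omega))]; exact h)
    (by simp) (by
      intro i m' hi hx hf h
      obtain ⟨h1, h2⟩ := hF i m' hx (fun a h6 h35 h36 => hf a (by simp [writes, emit]; omega))
      by_cases c : i < k
      · rw [run_ite_pos (h1.2 c), outL_emit, h, h2 c, min_eq_left c.le, min_eq_left (by omega),
          List.range_succ, List.map_append, List.append_assoc]
        rfl
      · rw [run_ite_neg (by by_contra hc; exact c (h1.1 hc)), run_skip, h, min_eq_right (by omega),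
          min_eq_right (by omega)])
  rw [min_eq_right hk] at key
  exact key

theorem emitWalk_spec {m : Mem} {r : Rec} (hN : m 1 2 = p.N) (h10 : m aPB = r.PB) (h11 : m aLP 0 = r.lp)
    (h31 : m aQB = r.QB) (h33 : m aHS 0 = r.hs) (h34 : m aMS 0 = r.ms)
    (hlp : r.lp ≤ p.N) (hhs : r.hs ≤ p.N) (hms : r.ms ≤ p.N) :
    outL (emitWalk.run m) = outL m ++ r.walk := by
  rw [emitWalk]
  simp only [run_seq]
  set m1 := (Cmd.loop xA 2 (.ite (var aLP - (var xA + 2)) (emit (.read aPB (var aLP - (var xA + 1)))) .skip)).run m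
    with hm1
  have f1 : ∀ a, a ≠ 6 → a ≠ 35 → a ≠ 36 → m1 a = m a := fun a _ _ _ =>
    run_frame _ (by simp [emit, writes]; omega) m
  set m2 := (Cmd.loop xA 2 (.ite (var aHS - (var xA + 2)) (emit (.read aPB (var xA + 3))) .skip)).run m1
    with hm2
  have f2 : ∀ a, a ≠ 6 → a ≠ 35 → a ≠ 36 → m2 a = m a := fun a h6 h35 h36 => by
    rw [← f1 a h6 h35 h36]; exact run_frame _ (by simp [emit, writes]; omega) m1
  have N1 : m1 1 2 = p.N := by rw [f1 1 (by omega) (by omega) (by omega), hN]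
  have N2 : m2 1 2 = p.N := by rw [f2 1 (by omega) (by omega) (by omega), hN]
  rw [outL_loop (k := r.ms - 2) (fun i => r.QB (r.ms - (i + 1))) (by omega), hm2,
    outL_loop (k := r.hs - 2) (fun i => r.PB (i + 3)) (by omega), hm1,
    outL_loop (k := r.lp - 2) (fun i => r.PB (r.lp - (i + 1))) (by omega)]
  · simp only [Rec.walk, List.append_assoc]
  · intro i m' hx hf
    simp only [val_sub, val_read, val_add, val_const, val_one, val_two, hx,
      hf 11 (by omega) (by omega) (by omega), hf 10 (by omega) (by omega) (by omega), h10, h11]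
    exact ⟨by omega, fun _ => trivial⟩
  · intro i m' hx hf
    simp only [val_sub, val_read, val_add, val_const, val_three, val_two, hx,
      hf 33 (by omega) (by omega) (by omega), hf 10 (by omega) (by omega) (by omega),
      f1 33 (by omega) (by omega) (by omega), f1 10 (by omega) (by omega) (by omega), h10, h33]
    exact ⟨by omega, fun _ => trivial⟩
  · intro i m' hx hf
    simp only [val_sub, val_read, val_add, val_const, val_one, val_two, hx,
      hf 34 (by omega) (by omega) (by omega), hf 31 (by omega) (by omega) (by omega),
      f2 34 (by omega) (by omega) (by omega), f2 31 (by omega) (by omega) (by omega), h31, h34]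
    exact ⟨by omega, fun _ => trivial⟩

theorem emitRoute_spec {m : Mem} {r : Rec} {x : ℕ} (h : p.Ready m) (hx : m aPOS 0 = x)
    (h10 : m aPB = r.PB) (h11 : m aLP 0 = r.lp)
    (h31 : m aQB = r.QB) (h33 : m aHS 0 = r.hs) (h34 : m aMS 0 = r.ms)
    (hlp : r.lp ≤ p.N) (hhs : r.hs ≤ p.N) (hms : r.ms ≤ p.N) :
    outL (emitRoute.run m) = outL m ++ p.block x r := by
  rw [emitRoute]
  simp only [run_seq]
  set m1 := (emit (.read aQB 1 - 2 * nE)).run m with hm1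
  have f1 : ∀ a, a ≠ 35 → a ≠ 36 → m1 a = m a := fun a h h' => emit_frame _ _ h h'
  set m2 := (emit (.read aPB 2)).run m1 with hm2
  have f2 : ∀ a, a ≠ 35 → a ≠ 36 → m2 a = m a := fun a h h' => by rw [hm2, emit_frame _ _ h h', f1 a h h']
  set m3 := (emit (.read 0 (var aPOS))).run m2 with hm3
  have f3 : ∀ a, a ≠ 35 → a ≠ 36 → m3 a = m a := fun a h h' => by rw [hm3, emit_frame _ _ h h', f2 a h h']
  set m4 := (emit (3 * unitE * .read 0 (var aPOS + 1))).run m3 with hm4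
  have f4 : ∀ a, a ≠ 35 → a ≠ 36 → m4 a = m a := fun a h h' => by rw [hm4, emit_frame _ _ h h', f3 a h h']
  set m5 := (emit ((var aLP - 2) + (var aHS - 2) + (var aMS - 2))).run m4 with hm5
  have f5 : ∀ a, a ≠ 35 → a ≠ 36 → m5 a = m a := fun a h h' => by rw [hm5, emit_frame _ _ h h', f4 a h h']
  rw [emitWalk_spec (p := p) (r := r), hm5, outL_emit, hm4, outL_emit, hm3, outL_emit, hm2, outL_emit, hm1,
    outL_emit]
  · have e1 : (Expr.read aQB 1 - 2 * nE).val m = r.QB 1 - 2 * p.n := by simp [h31, h.n]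
    have e2 : (Expr.read aPB 2).val m1 = r.PB 2 := by simp [f1 10, h10]
    have e3 : (Expr.read 0 (var aPOS)).val m2 = p.inp x := by
      simp [f2 0, f2 17, h.inp, hx]
    have e4 : (3 * unitE * Expr.read 0 (var aPOS + 1)).val m3 = 3 * p.L * p.inp (x + 1) := by
      simp [f3 0, f3 17, f3 1, h.inp, h.L, hx]
    have e5 : ((var aLP - 2) + (var aHS - 2) + (var aMS - 2) : Expr).val m4 =
        (r.lp - 2) + (r.hs - 2) + (r.ms - 2) := by
      simp [f4 11, f4 33, f4 34, h11, h33, h34]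
    rw [← hm1, ← hm2, ← hm3, ← hm4, e1, e2, e3, e4, e5]
    simp [Params.block]
  · rw [f5 1 (by omega) (by omega), h.N]
  · rw [f5 10 (by omega) (by omega), h10]
  · rw [f5 11 (by omega) (by omega), h11]
  · rw [f5 31 (by omega) (by omega), h31]
  · rw [f5 33 (by omega) (by omega), h33]
  · rw [f5 34 (by omega) (by omega), h34]
  · exact hlp
  · exact hhs
  · exact hms

theorem emitRoute_frame (m : Mem) {a : ℕ} (h6 : a ≠ 6) (h35 : a ≠ 35) (h36 : a ≠ 36) :
    emitRoute.run m a = m a := run_frame _ (by simp [emitRoute, emitWalk, emit, writes]; omega) m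

/-- One step of the flow decomposition. -/
theorem decompose_spec {G B P : ℕ} (hG : 8 ≤ G) (hB : 8 ≤ B) (hP : 8 ≤ P) (hBP : B ≠ P)
    (hBG : B ≠ G) (hPG : P ≠ G) {m : Mem} (h : p.Ready m) {val : ℕ}
    (hg : IsGross p.N p.s (mat p.N (m G)) (val + 1)) {m' : Mem}
    (h0 : m' G = m G) (h1 : m' B = (path G B P).run m B)
    (h2 : m' P = (path G B P).run m P) (h3 : m' 1 = m 1) :
    IsPath p.N p.s (mat p.N (m G)) (m' B) (m' P 0) ∧
      IsGross p.N p.s (mat p.N ((pull G B P).run m' G)) val ∧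
      ∀ u < p.N, ∀ v < p.N, arcUse (m' B) (m' P 0) u v + mat p.N ((pull G B P).run m' G) u v =
        mat p.N (m G) u v := by
  have hps := path_spec (A := G) hG hB hP hBP h.N h.s p.s_lt_N
  rcases hps with ⟨_, S, hS, hS0⟩ | ⟨hne, hp⟩
  · exact absurd hS0 (hg.not_closed (by omega) hS)
  rw [← h1, ← h2] at hp
  have hp' : IsPath p.N p.s (mat p.N (m' G)) (m' B) (m' P 0) := by rw [h0]; exact hp
  have hpull := pull_spec hG hB hP hBG hPG (m := m') (N := p.N) (by rw [h3, h.N]) hp'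
  refine ⟨hp, ?_, fun u hu v hv => ?_⟩
  · refine (hp'.pullPath_isGross ?_).congr hpull
    rw [h0]; exact hg
  · have := hp'.pullPath_add (i := m' P 0 - 1) (by have := hp'.pos; omega) u v
    rw [hpull u hu v hv, arcUse, add_comm, this, h0]

/-- The invariant of the decomposition into routes. -/
structure Params.Routed (p : Params) (x : ℕ) (T : Finset ℕ) (g1 g2 : ℕ → ℕ → ℕ) (pre : List ℕ)
    (rs : List Rec) (m : Mem) (v1 v2 : ℕ) : Prop where
  ok : ∀ r ∈ rs, p.RecOk x T r
  gross1 : IsGross p.N p.s (mat p.N (m aG1)) v1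
  gross2 : IsGross p.N p.s (mat p.N (m aG2)) v2
  use1 : ∀ u < p.N, ∀ v < p.N,
    (rs.map fun r => arcUse r.PB r.lp u v).sum + mat p.N (m aG1) u v = g1 u v
  use2 : ∀ u < p.N, ∀ v < p.N,
    (rs.map fun r => arcUse r.QB r.lq u v).sum + mat p.N (m aG2) u v = g2 u v
  out : outL m = pre ++ (rs.map (p.block x)).flatten

theorem route_writes : ∀ a ∈ route.writes,
    2 ≤ a ∧ a ≤ 7 ∨ a = 10 ∨ a = 11 ∨ 29 ≤ a ∧ a ≤ 36 := by decide

theorem route_spec {m : Mem} (h : p.Ready m) {x : ℕ} (hx : m aPOS 0 = x) {T : Finset ℕ}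
    {g1 g2 : ℕ → ℕ → ℕ}
    (hg1 : ∀ u < p.N, ∀ v < p.N, g1 u v ≤ p.capF x (p.rvP x T) u v)
    (hg2 : ∀ u < p.N, ∀ v < p.N, g2 u v ≤ p.capF x (p.rvD x) u v)
    {pre : List ℕ} {rs : List Rec} {v1 v2 : ℕ} (hr : p.Routed x T g1 g2 pre rs m (v1 + 1) (v2 + 1)) :
    ∃ r, p.Routed x T g1 g2 pre (rs ++ [r]) (route.run m) v1 v2 := by
  rw [route]
  simp only [run_seq]
  set m1 := (path aG1 aPB aLP).run m with hm1
  have f1 : ∀ a, a ≤ 1 ∨ 12 ≤ a → m1 a = m a := fun a ha =>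
    run_frame _ (by simp [path_writes]; omega) m
  have r1 : p.Ready m1 := h.frame (f1 0 (by omega)) (f1 1 (by omega)) (f1 15 (by omega))
  set m2 := (path aG2 aQB aLQ).run m1 with hm2
  have f2 : ∀ a, a ≤ 1 ∨ 8 ≤ a → a ≠ 31 → a ≠ 32 → m2 a = m1 a := fun a ha h31 h32 =>
    run_frame _ (by simp [path_writes]; omega) m1
  have r2 : p.Ready m2 := r1.frame (f2 0 (by omega) (by omega) (by omega))
    (f2 1 (by omega) (by omega) (by omega)) (f2 15 (by omega) (by omega) (by omega))
  have d1 := decompose_spec (G := 29) (B := 10) (P := 11) (by omega) (by omega) (by omega) (by omega)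
    (by omega) (by omega) h hr.gross1 (m' := m2)
    (by rw [f2 29 (by omega) (by omega) (by omega), f1 29 (by omega)])
    (by rw [f2 10 (by omega) (by omega) (by omega)])
    (by rw [f2 11 (by omega) (by omega) (by omega)])
    (by rw [f2 1 (by omega) (by omega) (by omega), f1 1 (by omega)])
  set m3 := (pull aG1 aPB aLP).run m2 with hm3
  have f3 : ∀ a, a ≠ 6 → a ≠ 29 → m3 a = m2 a := fun a _ _ =>
    run_frame _ (by simp [pull_writes]; omega) m2
  have r3 : p.Ready m3 := r2.frame (f3 0 (by omega) (by omega)) (f3 1 (by omega) (by omega))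
    (f3 15 (by omega) (by omega))
  have hgr2 : IsGross p.N p.s (mat p.N (m1 30)) (v2 + 1) := by rw [f1 30 (by omega)]; exact hr.gross2
  have d2 := decompose_spec (G := 30) (B := 31) (P := 32) (by omega) (by omega) (by omega) (by omega)
    (by omega) (by omega) r1 hgr2 (m' := m3)
    (by rw [f3 30 (by omega) (by omega), f2 30 (by omega) (by omega) (by omega)])
    (by rw [f3 31 (by omega) (by omega)]) (by rw [f3 32 (by omega) (by omega)])
    (by rw [f3 1 (by omega) (by omega), f2 1 (by omega) (by omega) (by omega)])
  rw [f1 30 (by omega)] at d2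
  set m4 := (pull aG2 aQB aLQ).run m3 with hm4
  have f4 : ∀ a, a ≠ 6 → a ≠ 30 → m4 a = m3 a := fun a _ _ =>
    run_frame _ (by simp [pull_writes]; omega) m3
  have r4 : p.Ready m4 := r3.frame (f4 0 (by omega) (by omega)) (f4 1 (by omega) (by omega))
    (f4 15 (by omega) (by omega))
  set m5 := hub.run m4 with hm5
  have f5 : ∀ a, a ≠ 6 → a ≠ 7 → a ≠ 33 → a ≠ 34 → m5 a = m4 a := fun a _ _ _ _ =>
    run_frame _ (by simp [hub, writes]; omega) m4
  have r5 : p.Ready m5 := r4.frame (f5 0 (by omega) (by omega) (by omega) (by omega))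
    (f5 1 (by omega) (by omega) (by omega) (by omega))
    (f5 15 (by omega) (by omega) (by omega) (by omega))
  clear_value m5 m4 m3 m2 m1
  set r : Rec := ⟨m2 10, m3 31, m2 11 0, m3 32 0, m5 33 0, m5 34 0⟩ with hrd
  obtain ⟨p1, q1, u1⟩ := d1
  obtain ⟨p2, q2, u2⟩ := d2
  have e10 : m4 10 = m2 10 := by rw [f4 10 (by omega) (by omega), f3 10 (by omega) (by omega)]
  have e11 : m4 11 = m2 11 := by rw [f4 11 (by omega) (by omega), f3 11 (by omega) (by omega)]
  have e31 : m4 31 = m3 31 := f4 31 (by omega) (by omega)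
  have e32 : m4 32 = m3 32 := f4 32 (by omega) (by omega)
  -- The remaining flow is part of the original one, which respects the capacities; so its arcs are
  -- arcs of the network.
  have P1 : IsPath p.N p.s (p.capF x (p.rvP x T)) (m2 10) (m2 11 0) := p1.mono fun u hu v hv => by
    have := hr.use1 u hu v hv; have := hg1 u hu v hv; omega
  have P2 : IsPath p.N p.s (p.capF x (p.rvD x)) (m3 31) (m3 32 0) := p2.mono fun u hu v hv => by
    have := hr.use2 u hu v hv; have := hg2 u hu v hv; omega
  have hub := hub_spec (m := m4) (N := p.N) (lp := m2 11 0) (lq := m3 32 0) r4.N (by rw [e11])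
    (by rw [e32]) P1.le P2.le (Params.path_shape P1).1 (Params.path_shape P2).1
    (by rw [e10, e31, P1.last, P2.last])
  rw [← hm5, e10, e31] at hub
  obtain ⟨b1, b2, b3, b4, b5, b6⟩ := hub
  have rok : p.RecOk x T r := ⟨P1, P2, b1, b2, b3, b4, b5, b6⟩
  have hout := emitRoute_spec (m := m5) (r := r) (x := x) r5
    (by rw [f5 17 (by omega) (by omega) (by omega) (by omega), f4 17 (by omega) (by omega),
      f3 17 (by omega) (by omega), f2 17 (by omega) (by omega) (by omega), f1 17 (by omega), hx])
    (by rw [f5 10 (by omega) (by omega) (by omega) (by omega), e10])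
    (by rw [f5 11 (by omega) (by omega) (by omega) (by omega), e11])
    (by rw [f5 31 (by omega) (by omega) (by omega) (by omega), e31]) rfl rfl P1.le
    (b2.le.trans P1.le) (b4.le.trans P2.le)
  have f6 : ∀ a, a ≠ 6 → a ≠ 35 → a ≠ 36 → emitRoute.run m5 a = m5 a := fun a h6 h35 h36 =>
    emitRoute_frame m5 h6 h35 h36
  have e29 : emitRoute.run m5 29 = m3 29 := by
    rw [f6 29 (by omega) (by omega) (by omega), f5 29 (by omega) (by omega) (by omega) (by omega),
      f4 29 (by omega) (by omega)]
  have e30 : emitRoute.run m5 30 = m4 30 := by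
    rw [f6 30 (by omega) (by omega) (by omega), f5 30 (by omega) (by omega) (by omega) (by omega)]
  refine ⟨r, ?_, ?_, ?_, ?_, ?_, ?_⟩
  · intro r' hr'
    rcases List.mem_append.mp hr' with hr' | hr'
    · exact hr.ok r' hr'
    · rw [List.mem_singleton.mp hr']; exact rok
  · rw [e29]; exact q1
  · rw [e30]; exact q2
  · intro u hu v hv
    have a1 := hr.use1 u hu v hv
    have a2 := u1 u hu v hv
    rw [e29, List.map_append, List.sum_append, List.map_singleton, List.sum_singleton]
    change _ + arcUse (m2 10) (m2 11 0) u v + _ = _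
    omega
  · intro u hu v hv
    have a1 := hr.use2 u hu v hv
    have a2 := u2 u hu v hv
    rw [e30, List.map_append, List.sum_append, List.map_singleton, List.sum_singleton]
    change _ + arcUse (m3 31) (m3 32 0) u v + _ = _
    omega
  · have e5 : outL m5 = outL m := by
      refine outL_congr ?_ ?_
      · rw [f5 35 (by omega) (by omega) (by omega) (by omega), f4 35 (by omega) (by omega),
          f3 35 (by omega) (by omega), f2 35 (by omega) (by omega) (by omega), f1 35 (by omega)]
      · rw [f5 36 (by omega) (by omega) (by omega) (by omega), f4 36 (by omega) (by omega),
          f3 36 (by omega) (by omega), f2 36 (by omega) (by omega) (by omega), f1 36 (by omega)]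
    rw [hout, e5, hr.out]
    simp

/-- The announced count is at most both flow values, so neither decomposition runs out of paths. The
arcs pulled so far and the flow left over always add up to the original flows. -/
theorem output_spec {m : Mem} (h : p.Ready m) {x : ℕ} (hx : m aPOS 0 = x) {T : Finset ℕ} {v1 v2 : ℕ}
    (h1 : p.IsFlow (p.capF x (p.rvP x T)) (mat p.N (m aG1)) v1)
    (h2 : p.IsFlow (p.capF x (p.rvD x)) (mat p.N (m aG2)) v2)
    (hv1 : m aBC 0 ≤ v1) (hv2 : m aBC 0 ≤ v2) (hK : m aBC 0 ≤ p.K) :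
    ∃ rs : List Rec, rs.length = m aBC 0 ∧ (∀ r ∈ rs, p.RecOk x T r) ∧
      (∀ u < p.N, ∀ v < p.N, (rs.map fun r => arcUse r.PB r.lp u v).sum ≤ mat p.N (m aG1) u v) ∧
      (∀ u < p.N, ∀ v < p.N, (rs.map fun r => arcUse r.QB r.lq u v).sum ≤ mat p.N (m aG2) u v) ∧
      outL (output.run m) = (List.range p.n).map (fun v => 1 - (1 - m aBT v)) ++ [m aBC 0] ++
        (rs.map (p.block x)).flatten := by
  rw [output]
  simp only [run_seq]
  set m1 := (Cmd.set aOL 0 0).run m with hm1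
  have f1 : ∀ a, a ≠ 36 → m1 a = m a := fun a ha => Mem.set_ne _ _ _ ha
  have o1 : outL m1 = [] := by simp [outL, hm1, Mem.set_apply]
  have r1 : p.Ready m1 := h.frame (f1 0 (by omega)) (f1 1 (by omega)) (f1 15 (by omega))
  have key1 := run_loop_inv (x := xA) (p := 0) (m := m1) (c := emit (1 - (1 - .read aBT (var xA))))
    (fun i m' => outL m' = (List.range i).map (fun v => 1 - (1 - m aBT v)))
    (fun i m' v h => by
      rw [outL_congr (Mem.set_ne _ _ _ (by omega)) (Mem.set_ne _ _ _ (by omega))]; exact h)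
    (by simp [o1]) (by
      intro i m' hi hx hf ih
      have : m' 27 = m 27 := by rw [hf 27 (by simp [writes, emit]), f1 27 (by omega)]
      rw [outL_emit, ih, List.range_succ, List.map_append]
      simp [this, hx])
  rw [r1.n] at key1
  set m2 := (Cmd.loop xA 0 (emit (1 - (1 - .read aBT (var xA))))).run m1 with hm2
  have f2 : ∀ a, a ≠ 6 → a ≠ 35 → a ≠ 36 → m2 a = m a := fun a _ h35 h36 => by
    rw [← f1 a h36]; exact run_frame _ (by simp [writes, emit]; omega) m1
  set m3 := (emit (var aBC)).run m2 with hm3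
  have f3 : ∀ a, a ≠ 6 → a ≠ 35 → a ≠ 36 → m3 a = m a := fun a h6 h35 h36 => by
    rw [hm3, emit_frame _ _ h35 h36, f2 a h6 h35 h36]
  set pre := (List.range p.n).map (fun v => 1 - (1 - m aBT v)) ++ [m aBC 0] with hpre
  have o3 : outL m3 = pre := by
    have e26 : m2 26 = m 26 := f2 26 (by omega) (by omega) (by omega)
    rw [hm3, outL_emit, key1, hpre]
    simp [e26]
  have r3 : p.Ready m3 := h.frame (f3 0 (by omega) (by omega) (by omega))
    (f3 1 (by omega) (by omega) (by omega)) (f3 15 (by omega) (by omega) (by omega))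
  have e29 := f3 29 (by omega) (by omega) (by omega)
  have e30 := f3 30 (by omega) (by omega) (by omega)
  have key := run_loop_inv (x := xC) (p := 3) (m := m3) (c := .ite (var aBC - var xC) route .skip)
    (fun i m' => ∃ rs : List Rec, rs.length = min i (m aBC 0) ∧
      p.Routed x T (mat p.N (m aG1)) (mat p.N (m aG2)) pre rs m'
        (v1 - min i (m aBC 0)) (v2 - min i (m aBC 0)))
    (fun i m' v ⟨rs, hl, h⟩ => ⟨rs, hl, h.ok, by
      rw [Mem.set_ne _ _ _ (by omega)]; exact h.gross1, by
      rw [Mem.set_ne _ _ _ (by omega)]; exact h.gross2, by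
      rw [Mem.set_ne _ _ _ (by omega)]; exact h.use1, by
      rw [Mem.set_ne _ _ _ (by omega)]; exact h.use2, by
      rw [outL_congr (Mem.set_ne _ _ _ (by omega)) (Mem.set_ne _ _ _ (by omega))]; exact h.out⟩)
    ⟨[], by simp, by simp, by simpa [e29] using h1.gross, by simpa [e30] using h2.gross,
      by simp [e29], by simp [e30], by simp [o3]⟩ (by
      rintro i m4 hi hxi hf ⟨rs, hl, hr⟩
      have f4 : ∀ a, a = 0 ∨ a = 1 ∨ a = 15 ∨ a = 17 ∨ a = 26 → m4 a = m a := fun a ha => by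
        rw [← f3 a (by omega) (by omega) (by omega)]
        refine hf a (fun hc => ?_)
        simp only [writes, List.append_nil, List.mem_cons] at hc
        rcases hc with hc | hc
        · omega
        · have := route_writes a hc; omega
      have r4 : p.Ready m4 := h.frame (f4 0 (by omega)) (f4 1 (by omega)) (f4 15 (by omega))
      have e26 := f4 26 (by omega)
      by_cases c : i < m aBC 0
      · rw [run_ite_pos (by simp [e26, hxi]; omega)]
        rw [min_eq_left c.le] at hr hl
        rw [min_eq_left (by omega : i + 1 ≤ m aBC 0)]
        rw [show v1 - i = v1 - (i + 1) + 1 by omega, show v2 - i = v2 - (i + 1) + 1 by omega] at hr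
        obtain ⟨r, hr'⟩ := route_spec r4 (by rw [f4 17 (by omega), hx]) h1.le h2.le hr
        exact ⟨rs ++ [r], by simp [hl], hr'⟩
      · rw [run_ite_neg (by simp [e26, hxi]; omega), run_skip]
        rw [min_eq_right (by omega)] at hr hl ⊢
        exact ⟨rs, hl, hr⟩)
  rw [r3.K, min_eq_right hK] at key
  obtain ⟨rs, hl, hr⟩ := key
  refine ⟨rs, hl, hr.ok, fun u hu v hv => ?_, fun u hu v hv => ?_, hr.out⟩
  · have := hr.use1 u hu v hv; omega
  · have := hr.use2 u hu v hv; omega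

end Middlebox

namespace Middlebox

/-! ## The parameters of an instance -/

section Encoding

variable {α : Type*}

theorem length_flatMap_eq {f : α → List ℕ} {k : ℕ} (hf : ∀ x, (f x).length = k) (l : List α) :
    (l.flatMap f).length = l.length * k := by
  induction l with
  | nil => simp
  | cons x l ih => simp [ih, hf, Nat.succ_mul, Nat.add_comm]

/-- Blocks of a common length make positions in the encoding arithmetic; used twice, it locates the
entries of the capacity matrix. -/
theorem getD_flatMap_eq {f : α → List ℕ} {k : ℕ} (hf : ∀ x, (f x).length = k) {l : List α} {i j : ℕ}
    (hi : i < l.length) (hj : j < k) : (l.flatMap f).getD (k * i + j) 0 = (f l[i]).getD j 0 := by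
  induction l generalizing i with
  | nil => simp at hi
  | cons x l ih =>
    rw [List.flatMap_cons]
    cases i with
    | zero =>
      rw [List.getD_append _ _ _ _ (by rw [hf]; omega)]
      simp
    | succ i =>
      rw [List.getD_append_right _ _ _ _ (by rw [hf, Nat.mul_succ]; omega), hf,
        show k * (i + 1) + j - k = k * i + j by rw [Nat.mul_succ]; omega,
        ih (by simpa using hi)]
      simp

theorem getD_flatMap_finRange {n k : ℕ} {f : Fin n → List ℕ} (hf : ∀ x, (f x).length = k)
    (i : Fin n) {j : ℕ} (hj : j < k) :
    ((List.finRange n).flatMap f).getD (k * i + j) 0 = (f i).getD j 0 := by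
  rw [getD_flatMap_eq hf (by simp) hj]
  simp

end Encoding

namespace Instance

variable (I : Instance)

/-- A bound on the number of summands of a cut. -/
def cutSize : ℕ := (I.n + I.numDemands + 1) * (I.n + I.numDemands + 1)

/-- The factor 20 makes the rounding loss, at most `cutSize + 1` units, a twentieth of a target of
at least `L` units. -/
def unitL : ℕ := 20 * (I.cutSize + 1)

def inp (i : ℕ) : ℕ := I.encode.getD i 0

theorem caps_length : ((List.finRange I.n).flatMap (fun u =>
    (List.finRange I.n).flatMap fun v => encodeRat (I.cap s(u, v)))).length = 2 * (I.n * I.n) := by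
  rw [length_flatMap_eq (k := I.n * 2) fun u => by
    rw [length_flatMap_eq (k := 2) fun _ => rfl, List.length_finRange]]
  simp; ring

theorem procs_length : ((List.finRange I.n).flatMap (fun v => encodeRat (I.proc v))).length =
    2 * I.n := by
  rw [length_flatMap_eq (k := 2) fun _ => rfl]; simp [mul_comm]

theorem prices_length : ((List.finRange I.n).flatMap (fun v => encodeRat (I.price v))).length =
    2 * I.n := by
  rw [length_flatMap_eq (k := 2) fun _ => rfl]; simp [mul_comm]

theorem encode_length : I.encode.length =
    4 + 2 * (I.n * I.n) + 4 * I.n + 3 * I.numDemands := by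
  rw [encode]
  simp only [List.length_append, caps_length, procs_length, prices_length]
  rw [length_flatMap_eq (k := 3) fun _ => rfl]
  simp; ring

theorem inp_caps {i : ℕ} (hi : i < 2 * (I.n * I.n)) : I.inp (4 + i) =
    ((List.finRange I.n).flatMap (fun u =>
      (List.finRange I.n).flatMap fun v => encodeRat (I.cap s(u, v)))).getD i 0 := by
  have h := I.caps_length
  rw [inp, encode, List.getD_append, List.getD_append, List.getD_append, List.getD_append_right]
  · simp
  · simp
  all_goals simp only [List.length_append, h, procs_length, prices_length, List.length_cons,
    List.length_nil]; omega

theorem inp_procs {i : ℕ} (hi : i < 2 * I.n) : I.inp (4 + 2 * (I.n * I.n) + i) =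
    ((List.finRange I.n).flatMap (fun v => encodeRat (I.proc v))).getD i 0 := by
  have h := I.caps_length
  rw [inp, encode, List.getD_append, List.getD_append, List.getD_append_right]
  · congr 1
    simp only [List.length_append, h, List.length_cons, List.length_nil]; omega
  all_goals simp only [List.length_append, h, procs_length, prices_length, List.length_cons,
    List.length_nil]; omega

theorem inp_prices {i : ℕ} (hi : i < 2 * I.n) : I.inp (4 + 2 * (I.n * I.n) + 2 * I.n + i) =
    ((List.finRange I.n).flatMap (fun v => encodeRat (I.price v))).getD i 0 := by
  have h := I.caps_length
  rw [inp, encode, List.getD_append, List.getD_append_right]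
  · congr 1
    simp only [List.length_append, h, procs_length, List.length_cons, List.length_nil]; omega
  all_goals simp only [List.length_append, h, procs_length, prices_length, List.length_cons,
    List.length_nil]; omega

theorem inp_demands {i : ℕ} : I.inp (4 + 2 * (I.n * I.n) + 4 * I.n + i) =
    ((List.finRange I.numDemands).flatMap
        (fun i => (I.sink i : ℕ) :: encodeRat (I.demand i))).getD i 0 := by
  have h := I.caps_length
  rw [inp, encode, List.getD_append_right]
  · congr 1
    simp only [List.length_append, h, procs_length, prices_length, List.length_cons,
      List.length_nil]; omega
  all_goals simp only [List.length_append, h, procs_length, prices_length, List.length_cons,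
    List.length_nil]; omega

/-- Position `i` holds the nonnegative rational `x`. -/
def HasRat (i : ℕ) (x : ℚ≥0) : Prop := I.inp i = x.num ∧ I.inp (i + 1) = x.den

theorem hasRat_cap (u v : Fin I.n) : I.HasRat (4 + 2 * (u * I.n + v)) (I.cap s(u, v)) := by
  have key : ∀ j < 2, I.inp (4 + 2 * (u * I.n + v) + j) = (encodeRat (I.cap s(u, v))).getD j 0 := by
    intro j hj
    have hu := u.2
    have hv := v.2
    have : (u : ℕ) * I.n + I.n ≤ I.n * I.n := by
      rw [← Nat.succ_mul]; exact Nat.mul_le_mul_right _ hu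
    rw [add_assoc, inp_caps _ (by omega),
      show 2 * ((u : ℕ) * I.n + v) + j = (I.n * 2) * u + (2 * v + j) by ring,
      getD_flatMap_finRange (fun u => by
        rw [length_flatMap_eq (k := 2) fun _ => rfl, List.length_finRange]) _ (by omega)]
    exact getD_flatMap_finRange (k := 2) (fun _ => rfl) _ hj
  exact ⟨key 0 (by omega), key 1 (by omega)⟩

theorem hasRat_proc (v : Fin I.n) : I.HasRat (4 + 2 * (I.n * I.n) + 2 * v) (I.proc v) := by
  have key : ∀ j < 2, I.inp (4 + 2 * (I.n * I.n) + 2 * v + j) =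
      (encodeRat (I.proc v)).getD j 0 := by
    intro j hj
    have hv := v.2
    rw [add_assoc, inp_procs _ (by omega)]
    exact getD_flatMap_finRange (k := 2) (fun _ => rfl) _ hj
  exact ⟨key 0 (by omega), key 1 (by omega)⟩

theorem hasRat_price (v : Fin I.n) :
    I.HasRat (4 + 2 * (I.n * I.n) + 2 * I.n + 2 * v) (I.price v) := by
  have key : ∀ j < 2, I.inp (4 + 2 * (I.n * I.n) + 2 * I.n + 2 * v + j) =
      (encodeRat (I.price v)).getD j 0 := by
    intro j hj
    have hv := v.2
    rw [add_assoc, inp_prices _ (by omega)]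
    exact getD_flatMap_finRange (k := 2) (fun _ => rfl) _ hj
  exact ⟨key 0 (by omega), key 1 (by omega)⟩

theorem inp_demPos (i : Fin I.numDemands) {j : ℕ} (hj : j < 3) :
    I.inp (4 + 2 * (I.n * I.n) + 4 * I.n + 3 * i + j) =
      ((I.sink i : ℕ) :: encodeRat (I.demand i)).getD j 0 := by
  rw [add_assoc, inp_demands]
  exact getD_flatMap_finRange (k := 3) (fun _ => rfl) _ hj

theorem inp_sink (i : Fin I.numDemands) :
    I.inp (4 + 2 * (I.n * I.n) + 4 * I.n + 3 * i) = I.sink i := I.inp_demPos i (j := 0) (by omega)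

theorem hasRat_demand (i : Fin I.numDemands) :
    I.HasRat (4 + 2 * (I.n * I.n) + 4 * I.n + 3 * i + 1) (I.demand i) :=
  ⟨I.inp_demPos i (j := 1) (by omega), I.inp_demPos i (j := 2) (by omega)⟩

/-- The relevant minimum cut is at most `cutSize` times the reference number, hence at most `cutSize
* unitL` units; this explains the truncation `K`. -/
def params : Params where
  inp := I.inp
  n := I.n
  d := I.numDemands
  s := I.source
  K := I.cutSize * I.unitL
  L := I.unitL
  s_lt := I.source.2
  sink_lt := fun i hi => by rw [I.inp_sink ⟨i, hi⟩]; exact (I.sink _).2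

theorem n_pos : 0 < I.n := I.source.pos

/-- The vertex with a given number. -/
def vtx (a : ℕ) : Fin I.n := ⟨a % I.n, Nat.mod_lt _ I.n_pos⟩

theorem vtx_val {a : ℕ} (h : a < I.n) : (I.vtx a : ℕ) = a := Nat.mod_eq_of_lt h

theorem vtx_coe (v : Fin I.n) : I.vtx v = v := Fin.ext (I.vtx_val v.2)

/-- The word is the denominator of the capacity at the pair of the vertices `(0, 0)`, which is
encoded although it plays no role. It makes position 4 an admissible initial reference for the
search. -/
theorem inp_five : I.params.inp 5 ≠ 0 := by
  have h := (I.hasRat_cap ⟨0, I.n_pos⟩ ⟨0, I.n_pos⟩).2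
  simp only [zero_mul, add_zero, mul_zero] at h
  change I.inp 5 ≠ 0
  rw [h]
  exact NNRat.den_ne_zero _

end Instance

/-! ## Rounding -/

namespace Params

variable (p : Params)

/-- The rational number at position `i`. -/
noncomputable def ratio (i : ℕ) : ℝ := (p.inp i : ℝ) / p.inp (i + 1)

theorem ratio_nonneg (i : ℕ) : 0 ≤ p.ratio i := by unfold ratio; positivity

variable {p}

/-- Rounding down never exceeds the true number. In the degenerate cases a division by zero gives 0,
so the bound needs no assumption and covers all reference positions. -/
theorem scaled_mul_le (x i : ℕ) : (p.scaled x i : ℝ) * (p.ratio x / p.L) ≤ p.ratio i := by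
  rcases Nat.eq_zero_or_pos (p.inp (i + 1) * p.inp x) with h | h
  · simp [scaled, h, p.ratio_nonneg]
  rcases Nat.eq_zero_or_pos (p.inp (x + 1) * p.L) with h' | h'
  · simp [scaled, h', p.ratio_nonneg]
  have key : p.scaled x i * (p.inp (i + 1) * p.inp x) ≤ p.inp i * (p.inp (x + 1) * p.L) :=
    Nat.div_mul_le_self _ _
  have key' : (p.scaled x i : ℝ) * (p.inp (i + 1) * p.inp x) ≤ p.inp i * (p.inp (x + 1) * p.L) := by
    exact_mod_cast key
  have h1 : (0 : ℝ) < p.inp (i + 1) := by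
    exact_mod_cast Nat.pos_of_ne_zero fun h0 => by simp [h0] at h
  have h2 : (0 : ℝ) < p.inp (x + 1) * p.L := by exact_mod_cast h'
  unfold ratio
  rw [le_div_iff₀ h1, div_div, mul_assoc, div_mul_eq_mul_div, ← mul_div_assoc, div_le_iff₀ h2]
  linarith

theorem lt_scaled_add_one {x i : ℕ} (hi : p.inp (i + 1) ≠ 0) (hx : p.inp x ≠ 0)
    (hx' : p.inp (x + 1) ≠ 0) (hL : p.L ≠ 0) :
    p.ratio i < ((p.scaled x i : ℝ) + 1) * (p.ratio x / p.L) := by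
  have h : 0 < p.inp (i + 1) * p.inp x := Nat.pos_of_ne_zero (mul_ne_zero hi hx)
  have key := Nat.lt_div_mul_add (a := p.inp i * (p.inp (x + 1) * p.L)) h
  rw [← Nat.succ_mul] at key
  have key' : (p.inp i : ℝ) * (p.inp (x + 1) * p.L) <
      ((p.scaled x i : ℝ) + 1) * (p.inp (i + 1) * p.inp x) := by
    exact_mod_cast key
  have h1 : (0 : ℝ) < p.inp (i + 1) := by exact_mod_cast Nat.pos_of_ne_zero hi
  have h2 : (0 : ℝ) < p.inp (x + 1) * p.L := by
    exact_mod_cast Nat.pos_of_ne_zero (mul_ne_zero hx' hL)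
  unfold ratio
  rw [div_lt_iff₀ h1, div_div, mul_assoc, div_mul_eq_mul_div, ← mul_div_assoc, lt_div_iff₀ h2]
  linarith

end Params

theorem Instance.HasRat.ratio {I : Instance} {i : ℕ} {x : ℚ≥0} (h : I.HasRat i x) :
    I.params.ratio i = x := by
  rw [Params.ratio]
  change ((I.inp i : ℕ) : ℝ) / (I.inp (i + 1) : ℕ) = x
  rw [h.1, h.2, NNRat.cast_def]

theorem Instance.HasRat.den_ne_zero {I : Instance} {i : ℕ} {x : ℚ≥0} (h : I.HasRat i x) :
    I.params.inp (i + 1) ≠ 0 := by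
  change I.inp (i + 1) ≠ 0
  rw [h.2]; exact x.den_ne_zero

end Middlebox

namespace Middlebox

/-! ## Routes from paths -/

/-- The walk that visits the values of `f` in turn. -/
theorem exists_walk {V : Type*} {G : SimpleGraph V} {f : ℕ → V} {k : ℕ}
    (h : ∀ i < k, G.Adj (f i) (f (i + 1))) : ∃ w : G.Walk (f 0) (f k),
      w.support = (List.range (k + 1)).map f ∧
      w.edges = (List.range k).map fun i => s(f i, f (i + 1)) := by
  induction k with
  | zero => exact ⟨.nil, by simp, by simp⟩
  | succ k ih =>
    obtain ⟨w, h1, h2⟩ := ih fun i hi => h i (by omega)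
    refine ⟨w.concat (h k (by omega)), ?_, ?_⟩
    · rw [SimpleGraph.Walk.support_concat, h1, List.range_succ (n := k + 1), List.map_append]
      rfl
    · rw [SimpleGraph.Walk.edges_concat, h2, List.range_succ (n := k), List.map_append,
        List.concat_eq_append]
      rfl

/-- A walk through three sequences of vertices. -/
theorem exists_walk_append {V : Type*} {G : SimpleGraph V} {f g h : ℕ → V} {a b c : ℕ}
    (hf : ∀ i < a, G.Adj (f i) (f (i + 1))) (hg : ∀ i < b, G.Adj (g i) (g (i + 1)))
    (hh : ∀ i < c, G.Adj (h i) (h (i + 1))) (hfg : f a = g 0) (hgh : g b = h 0) {s t : V}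
    (hs : f 0 = s) (ht : h c = t) : ∃ w : G.Walk s t,
      w.support = (List.range (a + 1)).map f ++ ((List.range b).map (fun i => g (i + 1)) ++
        (List.range c).map fun i => h (i + 1)) ∧
      w.edges = (List.range a).map (fun i => s(f i, f (i + 1))) ++
        ((List.range b).map (fun i => s(g i, g (i + 1))) ++
          (List.range c).map fun i => s(h i, h (i + 1))) := by
  subst hs ht
  obtain ⟨w1, s1, e1⟩ := exists_walk hf
  obtain ⟨w2, s2, e2⟩ := exists_walk hg
  obtain ⟨w3, s3, e3⟩ := exists_walk hh
  have tl : ∀ (k : ℕ) (φ : ℕ → V), ((List.range (k + 1)).map φ).tail =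
      (List.range k).map fun i => φ (i + 1) := by
    intro k φ
    rw [List.range_succ_eq_map]; simp [Function.comp_def]
  refine ⟨w1.append ((w2.copy hfg.symm rfl).append (w3.copy hgh.symm rfl)), ?_, ?_⟩
  · rw [SimpleGraph.Walk.support_append, SimpleGraph.Walk.tail_support_append]
    simp only [SimpleGraph.Walk.support_copy, s1, s2, s3, tl]
  · simp only [SimpleGraph.Walk.edges_append, SimpleGraph.Walk.edges_copy, e1, e2, e3]

theorem count_map_range {α : Type*} [DecidableEq α] (f : ℕ → α) (a : α) (k : ℕ) :
    ((List.range k).map f).count a = ∑ i ∈ Finset.range k, if f i = a then 1 else 0 := by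
  induction k with
  | zero => simp
  | succ k ih =>
    rw [List.range_succ, List.map_append, List.count_append, ih, Finset.sum_range_succ]
    simp [List.count_singleton]

namespace Instance

variable {I : Instance}

theorem adj_of_scaled_ne_zero {x a b : ℕ} (ha : a < I.n) (hb : b < I.n) (hab : a ≠ b)
    (h : I.params.scaled x (I.params.capPos a b) ≠ 0) : I.graph.Adj (I.vtx a) (I.vtx b) := by
  refine ⟨fun e => hab ?_, ?_⟩
  · have := congrArg Fin.val e
    rwa [I.vtx_val ha, I.vtx_val hb] at this
  · have hr := I.hasRat_cap (I.vtx a) (I.vtx b)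
    rw [I.vtx_val ha, I.vtx_val hb] at hr
    rw [pos_iff_ne_zero]
    intro h0
    refine h ?_
    have : I.params.inp (I.params.capPos a b) = 0 := by
      change I.inp (4 + 2 * (a * I.n + b)) = 0
      rw [hr.1, h0]; rfl
    simp [Params.scaled, this]

/-- The edges of a sequence that follows a path, each step in either direction. -/
theorem count_edges_le {b : ℕ → ℕ} {l k : ℕ} {φ : ℕ → Sym2 (Fin I.n)} {g : ℕ → ℕ}
    (hg : Set.InjOn g (Finset.range k)) (hgl : ∀ i < k, g i + 1 < l)
    (hb : ∀ i < k, b (g i) < I.n ∧ b (g i + 1) < I.n)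
    (hφ : ∀ i < k, φ i = s(I.vtx (b (g i + 1)), I.vtx (b (g i)))) (u v : Fin I.n) :
    ((List.range k).map φ).count s(u, v) ≤ arcUse b l u v + arcUse b l v u := by
  rw [count_map_range, arcUse, arcUse, ← Finset.sum_add_distrib]
  set F : ℕ → ℕ := fun j => (if (u : ℕ) = b (j + 1) ∧ (v : ℕ) = b j then 1 else 0) +
    if (v : ℕ) = b (j + 1) ∧ (u : ℕ) = b j then 1 else 0
  have h1 : ∀ i ∈ Finset.range k, (if φ i = s(u, v) then 1 else 0) ≤ F (g i) := by
    intro i hi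
    have hi : i < k := by simpa using hi
    split_ifs with h
    · rw [hφ i hi, Sym2.eq_iff] at h
      rcases h with ⟨h1, h2⟩ | ⟨h1, h2⟩
      · subst h1 h2
        simp only [F, I.vtx_val (hb i hi).1, I.vtx_val (hb i hi).2]; simp
      · subst h1 h2
        simp only [F, I.vtx_val (hb i hi).1, I.vtx_val (hb i hi).2]; simp
    · exact Nat.zero_le _
  refine (Finset.sum_le_sum h1).trans ?_
  rw [← Finset.sum_image (f := F) hg]
  refine Finset.sum_le_sum_of_subset fun j hj => ?_
  obtain ⟨i, hi, rfl⟩ := Finset.mem_image.mp hj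
  have := hgl i (by simpa using hi)
  simp only [Finset.mem_range]; omega

theorem nodup_map_range {φ : ℕ → Fin I.n} {k : ℕ} (h : ∀ i < k, ∀ j < k, φ i = φ j → i = j) :
    ((List.range k).map φ).Nodup :=
  List.Nodup.map_on (fun i hi j hj => h i (by simpa using hi) j (by simpa using hj)) List.nodup_range

/-- `R` is a route that follows the paths of `r`. -/
structure Follows (I : Instance) (x : ℕ) (r : Rec) (R : I.Route) : Prop where
  idx : r.QB 1 = I.n + (I.n + R.idx)
  node : r.PB 1 = I.n + R.node
  amount : R.amount = I.params.ratio x / (3 * I.params.L)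
  encodedBy : I.params.inp (x + 1) ≠ 0 → R.EncodedBy (I.params.block x r)
  two_walk : ∀ v, R.walk.support.count v ≤ 2
  node_mem : R.node ∈ R.walk.support
  edges : ∀ u v : Fin I.n, R.walk.edges.count s(u, v) ≤
    2 * (arcUse r.PB r.lp u v + arcUse r.PB r.lp v u) +
      (arcUse r.QB r.lq u v + arcUse r.QB r.lq v u)

/-- The terminals on the two paths tell the processing vertex and the demand pair, and the three
stretches join at the processing vertex and at the hub. -/
theorem exists_follows {x : ℕ} {T : Finset ℕ} (hT : T ⊆ Finset.range I.n) {r : Rec}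
    (h : I.params.RecOk x T r) : ∃ R : I.Route, I.Follows x r R := by
  obtain ⟨lp3, ⟨jp, hjp, pb1, rvp, pb2⟩, plt, parc⟩ := Params.path_shape h.pathP
  obtain ⟨lq3, ⟨jq, hjq, qb1, rvq, qb2⟩, qlt, qarc⟩ := Params.path_shape h.pathQ
  change jp < I.n + I.numDemands at hjp
  change jq < I.n + I.numDemands at hjq
  change r.PB 1 = I.n + jp at pb1
  change r.QB 1 = I.n + jq at qb1
  change ∀ i, 2 ≤ i → i < r.lp → r.PB i < I.n at plt
  change ∀ i, 2 ≤ i → i < r.lq → r.QB i < I.n at qlt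
  have hs2 := h.hs_ge
  have hsl := h.hs_lt
  have ms2 := h.ms_ge
  have msl := h.ms_lt
  have hjT : jp ∈ T := by
    by_contra hc
    simp [Params.rvP, hc] at rvp
  have jpn : jp < I.n := by simpa using hT hjT
  have jqn : I.n ≤ jq := by
    by_contra hc
    refine rvq ?_
    rw [Params.rvD, if_pos (by exact not_le.mp hc)]
  obtain ⟨i, rfl⟩ : ∃ i, jq = I.n + i := ⟨jq - I.n, by omega⟩
  have hi : i < I.numDemands := by omega
  have pb2' : r.PB 2 = jp := by
    rw [pb2, Params.att, if_pos (by exact jpn)]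
  have qb2' : r.QB 2 = I.sink ⟨i, hi⟩ := by
    rw [qb2, Params.att, if_neg (by change ¬ I.n + i < I.n; omega), ← I.inp_sink ⟨i, hi⟩]
    change I.inp (4 + 2 * (I.n * I.n) + 4 * I.n + 3 * (I.n + i - I.n)) = _
    rw [Nat.add_sub_cancel_left]
  have padj : ∀ i, 2 ≤ i → i + 1 < r.lp →
      I.graph.Adj (I.vtx (r.PB (i + 1))) (I.vtx (r.PB i)) := fun i h2 hl =>
    adj_of_scaled_ne_zero (plt _ (by omega) hl) (plt _ h2 (by omega))
      (fun e => by have := h.pathP.inj _ hl _ (by omega) e; omega) (parc i h2 hl)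
  have qadj : ∀ i, 2 ≤ i → i + 1 < r.lq →
      I.graph.Adj (I.vtx (r.QB (i + 1))) (I.vtx (r.QB i)) := fun i h2 hl =>
    adj_of_scaled_ne_zero (qlt _ (by omega) hl) (qlt _ h2 (by omega))
      (fun e => by have := h.pathQ.inj _ hl _ (by omega) e; omega) (qarc i h2 hl)
  have vinj : ∀ {a b : ℕ}, a < I.n → b < I.n → I.vtx a = I.vtx b → a = b := by
    intro a b ha hb e
    have := congrArg Fin.val e
    rwa [I.vtx_val ha, I.vtx_val hb] at this
  obtain ⟨w, ws, we⟩ := exists_walk_append (G := I.graph)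
    (f := fun i => I.vtx (r.PB (r.lp - (i + 1)))) (a := r.lp - 3)
    (g := fun i => I.vtx (r.PB (i + 2))) (b := r.hs - 2)
    (h := fun i => I.vtx (r.QB (r.ms - i))) (c := r.ms - 2) (s := I.source) (t := I.sink ⟨i, hi⟩)
    (fun i hi => by
      have := padj (r.lp - (i + 1 + 1)) (by omega) (by omega)
      rwa [show r.lp - (i + 1 + 1) + 1 = r.lp - (i + 1) by omega] at this)
    (fun i hi => (padj (i + 2) (by omega) (by omega)).symm)
    (fun i hi => by
      have := qadj (r.ms - (i + 1)) (by omega) (by omega)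
      rwa [show r.ms - (i + 1) + 1 = r.ms - i by omega] at this)
    (by congr 2; omega)
    (by
      rw [show r.hs - 2 + 2 = r.hs by omega, Nat.sub_zero, h.hub])
    (by
      simp only [zero_add]
      rw [h.pathP.last]; exact I.vtx_coe _)
    (by
      rw [show r.ms - (r.ms - 2) = 2 by omega, qb2', I.vtx_coe])
  rw [show r.lp - 3 + 1 = r.lp - 2 by omega] at ws
  -- The walk splits into two duplicate-free lists, the way out and everything after it; hence at
  -- most two visits to a vertex.
  have nd1 : ((List.range (r.lp - 2)).map fun i => I.vtx (r.PB (r.lp - (i + 1)))).Nodup :=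
    nodup_map_range fun i hi j hj e => by
      have := h.pathP.inj _ (by omega) _ (by omega) (vinj (plt _ (by omega) (by omega))
        (plt _ (by omega) (by omega)) e)
      omega
  have nd2 : ((List.range (r.hs - 2)).map (fun i => I.vtx (r.PB (i + 1 + 2))) ++
      (List.range (r.ms - 2)).map fun i => I.vtx (r.QB (r.ms - (i + 1)))).Nodup := by
    refine List.Nodup.append (nodup_map_range fun i hi j hj e => ?_)
      (nodup_map_range fun i hi j hj e => ?_) ?_
    · have := h.pathP.inj _ (by omega) _ (by omega) (vinj (plt _ (by omega) (by omega))
        (plt _ (by omega) (by omega)) e)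
      omega
    · have := h.pathQ.inj _ (by omega) _ (by omega) (vinj (qlt _ (by omega) (by omega))
        (qlt _ (by omega) (by omega)) e)
      omega
    -- A repetition would put a vertex of the way back on the end of `Q`. Before the hub this
    -- contradicts `first`; at the hub it contradicts simplicity, as the end of `Q` starts one step
    -- later.
    · intro a ha hb
      obtain ⟨i, hi, rfl⟩ := List.mem_map.mp ha
      obtain ⟨j, hj, e⟩ := List.mem_map.mp hb
      have hi : i < r.hs - 2 := by simpa using hi
      have hj : j < r.ms - 2 := by simpa using hj
      have e := vinj (qlt _ (by omega) (by omega)) (plt _ (by omega) (by omega)) e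
      by_cases c : i + 1 + 2 = r.hs
      · rw [c, h.hub] at e
        have := h.pathQ.inj _ (by omega) _ (by omega) e
        omega
      · exact h.first _ (by omega) (by omega) _ (by omega) (by omega) e.symm
  refine ⟨⟨⟨i, hi⟩, w, ⟨jp, jpn⟩, I.params.ratio x / (3 * I.params.L)⟩, qb1, pb1, rfl,
    fun hx => ⟨I.params.inp x, 3 * I.params.L * I.params.inp (x + 1), ?_, ?_, ?_⟩, fun v => ?_, ?_,
    fun u v => ?_⟩
  · have : 0 < I.params.L := Nat.mul_pos (by omega) (Nat.succ_pos _)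
    positivity
  · simp only [Params.ratio]
    push_cast
    rw [div_div, mul_comm (I.params.inp (x + 1) : ℝ)]
  · have e1 : r.QB 1 - 2 * I.n = i := by omega
    rw [Params.block]
    change [r.QB 1 - 2 * I.n, _, _, _, _] ++ _ = _
    simp only [ws, e1, pb2', Rec.walk]
    simp only [bind_pure_comp, List.map_eq_map, List.map_append, List.map_map]
    congr 1
    · simp [Nat.add_assoc]
    · congr 1
      · refine List.map_congr_left fun i hi => ?_
        have hi : i < r.lp - 2 := by simpa using hi
        exact (I.vtx_val (plt _ (by omega) (by omega))).symm
      congr 1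
      · refine List.map_congr_left fun i hi => ?_
        have hi : i < r.hs - 2 := by simpa using hi
        exact (I.vtx_val (plt _ (by omega) (by omega))).symm
      · refine List.map_congr_left fun i hi => ?_
        have hi : i < r.ms - 2 := by simpa using hi
        exact (I.vtx_val (qlt _ (by omega) (by omega))).symm
  · simp only [ws]
    rw [List.count_append]
    have := List.nodup_iff_count_le_one.mp nd1 v
    have := List.nodup_iff_count_le_one.mp nd2 v
    omega
  · simp only [ws]
    refine List.mem_append_left _ (List.mem_map.mpr ⟨r.lp - 3, by simp; omega, ?_⟩)
    rw [show r.lp - (r.lp - 3 + 1) = 2 by omega, pb2']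
    exact Fin.ext (I.vtx_val jpn)
  · simp only [we, List.count_append]
    -- `P` is charged for the way out and again for the way back, `Q` once. Within a stretch
    -- different steps are charged to different arcs of the stored path.
    have c1 := count_edges_le (I := I) (b := r.PB) (l := r.lp) (k := r.lp - 3)
      (φ := fun i => s(I.vtx (r.PB (r.lp - (i + 1))), I.vtx (r.PB (r.lp - (i + 1 + 1)))))
      (g := fun i => r.lp - (i + 1 + 1)) (fun i hi j hj e => by
        simp only [Finset.coe_range, Set.mem_Iio] at hi hj e; omega)
      (fun i hi => by omega)
      (fun i hi => ⟨plt _ (by omega) (by omega), plt _ (by omega) (by omega)⟩)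
      (fun i hi => by
          rw [show r.lp - (i + 1 + 1) + 1 = r.lp - (i + 1) by omega]) u v
    have c2 := count_edges_le (I := I) (b := r.PB) (l := r.lp) (k := r.hs - 2)
      (φ := fun i => s(I.vtx (r.PB (i + 2)), I.vtx (r.PB (i + 1 + 2))))
      (g := fun i => i + 2) (fun i hi j hj e => by
        simp only at e; omega)
      (fun i hi => by omega)
      (fun i hi => ⟨plt _ (by omega) (by omega), plt _ (by omega) (by omega)⟩)
      (fun i hi => Sym2.eq_swap) u v
    have c3 := count_edges_le (I := I) (b := r.QB) (l := r.lq) (k := r.ms - 2)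
      (φ := fun i => s(I.vtx (r.QB (r.ms - i)), I.vtx (r.QB (r.ms - (i + 1)))))
      (g := fun i => r.ms - (i + 1)) (fun i hi j hj e => by
        simp only [Finset.coe_range, Set.mem_Iio] at hi hj e; omega)
      (fun i hi => by omega)
      (fun i hi => ⟨qlt _ (by omega) (by omega), qlt _ (by omega) (by omega)⟩)
      (fun i hi => by
          rw [show r.ms - (i + 1) + 1 = r.ms - i by omega]) u v
    omega

end Instance

end Middlebox

namespace Middlebox

/-! ## The solution that is described by the output -/

theorem sum_map_le_of_forall₂ {α β : Type*} {Rel : α → β → Prop} {l : List α} {l' : List β}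
    (h : List.Forall₂ Rel l l') {f : β → ℝ} {g : α → ℝ} (hfg : ∀ a b, Rel a b → f b ≤ g a) :
    (l'.map f).sum ≤ (l.map g).sum := by
  induction h with
  | nil => simp
  | cons h _ ih => simpa using add_le_add (hfg _ _ h) ih

theorem sum_map_filter {α : Type*} (q : α → Prop) [DecidablePred q] (f : α → ℝ) (l : List α) :
    ((l.filter fun r => q r).map f).sum = (l.map fun r => if q r then f r else 0).sum := by
  induction l with
  | nil => simp
  | cons a l ih => by_cases h : q a <;> simp [h, ih]

theorem sum_map_cast_mul {α : Type*} (f : α → ℕ) (c : ℝ) (l : List α) :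
    (l.map fun r => (f r : ℝ) * c).sum = ((l.map f).sum : ℕ) * c := by
  induction l with
  | nil => simp
  | cons a l ih => simp [ih, add_mul]

theorem forall₂_of_forall_mem {α β : Type*} {Rel : α → β → Prop} {l : List α}
    (h : ∀ a ∈ l, ∃ b, Rel a b) : ∃ l', List.Forall₂ Rel l l' ∧ ∀ b ∈ l', ∃ a, Rel a b := by
  induction l with
  | nil => exact ⟨[], .nil, by simp⟩
  | cons a l ih =>
    obtain ⟨b, hb⟩ := h a (by simp)
    obtain ⟨l', hl', hm⟩ := ih fun a ha => h a (by simp [ha])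
    exact ⟨b :: l', .cons hb hl', List.forall_mem_cons.mpr ⟨⟨a, hb⟩, hm⟩⟩

namespace Instance

variable {I : Instance}

theorem ratio_cap (u v : Fin I.n) : I.params.ratio (I.params.capPos u v) = I.cap s(u, v) :=
  (I.hasRat_cap u v).ratio

theorem ratio_proc (v : Fin I.n) : I.params.ratio (I.params.procPos v) = I.proc v :=
  (I.hasRat_proc v).ratio

theorem ratio_price (v : Fin I.n) : I.params.ratio (I.params.pricePos v) = I.price v :=
  (I.hasRat_price v).ratio

theorem ratio_demand (i : Fin I.numDemands) :
    I.params.ratio (I.params.demPos i + 1) = I.demand i := (I.hasRat_demand i).ratio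

theorem scaled_symm (x : ℕ) (u v : Fin I.n) : I.params.scaled x (I.params.capPos v u) =
    I.params.scaled x (I.params.capPos u v) := by
  have h1 := I.hasRat_cap u v
  have h2 := I.hasRat_cap v u
  rw [Sym2.eq_swap] at h2
  unfold Params.scaled
  change I.inp (4 + 2 * (v * I.n + u)) * _ / (I.inp (4 + 2 * (v * I.n + u) + 1) * _) =
    I.inp (4 + 2 * (u * I.n + v)) * _ / (I.inp (4 + 2 * (u * I.n + v) + 1) * _)
  rw [h1.1, h1.2, h2.1, h2.2]

theorem aff_iff (v : Fin I.n) : I.params.Aff v ↔ (I.price v : ℝ) ≤ I.budget := by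
  have hb : (0 : ℝ) < I.params.inp (I.params.pricePos v + 1) := by
    exact_mod_cast Nat.pos_of_ne_zero (I.hasRat_price v).den_ne_zero
  rw [← ratio_price, Params.ratio, div_le_iff₀ hb, Params.Aff]
  norm_cast

/-- Rounding up never understates a price and overstates it by at most one unit, the `2n`-th part of
the budget. -/
theorem price_bounds (v : Fin I.n) (hk : I.budget ≠ 0) :
    (I.price v : ℝ) * (2 * I.n) ≤ I.params.price v * I.budget ∧
    (I.params.price v : ℝ) * I.budget ≤ I.price v * (2 * I.n) + I.budget := by
  have hb' := (I.hasRat_price v).den_ne_zero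
  have hb : (0 : ℝ) < I.params.inp (I.params.pricePos v + 1) := by
    exact_mod_cast Nat.pos_of_ne_zero hb'
  rw [← ratio_price, Params.ratio, Params.price]
  change I.params.inp (I.params.pricePos v + 1) ≠ 0 at hb'
  change _ ≤ ((((_ * (2 * I.n) + _ * I.budget - 1) / (_ * I.budget) : ℕ) : ℝ)) * _ ∧
    ((((_ * (2 * I.n) + _ * I.budget - 1) / (_ * I.budget) : ℕ) : ℝ)) * _ ≤ _
  set a := I.params.inp (I.params.pricePos v)
  set b := I.params.inp (I.params.pricePos v + 1)
  have h0 : 0 < b * I.budget := Nat.pos_of_ne_zero (mul_ne_zero hb' hk)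
  have h1 := Nat.lt_div_mul_add (a := a * (2 * I.n) + b * I.budget - 1) h0
  have h2 := Nat.div_mul_le_self (a * (2 * I.n) + b * I.budget - 1) (b * I.budget)
  set q := (a * (2 * I.n) + b * I.budget - 1) / (b * I.budget)
  have h3 : a * (2 * I.n) ≤ q * (b * I.budget) := by omega
  have h4 : q * (b * I.budget) ≤ a * (2 * I.n) + b * I.budget := by omega
  have h3' : (a : ℝ) * (2 * I.n) ≤ q * (b * I.budget) := by exact_mod_cast h3
  have h4' : (q : ℝ) * (b * I.budget) ≤ a * (2 * I.n) + b * I.budget := by exact_mod_cast h4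
  constructor
  · rw [div_mul_eq_mul_div, div_le_iff₀ hb]; linarith
  · rw [div_mul_eq_mul_div, ← sub_le_iff_le_add, le_div_iff₀ hb]; linarith

/-- The vertices of `I` whose numbers lie in `T`. -/
def ofNats (I : Instance) (T : Finset ℕ) : Finset (Fin I.n) :=
  Finset.univ.filter fun v => (v : ℕ) ∈ T

theorem sum_price_le_budget {T : Finset ℕ} (hT : I.params.Valid T) :
    ∑ v ∈ I.ofNats T, (I.price v : ℝ) ≤ I.budget := by
  have hmem : ∀ v ∈ I.ofNats T, (v : ℕ) ∈ T := fun v hv => (Finset.mem_filter.mp hv).2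
  -- For budget 0 the rounded prices are all 0, by division by zero, and say nothing. Affordability
  -- of each single vertex then gives that its price is 0.
  by_cases hk : I.budget = 0
  · refine (Finset.sum_nonpos fun v hv => ?_).trans (by positivity)
    have := (aff_iff v).mp (hT.aff v (hmem v hv))
    rwa [hk, Nat.cast_zero] at this
  have hn : (0 : ℝ) < 2 * I.n := by have := I.n_pos; positivity
  have h1 : ∑ v ∈ I.ofNats T, (I.price v : ℝ) * (2 * I.n) ≤
      ∑ v ∈ I.ofNats T, (I.params.price v : ℝ) * I.budget :=
    Finset.sum_le_sum fun v _ => (price_bounds v hk).1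
  rw [← Finset.sum_mul, ← Finset.sum_mul] at h1
  have h2 : ∑ v ∈ I.ofNats T, I.params.price v ≤ 2 * I.n := by
    refine le_trans ?_ hT.sum_le
    rw [← Finset.sum_image (f := I.params.price) (g := fun v : Fin I.n => (v : ℕ))
      fun v _ w _ e => Fin.ext e]
    refine Finset.sum_le_sum_of_subset fun v hv => ?_
    obtain ⟨w, hw, rfl⟩ := Finset.mem_image.mp hv
    exact hmem w hw
  have h2' : (∑ v ∈ I.ofNats T, (I.params.price v : ℝ)) ≤ 2 * I.n := by exact_mod_cast h2
  have h3 : (∑ v ∈ I.ofNats T, (I.params.price v : ℝ)) * I.budget ≤ 2 * I.n * I.budget :=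
    mul_le_mul_of_nonneg_right h2' (by positivity)
  nlinarith

theorem unitL_pos : 0 < I.params.L := Nat.mul_pos (by omega) (Nat.succ_pos _)

theorem arcUse_first {b : ℕ → ℕ} {l u v : ℕ} (hl : 2 ≤ l) (h0 : b 0 = v) (h1 : b 1 = u) :
    1 ≤ arcUse b l u v := by
  rw [arcUse, show l - 1 = (l - 2) + 1 by omega, Finset.sum_range_succ']
  simp [h0, h1]

/-- Routes that follow the decompositions of two flows form a feasible solution. -/
theorem exists_solution {x : ℕ} {T : Finset ℕ} {rs : List Rec} {g1 g2 : ℕ → ℕ → ℕ} {v1 v2 : ℕ}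
    (hT : I.params.Valid T) (hx : I.params.inp (x + 1) ≠ 0)
    (h1 : I.params.IsFlow (I.params.capF x (I.params.rvP x T)) g1 v1)
    (h2 : I.params.IsFlow (I.params.capF x (I.params.rvD x)) g2 v2)
    (hrs : ∀ r ∈ rs, I.params.RecOk x T r)
    (u1 : ∀ u < I.params.N, ∀ v < I.params.N,
      (rs.map fun r => arcUse r.PB r.lp u v).sum ≤ g1 u v)
    (u2 : ∀ u < I.params.N, ∀ v < I.params.N,
      (rs.map fun r => arcUse r.QB r.lq u v).sum ≤ g2 u v) :
    ∃ S : I.Solution, S.Feasible ∧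
      S.value = rs.length * (I.params.ratio x / (3 * I.params.L)) ∧
      S.EncodedBy (((List.finRange I.n).map fun v : Fin I.n => if v.1 ∈ T then 1 else 0) ++
        [rs.length] ++ (rs.map (I.params.block x)).flatten) := by
  obtain ⟨Rs, hR, hmem⟩ := forall₂_of_forall_mem
    (Rel := fun r R => I.params.RecOk x T r ∧ I.Follows x r R) fun r hr => by
      obtain ⟨R, hR⟩ := exists_follows hT.subset (hrs r hr)
      exact ⟨R, hrs r hr, hR⟩
  have hmemR : ∀ R ∈ Rs, ∃ r, I.Follows x r R := fun R hRm => by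
    obtain ⟨r, _, h⟩ := hmem R hRm
    exact ⟨r, h⟩
  have hL : (0 : ℝ) < I.params.L := by exact_mod_cast I.unitL_pos
  set c := I.params.ratio x / (3 * I.params.L) with hc
  have hc0 : 0 ≤ c := div_nonneg (I.params.ratio_nonneg x) (by positivity)
  have hN : I.params.N = I.n + (I.n + I.numDemands) + 1 := rfl
  have hz : I.params.N - 1 = I.n + (I.n + I.numDemands) := rfl
  have hscale : ∀ i, (I.params.scaled x i : ℝ) * (3 * c) ≤ I.params.ratio i := fun i => by
    refine le_trans (le_of_eq ?_) (Params.scaled_mul_le x i)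
    rw [hc]; field_simp
  refine ⟨⟨I.ofNats T, Rs⟩, ⟨sum_price_le_budget hT, ?_, ?_, ?_, ?_, ?_, ?_⟩, ?_, ?_⟩
  · intro R hRm
    obtain ⟨r, h⟩ := hmemR R hRm
    rw [h.amount]; exact hc0
  · intro R hRm
    obtain ⟨r, h⟩ := hmemR R hRm
    exact h.two_walk
  · intro R hRm
    obtain ⟨r, h⟩ := hmemR R hRm
    exact h.node_mem
  · intro e he
    induction e with | _ u v
    refine (sum_map_le_of_forall₂ hR (g := fun r => ((2 * (arcUse r.PB r.lp u v +
      arcUse r.PB r.lp v u) + (arcUse r.QB r.lq u v + arcUse r.QB r.lq v u) : ℕ) : ℝ) * c)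
      fun r R h => ?_).trans ?_
    · rw [h.2.amount]
      exact mul_le_mul_of_nonneg_right (by exact_mod_cast h.2.edges u v) hc0
    · rw [sum_map_cast_mul, List.sum_map_add, List.sum_map_mul_left, List.sum_map_add,
        List.sum_map_add]
      have hu := u.2
      have hv := v.2
      have hu' : (u : ℕ) < I.params.N := by omega
      have hv' : (v : ℕ) < I.params.N := by omega
      have a1 := u1 u hu' v hv'
      have a2 := u1 v hv' u hu'
      have a3 := u2 u hu' v hv'
      have a4 := u2 v hv' u hu'
      have cap : ∀ rv, I.params.capF x rv u v = I.params.scaled x (I.params.capPos u v) ∧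
          I.params.capF x rv v u = I.params.scaled x (I.params.capPos u v) := fun rv => by
        have hu'' : (u : ℕ) < I.params.n := hu
        have hv'' : (v : ℕ) < I.params.n := hv
        simp [Params.capF, hu'', hv'', scaled_symm x u v]
      have b1 := h1.le u hu' v hv'
      have b2 := h1.le v hv' u hu'
      have b3 := h2.le u hu' v hv'
      have b4 := h2.le v hv' u hu'
      rw [(cap _).1] at b1 b3
      rw [(cap _).2] at b2 b4
      have o1 := h1.one u hu' v hv'
      have o2 := h2.one u hu' v hv'
      rw [← ratio_cap]
      refine le_trans ?_ (hscale _)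
      rw [← mul_assoc]
      refine mul_le_mul_of_nonneg_right ?_ hc0
      rw [mul_comm (_ : ℝ) 3]
      -- Each flow uses an edge in one direction only, so both directions together stay within the
      -- rounded capacity; `P` counts twice and `Q` once.
      have : 2 * ((rs.map fun r => arcUse r.PB r.lp u v).sum +
          (rs.map fun r => arcUse r.PB r.lp v u).sum) +
          ((rs.map fun r => arcUse r.QB r.lq u v).sum +
          (rs.map fun r => arcUse r.QB r.lq v u).sum) ≤
          3 * I.params.scaled x (I.params.capPos u v) := by omega
      exact_mod_cast this
  · intro v
    have hv := v.2
    rw [sum_map_filter]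
    -- A route processed at `v` stems from a path whose last arc leaves the terminal of `v`; the
    -- flow on this arc bounds the number of these routes.
    refine (sum_map_le_of_forall₂ hR
      (g := fun r => (arcUse r.PB r.lp (I.n + v) (I.params.N - 1) : ℝ) * c) fun r R h => ?_).trans ?_
    · split_ifs with hnode
      · rw [h.2.amount]
        refine le_mul_of_one_le_left hc0 ?_
        have h3 := (Params.path_shape h.1.pathP).1
        have := arcUse_first (b := r.PB) (l := r.lp) (u := I.n + v) (v := I.params.N - 1)
          (by omega) h.1.pathP.first (by rw [h.2.node, hnode])
        exact_mod_cast this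
      · positivity
    · rw [sum_map_cast_mul]
      have a1 := u1 (I.n + v) (by omega) (I.params.N - 1) (by omega)
      have b1 := h1.le (I.n + v) (by omega) (I.params.N - 1) (by omega)
      have e : I.params.capF x (I.params.rvP x T) (I.n + v) (I.params.N - 1) =
          I.params.rvP x T v := by
        rw [Params.capF, if_neg (by change ¬ I.n + v < I.n; omega), if_pos ⟨rfl, by omega⟩]
        congr 1; change I.n + (v : ℕ) - I.n = v; omega
      rw [e] at b1
      have key : ((rs.map fun r => arcUse r.PB r.lp (I.n + v) (I.params.N - 1)).sum : ℕ) * c ≤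
          (I.params.rvP x T v : ℝ) * (3 * c) := by
        refine mul_le_mul (by exact_mod_cast a1.trans b1) (by linarith) hc0 (by positivity)
      refine key.trans ?_
      rw [Params.rvP]
      by_cases hvT : (v : ℕ) ∈ T
      · rw [if_pos hvT, if_pos (by simpa [ofNats] using hvT), ← ratio_proc]
        exact hscale _
      · rw [if_neg hvT, if_neg (by simpa [ofNats] using hvT)]
        simp
  · intro i
    have hi := i.2
    rw [sum_map_filter]
    -- Likewise the last arc of `Q` leaves the terminal of the demand. Here, as for processing, the
    -- factor 1/3 is not needed.
    refine (sum_map_le_of_forall₂ hR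
      (g := fun r => (arcUse r.QB r.lq (I.n + (I.n + i)) (I.params.N - 1) : ℝ) * c)
      fun r R h => ?_).trans ?_
    · split_ifs with hidx
      · rw [h.2.amount]
        refine le_mul_of_one_le_left hc0 ?_
        have h3 := (Params.path_shape h.1.pathQ).1
        have := arcUse_first (b := r.QB) (l := r.lq) (u := I.n + (I.n + i)) (v := I.params.N - 1)
          (by omega) h.1.pathQ.first (by rw [h.2.idx, hidx])
        exact_mod_cast this
      · positivity
    · rw [sum_map_cast_mul]
      have a1 := u2 (I.n + (I.n + i)) (by omega) (I.params.N - 1) (by omega)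
      have b1 := h2.le (I.n + (I.n + i)) (by omega) (I.params.N - 1) (by omega)
      have e : I.params.capF x (I.params.rvD x) (I.n + (I.n + i)) (I.params.N - 1) =
          I.params.scaled x (I.params.demPos i + 1) := by
        rw [Params.capF, if_neg (by change ¬ I.n + (I.n + i) < I.n; omega),
          if_pos ⟨rfl, by omega⟩, Params.rvD]
        change (if I.n + (I.n + i) - I.n < I.n then 0 else
          I.params.scaled x (I.params.demPos (I.n + (I.n + i) - I.n - I.n) + 1)) = _
        rw [if_neg (by omega), show I.n + (I.n + (i : ℕ)) - I.n - I.n = i by omega]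
      rw [e] at b1
      have key : ((rs.map fun r => arcUse r.QB r.lq (I.n + (I.n + i)) (I.params.N - 1)).sum : ℕ) * c
          ≤ (I.params.scaled x (I.params.demPos i + 1) : ℝ) * (3 * c) := by
        refine mul_le_mul (by exact_mod_cast a1.trans b1) (by linarith) hc0 (by positivity)
      refine key.trans ?_
      rw [← ratio_demand]
      exact hscale _
  · rw [Solution.value]
    have hlen := hR.length_eq
    have : Rs.map Route.amount = Rs.map fun _ => c := List.map_congr_left fun R hRm => by
      obtain ⟨r, h⟩ := hmemR R hRm
      exact h.amount
    simp [this, hlen]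
  · refine ⟨rs.map (I.params.block x), ?_, ?_⟩
    · rw [List.forall₂_map_right_iff]
      exact (hR.imp fun r R h => h.2.encodedBy hx).flip
    · simp [ofNats, hR.length_eq]

end Instance

end Middlebox

namespace Middlebox

/-! ## Upper bounds on the optimum -/

theorem sum_map_finset_sum {α ι : Type*} (s : Finset ι) (f : α → ι → ℝ) (l : List α) :
    (l.map fun r => ∑ a ∈ s, f r a).sum = ∑ a ∈ s, (l.map fun r => f r a).sum := by
  induction l with
  | nil => simp
  | cons a l ih => simp [ih, Finset.sum_add_distrib]

/-- The capacity of a cut, with real terminal capacities. -/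
noncomputable def Params.realCut (p : Params) (rv : ℕ → ℝ) (A : Finset ℕ) : ℝ :=
  (∑ u ∈ Finset.range p.n, ∑ v ∈ Finset.range p.n,
    if u ∈ A ∧ v ∉ A then p.ratio (p.capPos u v) else 0) +
  ∑ j ∈ Finset.range (p.n + p.d), if p.att j ∈ A then rv j else 0

noncomputable def Params.realP (p : Params) (O : Finset ℕ) (j : ℕ) : ℝ :=
  if j ∈ O then p.ratio (p.procPos j) else 0

noncomputable def Params.realD (p : Params) (j : ℕ) : ℝ :=
  if j < p.n then 0 else p.ratio (p.demPos (j - p.n) + 1)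

namespace Instance

variable {I : Instance}

/-- The part of the walk from the source to `t` leaves `A` along some edge unless `t` itself lies in
`A`. -/
theorem Route.amount_le_crossing (R : I.Route) (h0 : 0 ≤ R.amount) {A : Finset ℕ}
    (hs : (I.source : ℕ) ∈ A) {t : Fin I.n} (ht : t ∈ R.walk.support) :
    R.amount ≤ (∑ u : Fin I.n, ∑ v : Fin I.n,
      if (u : ℕ) ∈ A ∧ (v : ℕ) ∉ A then (R.walk.edges.count s(u, v) : ℝ) * R.amount else 0) +
      if (t : ℕ) ∈ A then R.amount else 0 := by
  have hpos : ∀ u v : Fin I.n, 0 ≤ if (u : ℕ) ∈ A ∧ (v : ℕ) ∉ A then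
      (R.walk.edges.count s(u, v) : ℝ) * R.amount else 0 := fun u v => by
    split_ifs
    · positivity
    · exact le_rfl
  by_cases hA : (t : ℕ) ∈ A
  · rw [if_pos hA]
    exact le_add_of_nonneg_left (Finset.sum_nonneg fun u _ => Finset.sum_nonneg fun v _ => hpos u v)
  · rw [if_neg hA, add_zero]
    obtain ⟨d, hd, h1, h2⟩ := (R.walk.takeUntil t ht).exists_boundary_dart
      {v | (v : ℕ) ∈ A} hs hA
    have hmem : s(d.fst, d.snd) ∈ R.walk.edges := by
      have hd' := R.walk.darts_takeUntil_subset_darts ht hd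
      exact List.mem_map.mpr ⟨d, hd', rfl⟩
    have hc : 1 ≤ R.walk.edges.count s(d.fst, d.snd) := List.count_pos_iff.mpr hmem
    calc R.amount ≤ (R.walk.edges.count s(d.fst, d.snd) : ℝ) * R.amount :=
          le_mul_of_one_le_left h0 (by exact_mod_cast hc)
      _ = if (d.fst : ℕ) ∈ A ∧ (d.snd : ℕ) ∉ A then
          (R.walk.edges.count s(d.fst, d.snd) : ℝ) * R.amount else 0 := by
        rw [if_pos ⟨h1, h2⟩]
      _ ≤ ∑ v : Fin I.n, if (d.fst : ℕ) ∈ A ∧ (v : ℕ) ∉ A then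
          (R.walk.edges.count s(d.fst, v) : ℝ) * R.amount else 0 :=
        Finset.single_le_sum (f := fun v : Fin I.n => if (d.fst : ℕ) ∈ A ∧ (v : ℕ) ∉ A then
          (R.walk.edges.count s(d.fst, v) : ℝ) * R.amount else 0)
          (fun v _ => hpos _ v) (Finset.mem_univ _)
      _ ≤ _ := Finset.single_le_sum (f := fun u : Fin I.n => ∑ v : Fin I.n,
          if (u : ℕ) ∈ A ∧ (v : ℕ) ∉ A then
          (R.walk.edges.count s(u, v) : ℝ) * R.amount else 0)
          (fun u _ => Finset.sum_nonneg fun v _ => hpos u v) (Finset.mem_univ _)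

variable {S : I.Solution}

/-- The crossings of all routes are summed up. Choosing `t` as the processing vertex or as the sink
gives the two cut bounds on the value. -/
theorem Solution.Feasible.value_le_crossing (h : S.Feasible) {A : Finset ℕ}
    (hs : (I.source : ℕ) ∈ A) (t : I.Route → Fin I.n)
    (ht : ∀ R ∈ S.routes, t R ∈ R.walk.support) :
    S.value ≤ (∑ u ∈ Finset.range I.n, ∑ v ∈ Finset.range I.n,
      if u ∈ A ∧ v ∉ A then I.params.ratio (I.params.capPos u v) else 0) +
      ∑ w : Fin I.n, if (w : ℕ) ∈ A then
        ((S.routes.filter fun R => t R = w).map Route.amount).sum else 0 := by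
  have h1 : S.value ≤ (S.routes.map fun R => (∑ u : Fin I.n, ∑ v : Fin I.n,
      if (u : ℕ) ∈ A ∧ (v : ℕ) ∉ A then (R.walk.edges.count s(u, v) : ℝ) * R.amount else 0) +
      if (t R : ℕ) ∈ A then R.amount else 0).sum :=
    List.sum_le_sum fun R hR => R.amount_le_crossing (h.amount_nonneg R hR) hs (ht R hR)
  refine h1.trans ?_
  rw [List.sum_map_add]
  refine add_le_add ?_ (le_of_eq ?_)
  · rw [sum_map_finset_sum, Finset.sum_range]
    refine Finset.sum_le_sum fun u _ => ?_
    rw [sum_map_finset_sum, Finset.sum_range]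
    refine Finset.sum_le_sum fun v _ => ?_
    by_cases c : (u : ℕ) ∈ A ∧ (v : ℕ) ∉ A
    · simp only [if_pos c]
      rw [ratio_cap]
      by_cases he : s(u, v) ∈ I.graph.edgeSet
      · exact h.edge_cap _ he
      · have : ∀ R ∈ S.routes, (R.walk.edges.count s(u, v) : ℝ) * R.amount = 0 := fun R _ => by
          rw [List.count_eq_zero_of_not_mem fun hm => he (R.walk.edges_subset_edgeSet hm)]
          simp
        rw [List.map_congr_left this]
        simpa using NNRat.cast_nonneg (I.cap s(u, v))
    · simp only [if_neg c]
      simp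
  · have : ∀ R : I.Route, (if (t R : ℕ) ∈ A then R.amount else 0) = ∑ w : Fin I.n,
        if t R = w then (if (w : ℕ) ∈ A then R.amount else 0) else 0 := fun R => by simp
    simp only [this]
    rw [sum_map_finset_sum]
    refine Finset.sum_congr rfl fun w _ => ?_
    rw [sum_map_filter]
    by_cases hw : (w : ℕ) ∈ A <;> simp [hw]

theorem Solution.Feasible.value_le_realP (h : S.Feasible) {A : Finset ℕ}
    (hs : (I.source : ℕ) ∈ A) :
    S.value ≤ I.params.realCut (I.params.realP (S.purchased.image Fin.val)) A := by
  refine (h.value_le_crossing hs Route.node h.node_mem).trans (add_le_add le_rfl ?_)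
  change _ ≤ ∑ j ∈ Finset.range (I.n + I.numDemands), _
  rw [Finset.sum_range_add, Finset.sum_range]
  refine (Finset.sum_le_sum fun w _ => ?_).trans (le_add_of_nonneg_right
    (Finset.sum_nonneg fun i _ => ?_))
  · have hatt : I.params.att w = w := by rw [Params.att, if_pos (by exact w.2)]
    rw [hatt]
    split_ifs
    · refine (h.node_cap w).trans (le_of_eq ?_)
      simp only [Params.realP, Finset.mem_image]
      rw [← ratio_proc]
      congr 1
      simp [Fin.val_inj]
    · exact le_rfl
  · unfold Params.realP
    split_ifs
    · exact I.params.ratio_nonneg _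
    · exact le_rfl
    · exact le_rfl

theorem Solution.Feasible.value_le_realD (h : S.Feasible) {A : Finset ℕ}
    (hs : (I.source : ℕ) ∈ A) : S.value ≤ I.params.realCut I.params.realD A := by
  refine (h.value_le_crossing hs (fun R => I.sink R.idx) (fun R _ => R.walk.end_mem_support)).trans
    (add_le_add le_rfl ?_)
  change _ ≤ ∑ j ∈ Finset.range (I.n + I.numDemands), _
  rw [Finset.sum_range_add]
  have h0 : 0 ≤ ∑ j ∈ Finset.range I.n,
      (if I.params.att j ∈ A then I.params.realD j else 0) := Finset.sum_nonneg fun i _ => by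
    unfold Params.realD
    split_ifs
    · exact le_rfl
    · exact I.params.ratio_nonneg _
    · exact le_rfl
  refine le_add_of_nonneg_of_le h0 ?_
  rw [Finset.sum_range]
  have h1 : ∀ R : I.Route, ∀ w : Fin I.n, (if I.sink R.idx = w then R.amount else 0) =
      ∑ i : Fin I.numDemands, if R.idx = i then (if I.sink i = w then R.amount else 0) else 0 :=
    fun R w => by simp
  have h2 : (∑ w : Fin I.n, if (w : ℕ) ∈ A then
      ((S.routes.filter fun R => I.sink R.idx = w).map Route.amount).sum else 0) =
      ∑ i : Fin I.numDemands, if (I.sink i : ℕ) ∈ A then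
        ((S.routes.filter fun R => R.idx = i).map Route.amount).sum else 0 := by
    have : ∀ w : Fin I.n, (if (w : ℕ) ∈ A then
        ((S.routes.filter fun R => I.sink R.idx = w).map Route.amount).sum else 0) =
        ∑ i : Fin I.numDemands, if I.sink i = w then (if (w : ℕ) ∈ A then
          ((S.routes.filter fun R => R.idx = i).map Route.amount).sum else 0) else 0 := fun w => by
      rw [sum_map_filter]
      simp only [h1]
      rw [sum_map_finset_sum]
      by_cases hw : (w : ℕ) ∈ A
      · simp only [if_pos hw]
        refine Finset.sum_congr rfl fun i _ => ?_
        rw [sum_map_filter]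
        by_cases hi : I.sink i = w <;> simp [hi]
      · simp [hw]
    simp only [this]
    rw [Finset.sum_comm]
    simp
  rw [h2]
  refine Finset.sum_le_sum fun i _ => ?_
  have e1 : I.params.att (I.n + i) = I.sink i := by
    rw [Params.att, if_neg (by change ¬ I.n + (i : ℕ) < I.n; omega), ← I.inp_sink i]
    change I.inp (4 + 2 * (I.n * I.n) + 4 * I.n + 3 * (I.n + i - I.n)) = _
    rw [Nat.add_sub_cancel_left]
  have e2 : I.params.realD (I.n + i) = I.demand i := by
    rw [Params.realD, if_neg (by change ¬ I.n + (i : ℕ) < I.n; omega), ← ratio_demand]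
    change I.params.ratio (I.params.demPos (I.n + i - I.n) + 1) = _
    rw [Nat.add_sub_cancel_left]
  rw [e1, e2]
  split_ifs
  · exact h.demand_cap i
  · exact le_rfl

end Instance

/-! ## The choice of the unit -/

namespace Params

variable {p : Params}

/-- A position before `K` of a rational number. -/
def IsPos (p : Params) (x : ℕ) : Prop := x < p.K ∧ p.inp (x + 1) ≠ 0

/-- Each summand is at most `V`. If none reached the `M`-th part of `V`, then fewer than `M` of them
could not add up to `V`. -/
theorem exists_unit_of_realCut {rv : ℕ → ℝ} {A : Finset ℕ} {M : ℕ}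
    (hM : p.n * p.n + (p.n + p.d) < M) (hcap : ∀ u < p.n, ∀ v < p.n, p.IsPos (p.capPos u v))
    (hrv : ∀ j < p.n + p.d, rv j = 0 ∨ ∃ x, p.IsPos x ∧ rv j = p.ratio x)
    (hV : 0 < p.realCut rv A) :
    ∃ x, p.IsPos x ∧ p.ratio x ≤ p.realCut rv A ∧ p.realCut rv A ≤ M * p.ratio x := by
  by_contra! hc
  set V := p.realCut rv A with hVd
  have hterm : ∀ t : ℝ, (t = 0 ∨ ∃ x, p.IsPos x ∧ t = p.ratio x) → t ≤ V → M * t ≤ V := by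
    rintro t (rfl | ⟨x, hx, rfl⟩) ht
    · simp [hV.le]
    · exact (hc x hx ht).le
  set f : ℕ → ℕ → ℝ := fun u v => if u ∈ A ∧ v ∉ A then p.ratio (p.capPos u v) else 0 with hf
  set g : ℕ → ℝ := fun j => if p.att j ∈ A then rv j else 0 with hg
  have hVfg : V = (∑ u ∈ Finset.range p.n, ∑ v ∈ Finset.range p.n, f u v) +
      ∑ j ∈ Finset.range (p.n + p.d), g j := rfl
  have f0 : ∀ u v, 0 ≤ f u v := fun u v => by
    simp only [hf]; split_ifs
    · exact p.ratio_nonneg _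
    · exact le_rfl
  have ft : ∀ u < p.n, ∀ v < p.n, f u v = 0 ∨ ∃ x, p.IsPos x ∧ f u v = p.ratio x :=
    fun u hu v hv => by
      simp only [hf]; split_ifs
      · exact Or.inr ⟨_, hcap u hu v hv, rfl⟩
      · exact Or.inl rfl
  have gt : ∀ j < p.n + p.d, g j = 0 ∨ ∃ x, p.IsPos x ∧ g j = p.ratio x := fun j hj => by
    simp only [hg]; split_ifs
    · exact hrv j hj
    · exact Or.inl rfl
  have g0 : ∀ j ∈ Finset.range (p.n + p.d), 0 ≤ g j := fun j hj => by
    rcases gt j (by simpa using hj) with h | ⟨x, _, h⟩ <;> rw [h]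
    exact p.ratio_nonneg _
  have fs : 0 ≤ ∑ u ∈ Finset.range p.n, ∑ v ∈ Finset.range p.n, f u v :=
    Finset.sum_nonneg fun u _ => Finset.sum_nonneg fun v _ => f0 u v
  have gs : 0 ≤ ∑ j ∈ Finset.range (p.n + p.d), g j := Finset.sum_nonneg g0
  have fV : ∀ u ∈ Finset.range p.n, ∀ v ∈ Finset.range p.n, M * f u v ≤ V := fun u hu v hv => by
    refine hterm _ (ft u (by simpa using hu) v (by simpa using hv)) ?_
    have a1 := Finset.single_le_sum (f := f u) (fun v _ => f0 u v) hv
    have a2 := Finset.single_le_sum (f := fun u => ∑ v ∈ Finset.range p.n, f u v)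
      (fun u _ => Finset.sum_nonneg fun v _ => f0 u v) hu
    linarith
  have gV : ∀ j ∈ Finset.range (p.n + p.d), M * g j ≤ V := fun j hj => by
    refine hterm _ (gt j (by simpa using hj)) ?_
    have a1 := Finset.single_le_sum (f := g) g0 hj
    linarith
  have s1 := Finset.sum_le_sum fun u hu => Finset.sum_le_sum (fV u hu)
  have s2 := Finset.sum_le_sum gV
  simp only [← Finset.mul_sum] at s1 s2
  simp only [Finset.sum_const, Finset.card_range, nsmul_eq_mul] at s1 s2
  have hM' : ((p.n : ℝ) * p.n + (p.n + p.d)) < M := by exact_mod_cast hM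
  have e : (M : ℝ) * V = M * (∑ u ∈ Finset.range p.n, ∑ v ∈ Finset.range p.n, f u v) +
      M * ∑ j ∈ Finset.range (p.n + p.d), g j := by rw [hVfg]; ring
  push_cast at s2
  nlinarith

/-- Rounding down loses less than one unit per summand, and there are `n * n + (n + d)` of them. -/
theorem realCut_le_rcut {x : ℕ} (hx : p.inp x ≠ 0) (hx' : p.inp (x + 1) ≠ 0) (hL : p.L ≠ 0)
    {rv : ℕ → ℝ} {rv' : ℕ → ℕ} (A : Finset ℕ)
    (hcap : ∀ u < p.n, ∀ v < p.n, p.IsPos (p.capPos u v))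
    (hrv : ∀ j < p.n + p.d, rv j = 0 ∨ ∃ i, p.IsPos i ∧ rv j = p.ratio i ∧ rv' j = p.scaled x i) :
    p.realCut rv A ≤ (p.rcut x rv' A + (p.n * p.n + (p.n + p.d))) * (p.ratio x / p.L) := by
  set δ := p.ratio x / p.L with hδ
  have hδ0 : 0 ≤ δ := div_nonneg (p.ratio_nonneg x) (by positivity)
  have h1 : ∀ u ∈ Finset.range p.n, ∀ v ∈ Finset.range p.n,
      (if u ∈ A ∧ v ∉ A then p.ratio (p.capPos u v) else 0) ≤
        (((if u ∈ A ∧ v ∉ A then p.scaled x (p.capPos u v) else 0 : ℕ) : ℝ) + 1) * δ := by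
    intro u hu v hv
    split_ifs
    · exact (lt_scaled_add_one (hcap u (by simpa using hu) v (by simpa using hv)).2 hx hx' hL).le
    · simpa using hδ0
  have h2 : ∀ j ∈ Finset.range (p.n + p.d), (if p.att j ∈ A then rv j else 0) ≤
      (((if p.att j ∈ A then rv' j else 0 : ℕ) : ℝ) + 1) * δ := by
    intro j hj
    split_ifs
    · rcases hrv j (by simpa using hj) with h | ⟨i, hi, h, h'⟩
      · rw [h]; positivity
      · rw [h, h']; exact (lt_scaled_add_one hi.2 hx hx' hL).le
    · simpa using hδ0
  refine (add_le_add (Finset.sum_le_sum fun u hu => Finset.sum_le_sum (h1 u hu))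
    (Finset.sum_le_sum h2)).trans (le_of_eq ?_)
  simp only [← Finset.sum_mul, Finset.sum_add_distrib, Finset.sum_const, Finset.card_range,
    nsmul_eq_mul, mul_one, rcut]
  push_cast
  ring

end Params

namespace Instance

variable (I : Instance)

/-- A loop up to `K` thus passes all positions of the input, so the reference number that the
analysis wants is among those tried. -/
theorem params_K_gt {i : ℕ} (hi : i ≤ 4 + 2 * (I.n * I.n) + 4 * I.n + 3 * I.numDemands) :
    i < I.params.K := by
  change i < I.cutSize * (20 * (I.cutSize + 1))
  have : I.n * I.n + 2 * I.n + 2 * I.numDemands + 1 ≤ I.cutSize := by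
    unfold cutSize; nlinarith [Nat.zero_le (I.n * I.numDemands)]
  nlinarith

theorem isPos_cap {u v : ℕ} (hu : u < I.n) (hv : v < I.n) : I.params.IsPos (I.params.capPos u v) := by
  refine ⟨I.params_K_gt ?_, (I.hasRat_cap ⟨u, hu⟩ ⟨v, hv⟩).den_ne_zero⟩
  change 4 + 2 * (u * I.n + v) ≤ _
  have : u * I.n + I.n ≤ I.n * I.n := by
    rw [← Nat.succ_mul]; exact Nat.mul_le_mul_right _ hu
  omega

theorem isPos_proc {v : ℕ} (hv : v < I.n) : I.params.IsPos (I.params.procPos v) := by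
  refine ⟨I.params_K_gt ?_, (I.hasRat_proc ⟨v, hv⟩).den_ne_zero⟩
  change 4 + 2 * (I.n * I.n) + 2 * v ≤ _
  omega

theorem isPos_demand {i : ℕ} (hi : i < I.numDemands) :
    I.params.IsPos (I.params.demPos i + 1) := by
  refine ⟨I.params_K_gt ?_, (I.hasRat_demand ⟨i, hi⟩).den_ne_zero⟩
  change 4 + 2 * (I.n * I.n) + 4 * I.n + 3 * i + 1 ≤ _
  omega

variable {I}

theorem realP_cases {O : Finset ℕ} (hO : O ⊆ Finset.range I.n) (x j : ℕ) :
    I.params.realP O j = 0 ∨ ∃ i, I.params.IsPos i ∧ I.params.realP O j = I.params.ratio i ∧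
      I.params.rvP x O j = I.params.scaled x i := by
  by_cases hj : j ∈ O
  · exact Or.inr ⟨_, I.isPos_proc (by simpa using hO hj), by simp [Params.realP, hj],
      by simp [Params.rvP, hj]⟩
  · exact Or.inl (by simp [Params.realP, hj])

theorem realD_cases (x : ℕ) {j : ℕ} (hj : j < I.n + I.numDemands) :
    I.params.realD j = 0 ∨ ∃ i, I.params.IsPos i ∧ I.params.realD j = I.params.ratio i ∧
      I.params.rvD x j = I.params.scaled x i := by
  by_cases h : j < I.params.n
  · exact Or.inl (by rw [Params.realD, if_pos h])
  · refine Or.inr ⟨_, I.isPos_demand (i := j - I.n) ?_, by rw [Params.realD, if_neg h]; rfl,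
      by rw [Params.rvD, if_neg h]; rfl⟩
    change ¬ j < I.n at h
    omega

/-- The reference is taken from the smaller of the two minimum real cuts. It then suits both
networks: neither has a smaller cut, and rounding costs each cut at most `M` units. -/
theorem exists_unit {O : Finset ℕ} (hO : O ⊆ Finset.range I.n) {z : ℝ} (hz : 0 < z)
    (hP : ∀ A : Finset ℕ, (I.source : ℕ) ∈ A → z ≤ I.params.realCut (I.params.realP O) A)
    (hD : ∀ A : Finset ℕ, (I.source : ℕ) ∈ A → z ≤ I.params.realCut I.params.realD A) :
    ∃ x w, x < I.params.K ∧ w < I.params.K ∧ I.params.inp x ≠ 0 ∧ I.params.inp (x + 1) ≠ 0 ∧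
      w ≤ I.params.flowP x O ∧ w ≤ I.params.flowD x ∧
      19 / 20 * z * I.params.L ≤ w * I.params.ratio x := by
  set p := I.params with hp
  set F : Finset ℕ × Bool → ℝ := fun a => p.realCut (if a.2 then p.realP O else p.realD) a.1 with hF
  obtain ⟨⟨A, b⟩, hA, hmin⟩ := Finset.exists_min_image
    (((Finset.range I.n).powerset.filter fun A => (I.source : ℕ) ∈ A) ×ˢ Finset.univ) F
    ⟨(Finset.range I.n, true), by simp⟩
  set V := F (A, b) with hV
  have hsA : (I.source : ℕ) ∈ A := by
    simp only [Finset.mem_product, Finset.mem_filter] at hA; exact hA.1.2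
  have hminP : ∀ B, B ⊆ Finset.range p.n → p.s ∈ B → V ≤ p.realCut (p.realP O) B :=
    fun B h1 h2 => hmin (B, true) (by simpa using ⟨h1, h2⟩)
  have hminD : ∀ B, B ⊆ Finset.range p.n → p.s ∈ B → V ≤ p.realCut p.realD B :=
    fun B h1 h2 => by simpa [hF] using hmin (B, false) (by simpa using ⟨h1, h2⟩)
  have hzV : z ≤ V := by
    cases b
    · simpa [hV, hF] using hD A hsA
    · simpa [hV, hF] using hP A hsA
  have hV0 : 0 < V := hz.trans_le hzV
  set M := I.cutSize with hM
  have hMlt : p.n * p.n + (p.n + p.d) < M := by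
    change I.n * I.n + (I.n + I.numDemands) < (I.n + I.numDemands + 1) * (I.n + I.numDemands + 1)
    nlinarith [Nat.zero_le (I.n * I.numDemands)]
  have hcap : ∀ u < p.n, ∀ v < p.n, p.IsPos (p.capPos u v) := fun u hu v hv => I.isPos_cap hu hv
  obtain ⟨x, hx, hxV, hVx⟩ := Params.exists_unit_of_realCut (p := p)
    (rv := if b then p.realP O else p.realD) (A := A) hMlt hcap (fun j hj => by
      cases b
      · rcases realD_cases (I := I) 0 hj with h | ⟨i, h1, h2, _⟩
        · exact Or.inl h
        · exact Or.inr ⟨i, h1, h2⟩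
      · rcases realP_cases hO 0 j with h | ⟨i, h1, h2, _⟩
        · exact Or.inl h
        · exact Or.inr ⟨i, h1, h2⟩) hV0
  change p.ratio x ≤ V at hxV
  change V ≤ M * p.ratio x at hVx
  have hτ : 0 < p.ratio x := by
    refine lt_of_le_of_ne (p.ratio_nonneg x) fun h0 => ?_
    rw [← h0, mul_zero] at hVx
    linarith
  have hx0 : p.inp x ≠ 0 := fun h0 => by
    rw [Params.ratio, h0] at hτ; simp at hτ
  have hL : p.L ≠ 0 := I.unitL_pos.ne'
  have hL0 : (0 : ℝ) < p.L := by exact_mod_cast I.unitL_pos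
  set δ := p.ratio x / p.L with hδ
  have hδ0 : 0 < δ := div_pos hτ hL0
  have hKML : (p.K : ℝ) = M * p.L := by
    have : p.K = M * p.L := rfl
    exact_mod_cast this
  have hLM : (p.L : ℝ) = 20 * (M + 1) := by
    have : p.L = 20 * (M + 1) := rfl
    exact_mod_cast this
  have hM' : ((p.n : ℝ) * p.n + (p.n + p.d)) ≤ M := by exact_mod_cast hMlt.le
  -- `V` is at most `M` times the reference, so `V / δ` is at most `K` and the truncation does no
  -- harm.
  set q := ⌊V / δ⌋₊ with hq
  have hqle : (q : ℝ) ≤ V / δ := Nat.floor_le (by positivity)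
  have hqlt : V / δ < q + 1 := Nat.lt_floor_add_one _
  have hVδ : V / δ ≤ p.K := by
    rw [hKML, div_le_iff₀ hδ0, hδ]
    rw [mul_assoc, mul_div_cancel₀ _ hL0.ne']
    exact hVx
  have hqK : q ≤ p.K := by exact_mod_cast hqle.trans hVδ
  have hMpos : 0 < M := by omega
  have hKpos : 0 < p.K := by have := hx.1; omega
  -- A rounded cut misses at most `M` units of the real one, so it still has `q - M` units.
  have hcut : ∀ r : ℕ, V ≤ (r + ((p.n : ℝ) * p.n + (p.n + p.d))) * δ → q - M ≤ r := by
    intro r hr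
    have h1 : V / δ ≤ r + M := by
      rw [div_le_iff₀ hδ0]
      exact hr.trans (mul_le_mul_of_nonneg_right (by linarith) hδ0.le)
    have h2 : q ≤ r + M := by exact_mod_cast hqle.trans h1
    omega
  refine ⟨x, q - M, hx.1, by omega, hx0, hx.2, ?_, ?_, ?_⟩
  · refine le_min (by omega) ?_
    obtain ⟨B, hB, hsB, e⟩ := p.exists_mcut x (p.rvP x O)
    rw [← e]
    exact hcut _ ((hminP B hB hsB).trans (Params.realCut_le_rcut hx0 hx.2 hL B hcap
      fun j _ => realP_cases hO x j))
  · refine le_min (by omega) ?_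
    obtain ⟨B, hB, hsB, e⟩ := p.exists_mcut x (p.rvD x)
    rw [← e]
    exact hcut _ ((hminD B hB hsB).trans (Params.realCut_le_rcut hx0 hx.2 hL B hcap
      fun j hj => realD_cases x hj))
  · have h1 : V / δ - (M + 1) ≤ ((q - M : ℕ) : ℝ) := by
      have : q ≤ (q - M) + M := by omega
      have : (q : ℝ) ≤ ((q - M : ℕ) : ℝ) + M := by exact_mod_cast this
      linarith
    have h2 : (V / δ - (M + 1)) * p.ratio x ≤ ((q - M : ℕ) : ℝ) * p.ratio x :=
      mul_le_mul_of_nonneg_right h1 hτ.le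
    refine le_trans ?_ h2
    have h3 : V / δ * p.ratio x = V * p.L := by
      rw [hδ]; field_simp
    -- The loss is `M` units from rounding cuts and one from the floor. The reference is at most `V`
    -- and `L = 20 * (M + 1)`, which makes this a twentieth.
    have h4 : ((M : ℝ) + 1) * p.ratio x ≤ p.L / 20 * V := by
      rw [hLM]
      have : (0 : ℝ) ≤ M := by positivity
      nlinarith
    rw [sub_mul, h3]
    nlinarith

/-- The value of the best solution found. -/
theorem le_best {m : Mem}
    (hb : I.params.Best m fun x w j => x < I.params.K ∧ w < I.params.K ∧ j < I.params.N)
    {S : I.Solution} (h : S.Feasible) :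
    19 / 240 * S.value ≤ m aBC 0 * (I.params.ratio (m aBP 0) / (3 * I.params.L)) := by
  have hL0 : (0 : ℝ) < I.params.L := by exact_mod_cast I.unitL_pos
  have hnn : 0 ≤ (m aBC 0 : ℝ) * (I.params.ratio (m aBP 0) / (3 * I.params.L)) :=
    mul_nonneg (by positivity) (div_nonneg (I.params.ratio_nonneg _) (by positivity))
  rcases le_or_gt S.value 0 with h0 | h0
  · linarith
  set O := S.purchased.image Fin.val with hO
  have hOsub : O ⊆ Finset.range I.n := fun v hv => by
    obtain ⟨w, _, rfl⟩ := Finset.mem_image.mp hv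
    simp
  have hprice : ∀ v ∈ S.purchased, (I.price v : ℝ) ≤ I.budget := fun v hv =>
    (Finset.single_le_sum (f := fun v => (I.price v : ℝ)) (fun v _ => NNRat.cast_nonneg _) hv).trans
      h.budget
  have haff : ∀ v ∈ O, I.params.Aff v := fun v hv => by
    obtain ⟨w, hw, rfl⟩ := Finset.mem_image.mp hv
    exact (aff_iff w).mpr (hprice w hw)
  -- The purchases cost at most `2n` units before rounding, and each of the at most `n` prices is
  -- rounded up by at most one unit.
  have hsum : ∑ v ∈ O, I.params.price v ≤ 3 * I.n := by
    rw [hO, Finset.sum_image fun v _ w _ e => Fin.ext e]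
    by_cases hk : I.budget = 0
    · refine (Finset.sum_nonpos fun v _ => ?_).trans (Nat.zero_le _)
      have : I.params.inp 2 = 0 := hk
      simp [Params.price, this]
    have hk0 : (0 : ℝ) < I.budget := by exact_mod_cast Nat.pos_of_ne_zero hk
    have h1 := Finset.sum_le_sum fun v (_ : v ∈ S.purchased) => (price_bounds v hk).2
    rw [← Finset.sum_mul, Finset.sum_add_distrib, ← Finset.sum_mul, Finset.sum_const,
      nsmul_eq_mul] at h1
    have hcard : (S.purchased.card : ℝ) ≤ I.n := by
      exact_mod_cast (Finset.card_le_univ _).trans (by simp)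
    have h2 : (∑ v ∈ S.purchased, (I.params.price v : ℝ)) * I.budget ≤ 3 * I.n * I.budget := by
      refine h1.trans ?_
      have := mul_le_mul_of_nonneg_right h.budget (by positivity : (0 : ℝ) ≤ 2 * I.n)
      have := mul_le_mul_of_nonneg_right hcard hk0.le
      linarith
    have h3 := le_of_mul_le_mul_right h2 hk0
    exact_mod_cast h3
  obtain ⟨x, w, hx, hw, hx0, hx1, hwP, hwD, hle⟩ := exists_unit hOsub h0
    (fun A hs => h.value_le_realP hs) (fun A hs => h.value_le_realD hs)
  obtain ⟨j, hj, hwj⟩ := Params.exists_greedyT hOsub haff hsum hwP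
  have key := hb.best x w j ⟨hx, hw, hj⟩ hx0 hx1
  set c := min (I.params.flowP x (I.params.greedyT x w j)) (I.params.flowD x) with hc
  have hwc : w ≤ 4 * c := by omega
  have key' : (c : ℝ) * I.params.ratio x ≤ m aBC 0 * I.params.ratio (m aBP 0) := by
    have h1 : (0 : ℝ) < I.params.inp (x + 1) := by exact_mod_cast Nat.pos_of_ne_zero hx1
    have h2 : (0 : ℝ) < I.params.inp (m aBP 0 + 1) := by exact_mod_cast Nat.pos_of_ne_zero hb.den
    unfold Params.ratio
    rw [← mul_div_assoc, ← mul_div_assoc, div_le_div_iff₀ h1 h2]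
    exact_mod_cast key
  have hwc' : (w : ℝ) * I.params.ratio x ≤ 4 * (c * I.params.ratio x) := by
    rw [← mul_assoc]
    exact mul_le_mul_of_nonneg_right (by exact_mod_cast hwc) (I.params.ratio_nonneg x)
  -- The constant is `19/20 * 1/4 * 1/3`: rounding of capacities, greedy choice, and the triple use
  -- of edges.
  rw [← mul_div_assoc, le_div_iff₀ (by positivity)]
  nlinarith

end Instance

end Middlebox

namespace Middlebox

open Middlebox.Expr Middlebox.Cmd

/-! ## The complete program -/

/-- Store the values of expressions in array `1`. -/
def setup : List (ℕ × Expr) → Prog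
  | [] => .skip
  | (i, e) :: l => .seq (.write 1 (.const i) e) (setup l)

def setupMem : List (ℕ × Expr) → Mem → Mem
  | [], m => m
  | (i, e) :: l, m => setupMem l (m.set 1 i (e.val m))

/-- All values stored have at most `W` bits. -/
def Small (W : ℕ) : List (ℕ × Expr) → Mem → Prop
  | [], _ => True
  | (i, e) :: l, m => (e.val m).size ≤ W ∧ Small W l (m.set 1 i (e.val m))

def setupLen : List (ℕ × Expr) → ℕ
  | [] => 1
  | (i, e) :: l => (Expr.const i).len + e.len + setupLen l

theorem runs_setup {W b : ℕ} (o : List ℕ) (l : List (ℕ × Expr)) (m : Mem) (hb : setupLen l ≤ b)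
    (hm : ∀ a i, (m a i).size ≤ W) (hs : Small W l m) :
    ∃ t, Runs (setup l) ⟨m, o⟩ ⟨setupMem l m, o⟩ t ∧ (∀ a i, (setupMem l m a i).size ≤ W) ∧
      t ≤ (l.length + 1) * (20 * b ^ 2 * (W + 1)) := by
  induction l generalizing m with
  | nil =>
    refine ⟨1, .skip _, hm, ?_⟩
    simp only [setupLen] at hb
    have : 1 ≤ b ^ 2 := Nat.one_le_pow _ _ hb
    simp only [List.length_nil]
    nlinarith
  | cons a l ih =>
    obtain ⟨i, e⟩ := a
    simp only [setupLen] at hb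
    have hw := Runs.write 1 (.const i) e ⟨m, o⟩
    rw [write_eq] at hw
    obtain ⟨t, ht, hsz, htt⟩ := ih (m.set 1 i (e.val m)) (by omega)
      (Mem.size_set_le hm le_rfl hs.1 _ _) hs.2
    refine ⟨_, .seq hw ht, hsz, ?_⟩
    have h1 := Expr.cost_le hm e
    have h2 := Expr.cost_le hm (.const i)
    have h3 := Expr.size_val_le hm e
    have h4 := Expr.size_val_le hm (.const i)
    have hpos : 1 ≤ (Expr.const i).len := by simp [Expr.len]
    have h5 := cost_arith (W := W) (l := b) (i := (Expr.const i).len) (e := e.len) (by omega)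
      (by omega)
    have e1 : (l.length + 1 + 1) * (20 * b ^ 2 * (W + 1)) =
      20 * b ^ 2 * (W + 1) + (l.length + 1) * (20 * b ^ 2 * (W + 1)) := by ring
    rw [List.length_cons, e1]
    exact add_le_add (by dsimp only; omega) htt

/-- Copy the array `aOUT` to the output tape. -/
def flush : Prog :=
  .seq (.write xA 0 0) (.loop (var aOL - var xA)
    (.seq (.emit (.read aOUT (var xA))) (.write xA 0 (var xA + 1))))

theorem runs_flush {W b : ℕ} (o : List ℕ) (m : Mem) (hb : 20 ≤ b)
    (hm : ∀ a i, (m a i).size ≤ W) :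
    ∃ m' t, Runs flush ⟨m, o⟩ ⟨m', o ++ outL m⟩ t ∧
      t ≤ (3 * m aOL 0 + 2) * (20 * b ^ 2 * (W + 1)) := by
  set X := 20 * b ^ 2 * (W + 1) with hX
  have len0 : Nat.size 0 = 0 := Nat.size_zero
  have len1 : Nat.size 1 = 1 := Nat.size_one
  have key : ∀ j i o, i + j = m aOL 0 → ∃ m' t, Runs (.loop (var aOL - var xA)
      (.seq (.emit (.read aOUT (var xA))) (.write xA 0 (var xA + 1)))) ⟨m.set xA 0 i, o⟩
        ⟨m', o ++ (List.range j).map fun k => m aOUT (i + k)⟩ t ∧ t ≤ (3 * j + 1) * X := by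
    intro j
    induction j with
    | zero =>
      intro i o hij
      have hsz : ∀ a k, (m.set xA 0 i a k).size ≤ W := Mem.size_set_le hm le_rfl (by
        rw [show i = m aOL 0 by omega]; exact hm _ _) _ _
      refine ⟨m.set xA 0 i, _, by simpa using Runs.loop_done (by simp [Mem.set_apply]; omega), ?_⟩
      have hc := Expr.cost_le hsz (var aOL - var xA)
      have hlen : (var aOL - var xA : Expr).len = 5 := by
        change 1 + (1 + (1 + Nat.size 0)) + (1 + (1 + Nat.size 0)) = 5
        rw [len0]
      rw [hlen] at hc
      have := cost_arith (W := W) (l := b) (i := 5) (e := 0) (by omega) (by omega)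
      simp only [mul_zero, zero_add, one_mul]
      omega
    | succ j ih =>
      intro i o hij
      have hile : ∀ k ≤ m aOL 0, k.size ≤ W := fun k hk => (Nat.size_le_size hk).trans (hm _ _)
      have hsz : ∀ a k, (m.set xA 0 i a k).size ≤ W :=
        Mem.size_set_le hm le_rfl (hile _ (by omega)) _ _
      set m1 := m.set xA 0 i with hm1
      have hv : (var aOL - var xA : Expr).val m1 ≠ 0 := by
        simp [hm1, Mem.set_apply]; omega
      have he := Runs.emit (.read aOUT (var xA)) ⟨m1, o⟩
      have hev : (Expr.read aOUT (var xA)).val m1 = m aOUT i := by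
        simp [hm1, Mem.set_apply]
      have hw := Runs.write xA 0 (var xA + 1) ⟨m1, o ++ [m aOUT i]⟩
      rw [write_eq] at hw
      have hset : m1.set xA ((0 : Expr).val m1) ((var xA + 1 : Expr).val m1) =
          m.set xA 0 (i + 1) := by
        funext a k
        simp only [hm1, Mem.set_apply, val_zero, val_add, val_read, val_const, val_one]
        by_cases h : a = 6 ∧ k = 0 <;> simp [h]
      dsimp only at hw he
      rw [hset] at hw
      rw [State.emit, hev] at he
      obtain ⟨m', t, ht, htt⟩ := ih (i + 1) (o ++ [m aOUT i]) (by omega)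
      have hrun := Runs.loop_step hv (.seq he hw) ht
      have eo : o ++ [m aOUT i] ++ (List.range j).map (fun k => m aOUT (i + 1 + k)) =
          o ++ (List.range (j + 1)).map fun k => m aOUT (i + k) := by
        rw [List.range_succ_eq_map]
        simp [Function.comp_def, Nat.add_assoc, Nat.add_comm 1]
      rw [eo] at hrun
      refine ⟨m', _, hrun, ?_⟩
      · have hc := Expr.cost_le hsz (var aOL - var xA)
        have hlen : (var aOL - var xA : Expr).len = 5 := by
          change 1 + (1 + (1 + Nat.size 0)) + (1 + (1 + Nat.size 0)) = 5
          rw [len0]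
        have hlen' : (Expr.read aOUT (var xA)).len = 3 := by
          change 1 + (1 + (1 + Nat.size 0)) = 3
          rw [len0]
        have hlen'' : (var xA + 1 : Expr).len ≤ 5 := by
          change 1 + (1 + (1 + Nat.size 0)) + (1 + Nat.size 1) ≤ _
          rw [len0, len1]
        rw [hlen] at hc
        have he1 := Expr.cost_le hsz (.read aOUT (var xA))
        have he2 := Expr.size_val_le hsz (.read aOUT (var xA))
        rw [hlen'] at he1 he2
        have a1 := cost_arith (W := W) (l := b) (i := 5) (e := 0) (by omega) (by omega)
        have a2 := cost_arith (W := W) (l := b) (i := 3) (e := 0) (by omega) (by omega)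
        have a3 := write_cost hsz hlen'' hb
        have e1 : (3 * (j + 1) + 1) * X = X + X + X + (3 * j + 1) * X := by ring
        rw [hev] at he2
        rw [e1]
        dsimp only
        omega
  obtain ⟨m', t, ht, htt⟩ := key (m aOL 0) 0 o (by omega)
  have hw := Runs.write xA 0 0 ⟨m, o⟩
  rw [write_eq] at hw
  have hrun := Runs.seq hw ht
  simp only [zero_add] at hrun
  refine ⟨m', _, hrun, ?_⟩
  · have hl0 : (0 : Expr).len ≤ 5 := by change 1 + Nat.size 0 ≤ 5; rw [len0]; omega
    have a3 := write_cost hm hl0 hb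
    have e1 : (3 * m aOL 0 + 2) * X = X + (3 * m aOL 0 + 1) * X := by ring
    rw [e1]
    exact add_le_add a3 htt

/-- The square of the size of the network, as an expression. -/
def cutSizeE : Expr := (.read 0 0 + .read 0 3 + 1) * (.read 0 0 + .read 0 3 + 1)

def twentyE : Expr := .const 20

/-- The parameters of an instance, as expressions. -/
def paramExprs : List (ℕ × Expr) :=
  [(0, .read 0 0), (1, .read 0 3), (2, .read 0 0 + (.read 0 0 + .read 0 3) + 1),
    (3, cutSizeE * (twentyE * (cutSizeE + 1))), (4, twentyE * (cutSizeE + 1)), (5, .read 0 1)]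

/-- The parameters fill array 1 and involve iterated products, so they are computed before the
restricted language takes over. Since commands cannot emit, the output is collected in an array and
copied at the end. -/
def approx : Prog := .seq (setup paramExprs) (.seq main.toProg flush)

namespace Instance

variable (I : Instance)

/-- The memory after the parameters have been computed. -/
def startMem : Mem := setupMem paramExprs (initState I.encode).mem

theorem startMem_eq (a i : ℕ) : I.startMem a i = if a = 0 then I.inp i else if a = 1 then
    (if i = 0 then I.n else if i = 1 then I.numDemands else if i = 2 then I.params.N else
      if i = 3 then I.params.K else if i = 4 then I.params.L else if i = 5 then I.source else 0)
    else 0 := by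
  have i0 : I.encode.getD 0 0 = I.n := rfl
  have i1 : I.encode.getD 1 0 = I.source := rfl
  have i3 : I.encode.getD 3 0 = I.numDemands := rfl
  have eN : I.params.N = I.n + (I.n + I.numDemands) + 1 := rfl
  have eK : I.params.K = I.cutSize * (20 * (I.cutSize + 1)) := rfl
  have eL : I.params.L = 20 * (I.cutSize + 1) := rfl
  simp only [startMem, paramExprs, setupMem, Mem.set_apply, val_read, val_zero, val_three, val_add,
    val_one, val_mul, initState, cutSizeE, twentyE, val_const, i0, i1, i3, eN, eK, eL, cutSize, inp]
  by_cases h0 : a = 0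
  · subst h0; simp
  by_cases h1 : a = 1
  · subst h1
    by_cases c0 : i = 0
    · subst c0; simp
    by_cases c1 : i = 1
    · subst c1; simp
    by_cases c2 : i = 2
    · subst c2; simp
    by_cases c3 : i = 3
    · subst c3; simp
    by_cases c4 : i = 4
    · subst c4; simp
    by_cases c5 : i = 5
    · subst c5; simp
    simp [c0, c1, c2, c3, c4, c5]
  · simp [h0, h1]

theorem holds_startMem : I.params.Holds I.startMem := by
  refine ⟨funext fun i => ?_, ?_, ?_, ?_, ?_, ?_, ?_⟩ <;> rw [startMem_eq] <;> rfl

theorem length_le_bitSize (l : List ℕ) : l.length ≤ bitSize l := by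
  induction l with
  | nil => simp
  | cons a l ih => simp only [bitSize, List.map_cons, List.sum_cons, List.length_cons] at *; omega

theorem size_le_bitSize {l : List ℕ} {w : ℕ} (h : w ∈ l) : w.size ≤ bitSize l := by
  induction l with
  | nil => simp at h
  | cons a l ih =>
    simp only [bitSize, List.map_cons, List.sum_cons] at *
    rcases List.mem_cons.mp h with rfl | h
    · omega
    · have := ih h; omega

theorem size_le_self (k : ℕ) : k.size ≤ k := Nat.size_le.mpr Nat.lt_two_pow_self

/-- A bound on the parameters in terms of the bit size. -/
def paramBound (b : ℕ) : ℕ := 20 * (b ^ 2 + 1) ^ 2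

theorem le_paramBound (b : ℕ) : b ≤ paramBound b := by unfold paramBound; nlinarith

theorem cutSize_le : I.cutSize ≤ bitSize I.encode ^ 2 := by
  have h := length_le_bitSize I.encode
  rw [encode_length] at h
  rw [cutSize, sq]
  exact Nat.mul_le_mul (by omega) (by omega)

theorem params_le {k : ℕ} (h : k = I.n ∨ k = I.numDemands ∨ k = I.params.N ∨ k = I.params.K ∨
    k = I.params.L ∨ k = I.source) : k ≤ paramBound (bitSize I.encode) := by
  have h1 := length_le_bitSize I.encode
  have h2 := le_paramBound (bitSize I.encode)
  have h3 := I.cutSize_le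
  have eN : I.params.N = I.n + (I.n + I.numDemands) + 1 := rfl
  have eK : I.params.K = I.cutSize * (20 * (I.cutSize + 1)) := rfl
  have eL : I.params.L = 20 * (I.cutSize + 1) := rfl
  have hs := I.source.2
  rw [encode_length] at h1
  rcases h with h | h | h | h | h | h
  · omega
  · omega
  · omega
  · rw [h, eK, paramBound]; nlinarith
  · rw [h, eL, paramBound]; nlinarith
  · omega

theorem startMem_one_le (i : ℕ) : I.startMem 1 i ≤ paramBound (bitSize I.encode) := by
  rw [startMem_eq, if_neg (by omega), if_pos rfl]
  split_ifs
  · exact I.params_le (by simp)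
  · exact I.params_le (by simp)
  · exact I.params_le (by simp)
  · exact I.params_le (by simp)
  · exact I.params_le (by simp)
  · exact I.params_le (by simp)
  · exact Nat.zero_le _

theorem size_initState_le (a i : ℕ) :
    ((initState I.encode).mem a i).size ≤ paramBound (bitSize I.encode) := by
  have h2 := le_paramBound (bitSize I.encode)
  simp only [initState]
  split_ifs
  · rw [List.getD_eq_getElem?_getD]
    by_cases hi : i < I.encode.length
    · rw [List.getElem?_eq_getElem hi, Option.getD_some]
      exact (size_le_bitSize (List.getElem_mem hi)).trans h2
    · rw [List.getElem?_eq_none (by omega)]; simp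
  · simp

theorem small_paramExprs :
    Small (paramBound (bitSize I.encode)) paramExprs (initState I.encode).mem := by
  have hsz : ∀ {k : ℕ}, (k = I.n ∨ k = I.numDemands ∨ k = I.params.N ∨ k = I.params.K ∨
    k = I.params.L ∨ k = I.source) → k.size ≤ paramBound (bitSize I.encode) := fun h =>
      (size_le_self _).trans (I.params_le h)
  refine ⟨hsz (Or.inl rfl), hsz (Or.inr (Or.inl rfl)), hsz (Or.inr (Or.inr (Or.inl rfl))),
    hsz (Or.inr (Or.inr (Or.inr (Or.inl rfl)))),
    hsz (Or.inr (Or.inr (Or.inr (Or.inr (Or.inl rfl))))),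
    hsz (Or.inr (Or.inr (Or.inr (Or.inr (Or.inr rfl))))), trivial⟩

theorem length_block_le {x : ℕ} {T : Finset ℕ} {r : Rec} (h : I.params.RecOk x T r) :
    (I.params.block x r).length ≤ 5 + 3 * I.params.N := by
  have h1 := h.pathP.le
  have h2 := h.pathQ.le
  have h3 := h.hs_lt
  have h4 := h.ms_lt
  simp only [Params.block, Rec.walk, List.length_append, List.length_map, List.length_range,
    List.length_cons, List.length_nil]
  omega

/-- The output of the program describes a good solution. -/
theorem main_spec : ∃ S : I.Solution, S.EncodedBy (outL (main.run I.startMem)) ∧ S.Feasible ∧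
    19 / 240 * I.opt ≤ S.value ∧
    main.run I.startMem aOL 0 ≤ I.n + 1 + I.params.K * (5 + 3 * I.params.N) := by
  have hr := attach_spec I.holds_startMem
  obtain ⟨hr', hb⟩ := search_spec hr I.inp_five
  obtain ⟨hq, hpos, hbt, hbc, hf1, hf2⟩ := bestFlows_spec hr'
  set m := search.run (attach.run I.startMem) with hm
  have hrun : main.run I.startMem = output.run (bestFlows.run m) := rfl
  rw [hrun]
  set m4 := bestFlows.run m
  have hK : m aBC 0 ≤ I.params.K := hb.le_flowP.trans (min_le_left _ _)
  obtain ⟨rs, hlen, hok, u1, u2, hout⟩ := output_spec hq hpos hf1 hf2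
    (by rw [hbc]; exact hb.le_flowP) (by rw [hbc]; exact hb.le_flowD) (by rw [hbc]; exact hK)
  rw [hbc] at hlen
  obtain ⟨S, hS, hval, henc⟩ := exists_solution hb.valid hb.den hf1 hf2 hok u1 u2
  have hind : (List.range I.n).map (fun v => 1 - (1 - m4 aBT v)) =
      (List.finRange I.n).map fun v : Fin I.n => if v.1 ∈ tset I.n (m aBT) then 1 else 0 := by
    rw [← List.map_coe_finRange_eq_range, List.map_map]
    refine List.map_congr_left fun v _ => ?_
    simp only [Function.comp_apply, mem_tset, v.2, true_and, hbt]
    split_ifs with h <;> omega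
  have hout' : outL (output.run m4) = ((List.finRange I.n).map fun v : Fin I.n =>
      if v.1 ∈ tset I.n (m aBT) then 1 else 0) ++ [rs.length] ++
      (rs.map (I.params.block (m aBP 0))).flatten := by
    rw [hout, hbc, hlen, ← hind]; rfl
  refine ⟨S, by rw [hout']; exact henc, hS, ?_, ?_⟩
  · have : ∀ x ∈ {x | ∃ S : I.Solution, S.Feasible ∧ S.value = x}, x ≤ 240 / 19 * S.value := by
      rintro _ ⟨S', h', rfl⟩
      have := le_best hb h'
      rw [← hlen, ← hval] at this
      linarith
    have := csSup_le ⟨0, zero_mem_values⟩ this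
    rw [← opt] at this
    linarith
  -- The number of words controls the cost of the final copying: at most `K` blocks, each of length
  -- linear in `N`.
  · have hl : (outL (output.run m4)).length = output.run m4 aOL 0 := by simp [outL]
    rw [← hl, hout']
    have hfl : (rs.map (I.params.block (m aBP 0))).flatten.length ≤
        rs.length * (5 + 3 * I.params.N) := by
      clear * - hok
      induction rs with
      | nil => simp
      | cons r rs ih =>
        have h1 := I.length_block_le (hok r (by simp))
        have h2 := ih fun r hr => hok r (by simp [hr])
        simp only [List.map_cons, List.flatten_cons, List.length_append, List.length_cons, add_mul,
          one_mul] at h2 ⊢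
        omega
    have h3 : rs.length * (5 + 3 * I.params.N) ≤ I.params.K * (5 + 3 * I.params.N) :=
      Nat.mul_le_mul_right _ (by rw [hlen]; exact hK)
    simp only [List.length_append, List.length_map, List.length_finRange, List.length_cons,
      List.length_nil]
    omega

end Instance

-- All parameters, and the bit lengths of all input words, are at most `β = 20 (b ^ 2 + 1) ^ 2` for
-- inputs of `b` bits. Substituting `β` for loop bounds and word lengths in the three cost estimates
-- gives the polynomial.
open Polynomial in
theorem isPolyTimeApprox_approx : IsPolyTimeApprox approx (19 / 240) := by
  set β : ℕ[X] := 20 * (X ^ 2 + 1) ^ 2 with hβ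
  set σ : ℕ[X] := main.stepsPoly.comp β
  set l : ℕ := main.len + 20
  set ω : ℕ[X] := β + σ * ((l : ℕ[X]) * (β + 1))
  refine ⟨((paramExprs.length : ℕ[X]) + 1) * (20 * (setupLen paramExprs : ℕ[X]) ^ 2 * (β + 1)) +
    (σ * (20 * (l : ℕ[X]) ^ 2 * (ω + 1)) +
    (3 * (β + 1 + β * (5 + 3 * β)) + 2) * (20 * (l : ℕ[X]) ^ 2 * (ω + 1))), fun I => ?_⟩
  set b := bitSize I.encode with hb
  set B := Instance.paramBound b with hB
  have evβ : β.eval b = B := by simp [hβ, hB, Instance.paramBound]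
  have evσ : σ.eval b = main.steps B := by
    simp only [σ, eval_comp, evβ, eval_stepsPoly]
  set W := B + main.steps B * (l * (B + 1)) with hW
  have evω : ω.eval b = W := by
    simp only [ω, eval_add, eval_mul, eval_natCast, eval_one, evβ, evσ, hW, Nat.cast_id]
  obtain ⟨t1, r1, s1, c1⟩ := runs_setup [] paramExprs (initState I.encode).mem le_rfl
    I.size_initState_le I.small_paramExprs
  obtain ⟨t2, r2, s2, c2⟩ := exec main main_ok (Nat.le_add_right main.len 20) [] I.startMem B
    I.startMem_one_le (fun i => s1 0 i) (fun i => s1 1 i) s1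
  obtain ⟨m', t3, r3, c3⟩ := runs_flush (b := l) [] (main.run I.startMem) (Nat.le_add_left _ _) s2
  obtain ⟨S, henc, hS, hval, hlen⟩ := I.main_spec
  refine ⟨_, _, .seq r1 (.seq r2 r3), ?_, S, by simpa using henc, hS, hval⟩
  simp only [eval_add, eval_mul, eval_natCast, eval_one, eval_pow, eval_ofNat, evβ, evσ, evω,
    Nat.cast_id]
  refine add_le_add c1 (add_le_add c2 (c3.trans ?_))
  refine Nat.mul_le_mul_right _ ?_
  have hn : _ ≤ B := I.params_le (Or.inl rfl)
  have hN : _ ≤ B := I.params_le (Or.inr (Or.inr (Or.inl rfl)))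
  have hK : _ ≤ B := I.params_le (Or.inr (Or.inr (Or.inr (Or.inl rfl))))
  have : I.params.K * (5 + 3 * I.params.N) ≤ B * (5 + 3 * B) :=
    Nat.mul_le_mul hK (by omega)
  omega

theorem Instance.opt_nonneg (I : Instance) : 0 ≤ I.opt :=
  le_csSup bddAbove_values zero_mem_values

theorem IsPolyTimeApprox.mono {p : Prog} {α β : ℝ} (h : IsPolyTimeApprox p β) (hαβ : α ≤ β) :
    IsPolyTimeApprox p α := by
  obtain ⟨P, hP⟩ := h
  refine ⟨P, fun I => ?_⟩
  obtain ⟨τ, t, h1, h2, S, h3, h4, h5⟩ := hP I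
  exact ⟨τ, t, h1, h2, S, h3, h4, (mul_le_mul_of_nonneg_right hαβ I.opt_nonneg).trans h5⟩

end Middlebox

theorem mainTheorem7 :
    ∃ p : Middlebox.Prog,
      Middlebox.IsPolyTimeApprox p ((1 - 1 / Real.exp 1) / 8) := by
  refine ⟨Middlebox.approx, Middlebox.isPolyTimeApprox_approx.mono ?_⟩
  -- The number `11/30` is the one for which `(1 - 11/30) / 8 = 19/240`.
  have h1 : Real.exp 1 < 30 / 11 := Real.exp_one_lt_d9.trans (by norm_num)
  have h2 : (11 : ℝ) / 30 ≤ 1 / Real.exp 1 := by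
    rw [div_le_div_iff₀ (by norm_num) (Real.exp_pos 1)]
    linarith
  linarith
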